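/- Let $n\ge 1$, let $U=\{|w|<1\}\subset\mathbb C$, and let $U^n\subset\mathbb C^n$ be the unit polydisc with Lebesgue measure $m_{2n}$. Let $S$ be the class of positive measurable functions $\omega$ on $(0,1)$ for which there are $M>0$ and $q,m\in(0,1)$ with $$m\le \frac{\omega(\lambda r)}{\omega(r)}\le M\qquad (r\in(0,1),\ \lambda\in[q,1]).$$ For $\omega\in S$ let $\alpha_\omega$ be the infimum of the numbers $a$ given by $-a=\log m/\log q^{-1}$ over all pairs $q,m\in(0,1)$ for which the lower estimate $m\le\omega(\lambda r)/\omega(r)$ holds for all $r\in(0,1)$, $\lambda\in[q,1]$; and let $\beta_\omega$ be the infimum of all real $b$ for which there is $C>0$ with $\omega(\lambda r)\le C\lambda^{-b}\omega(r)$ for all $r\in(0,1)$, $\lambda\in(0,1]$. (For $\omega(t)=t^a$ with $a>0$: $\alpha_\omega=a$, $\beta_\omega=-a$.) Let $\omega=(\omega_1,\dots,\omega_n)$ with $\omega_j\in S$ and $\beta_{\omega_j}<-1$ for $1\le j\le n$. For $0<p<1$ let $B_p(\omega)$ be the space of holomorphic functions $f$ on $U^n$ with $$\|f\|_{B_p(\omega)}^p=\int_{U^n}|Df(z)|^p\prod_{j=1}^n\frac{\omega_j(1-|z_j|)}{(1-|z_j|^2)^{2-p}}\,dm_{2n}(z)<\infty,\qquad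 Df=\frac{\partial^n(z_1\cdots z_n f)}{\partial z_1\cdots\partial z_n},$$ and let $\overline B_p(\omega)=\{\overline f: f\in B_p(\omega)\}$ with $\|\overline f\|_{\overline B_p(\omega)}=\|f\|_{B_p(\omega)}$. For $\alpha=(\alpha_1,\dots,\alpha_n)$ with $\alpha_j>-1$ and $g\in L^\infty(U^n)$, the generalized little Hankel operator is $$h^\alpha_g(f)(z)=\int_{U^n}\prod_{j=1}^n\frac{(1-|\zeta_j|^2)^{\alpha_j}}{(1-\zeta_j\overline{z_j})^{\alpha_j+2}}\,f(\zeta)g(\zeta)\,dm_{2n}(\zeta),\qquad z\in U^n .$$ **Theorem.** Let $0<p<1$, and let $\omega$, $\alpha$ be as above. Let $X$ be either $B_p(\omega)$ or $\overline B_p(\omega)$. Then the following are equivalent: 1. for every $f\in X$ and every $g\in L^\infty(U^n)$ the integral defining $h^\alpha_g(f)$ converges absolutely at every point of $U^n$, and $h^\alpha_g(f)\in\overline B_p(\omega)$; 2. $\alpha_j>\alpha_{\omega_j}/p-2$ for every $1\le j\le n$. Moreover, if 2 holds, then there is a constant $C$ depending only on $n,p,\omega,\alpha$ such that for both choices of $X$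 $$\|h^\alpha_g(f)\|_{\overline B_p(\omega)}\le C\,\|g\|_{\infty}\,\|f\|_{X}\qquad (f\in X,\ g\in L^\infty(U^n)).$$ -/

import Mathlib

open MeasureTheory
open scoped ENNReal NNReal

/-- The class `S`: positive measurable weights on `(0,1)` such that, for some `M > 0` and
`q, m ∈ (0,1)`, one has `m ≤ ω (l * r) / ω r ≤ M` for all `r ∈ (0,1)` and `l ∈ [q,1]`.
(Only the values of `ω` on `(0,1)` matter.) -/
structure RegularWeight (ω : ℝ → ℝ) : Prop where
  measurable : Measurable (fun t : Set.Ioo (0 : ℝ) 1 => ω t)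
  pos : ∀ t ∈ Set.Ioo (0 : ℝ) 1, 0 < ω t
  ratio : ∃ M q m : ℝ, 0 < M ∧ q ∈ Set.Ioo (0 : ℝ) 1 ∧ m ∈ Set.Ioo (0 : ℝ) 1 ∧
    ∀ r ∈ Set.Ioo (0 : ℝ) 1, ∀ l ∈ Set.Icc q 1,
      m ≤ ω (l * r) / ω r ∧ ω (l * r) / ω r ≤ M

/-- The exponent `α_ω`, determined by `-α_ω = log m / log q⁻¹`, for the best (smallest possible)
choice of the admissible constants `q, m ∈ (0,1)` in the lower estimate
`m ≤ ω (l * r) / ω r`, `r ∈ (0,1)`, `l ∈ [q,1]`. For `ω t = t ^ a`, `0 < a`, it equals `a`. -/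
noncomputable def alphaIndex (ω : ℝ → ℝ) : ℝ :=
  sInf {a : ℝ | ∃ q ∈ Set.Ioo (0 : ℝ) 1, ∃ m ∈ Set.Ioo (0 : ℝ) 1,
    (∀ r ∈ Set.Ioo (0 : ℝ) 1, ∀ l ∈ Set.Icc q 1, m ≤ ω (l * r) / ω r) ∧
      -a = Real.log m / Real.log q⁻¹}

/-- The exponent `β_ω`: the best (smallest possible) `b` in the upper estimate
`ω (l * r) ≤ C * l ^ (-b) * ω r`, `r ∈ (0,1)`, `l ∈ (0,1]`. For `ω t = t ^ a` it equals `-a`. -/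
noncomputable def betaIndex (ω : ℝ → ℝ) : ℝ :=
  sInf {b : ℝ | ∃ C : ℝ, 0 < C ∧
    ∀ r ∈ Set.Ioo (0 : ℝ) 1, ∀ l ∈ Set.Ioc (0 : ℝ) 1, ω (l * r) ≤ C * l ^ (-b) * ω r}

/-- The open unit polydisc `U^n`. -/
def polydisc (n : ℕ) : Set (Fin n → ℂ) := {z | ∀ j, ‖z j‖ < 1}

/-- The complex partial derivative `∂F/∂z_j`. -/
noncomputable def partialDeriv {n : ℕ} (j : Fin n) (F : (Fin n → ℂ) → ℂ) : (Fin n → ℂ) → ℂ :=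
  fun z => deriv (fun w : ℂ => F (Function.update z j w)) (z j)

/-- `D f = ∂^n (z_1 ⋯ z_n f) / ∂z_1 ⋯ ∂z_n`. -/
noncomputable def besovD {n : ℕ} (f : (Fin n → ℂ) → ℂ) : (Fin n → ℂ) → ℂ :=
  (List.finRange n).foldr partialDeriv (fun z => (∏ j, z j) * f z)

/-- `‖f‖^p = ∫_{U^n} |Df(z)|^p ∏_j ω_j(1-|z_j|) / (1-|z_j|²)^{2-p} dm_{2n}(z)`, in `[0,∞]`. -/
noncomputable def besovPow {n : ℕ} (p : ℝ) (ω : Fin n → ℝ → ℝ) (f : (Fin n → ℂ) → ℂ) : ℝ≥0∞ :=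
  ∫⁻ z in polydisc n, ENNReal.ofReal
    (‖besovD f z‖ ^ p * ∏ j, ω j (1 - ‖z j‖) / (1 - ‖z j‖ ^ 2) ^ (2 - p))

/-- The (quasi-)norm of `B_p(ω)`, in `[0,∞]`. -/
noncomputable def besovNorm {n : ℕ} (p : ℝ) (ω : Fin n → ℝ → ℝ) (f : (Fin n → ℂ) → ℂ) : ℝ≥0∞ :=
  besovPow p ω f ^ (1 / p)

/-- `f ∈ B_p(ω)`. -/
def MemBesov {n : ℕ} (p : ℝ) (ω : Fin n → ℝ → ℝ) (f : (Fin n → ℂ) → ℂ) : Prop :=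
  DifferentiableOn ℂ f (polydisc n) ∧ besovPow p ω f < ∞

/-- The pointwise complex conjugate of a function. -/
noncomputable def conjFun {n : ℕ} (f : (Fin n → ℂ) → ℂ) : (Fin n → ℂ) → ℂ :=
  fun z => starRingEnd ℂ (f z)

/-- `f` lies in the conjugate space of `B_p(ω)`; its norm there is `besovNorm p ω (conjFun f)`. -/
def MemConjBesov {n : ℕ} (p : ℝ) (ω : Fin n → ℝ → ℝ) (f : (Fin n → ℂ) → ℂ) : Prop :=
  MemBesov p ω (conjFun f)

/-- The integrand of the generalized little Hankel operator. -/
noncomputable def hankelIntegrand {n : ℕ} (α : Fin n → ℝ) (g f : (Fin n → ℂ) → ℂ)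
    (z ζ : Fin n → ℂ) : ℂ :=
  (∏ j, (((1 - ‖ζ j‖ ^ 2) ^ (α j) : ℝ) : ℂ) /
      (1 - ζ j * starRingEnd ℂ (z j)) ^ ((α j + 2 : ℝ) : ℂ)) * f ζ * g ζ

/-- The integral defining the little Hankel operator converges at every point of `U^n`. -/
def HankelDefined {n : ℕ} (α : Fin n → ℝ) (g f : (Fin n → ℂ) → ℂ) : Prop :=
  ∀ z ∈ polydisc n, IntegrableOn (hankelIntegrand α g f z) (polydisc n)

/-- The generalized little Hankel operator with symbol `g`. -/
noncomputable def hankel {n : ℕ} (α : Fin n → ℝ) (g f : (Fin n → ℂ) → ℂ) : (Fin n → ℂ) → ℂ :=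
  fun z => ∫ ζ in polydisc n, hankelIntegrand α g f z ζ

/-- `g ∈ L^∞(U^n)`. -/
def MemLinfty {n : ℕ} (g : (Fin n → ℂ) → ℂ) : Prop :=
  MemLp g ∞ (volume.restrict (polydisc n))

/-- The norm of `L^∞(U^n)`. -/
noncomputable def linftyNorm {n : ℕ} (g : (Fin n → ℂ) → ℂ) : ℝ≥0∞ :=
  eLpNorm g ∞ (volume.restrict (polydisc n))

/-!
The complex conjugate of `h^α_g f` is a holomorphic function
`F(z) = ∫ Q(ζ) ∏ (1 - ζ̄_j z_j)^{-(α_j + 2)}`, where `Q` is the conjugate of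
`∏ (1 - |ζ_j|²)^{α_j} f g`, and the operator `D` is a composition of one-variable operators
`∂_j (z_j ·)`. Hence `D F` is given by the kernel with factors
`∂_z (z (1 - ζ̄ z)^{-(α_j + 2)})`, of size at most a constant times `|1 - ζ̄ z|^{-(α_j + 3)}`
(`besovD_conjFun_hankel`, `norm_cpowKernel_add_le`).

*Sufficiency* (`exists_hankel_bound`). The engine is `exists_schur_bound`: for `p < 1` and a
holomorphic `ψ` one has `(∫ |ψ| κ)^p ≤ C ∫ |ψ|^p κ^p ∏ (1 - |y_j|)^{2p-2}` for all slowly varying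
kernels `κ` (`exists_lintegral_rpow_le`), because `|ψ|^p` satisfies a mean value inequality on
Whitney discs. Raising the kernel to the power `p` and integrating first in the other variable, one
is left with the one-variable weighted Forelli–Rudin estimate
`WeightGrowth.exists_forelliRudin`. The index conditions enter through two-sided power bounds
`c λ^A ω(r) ≤ ω(λ r) ≤ C λ^s ω(r)` with `s > 1` and any `A > α_ω`
(`RegularWeight.exists_growth`). The bound is used twice. First, `f` is dominated by an integral
operator of high order applied to `D f` (`exists_enorm_le_lintegral_besovD`), which gives
`∫ |f|^p ∏ ω_j (1 - |y_j|)^{-2} ≤ C ‖f‖^p`; then it is applied to the kernel of `D F`, and the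
condition `A_j < p (α_j + 2)` is exactly what the Forelli–Rudin estimate requires. Only `|f|`
enters, so the spaces `B_p(ω)` and its conjugate are treated simultaneously.

*Necessity* (`alphaIndex_lt_of_forall_memConjBesov`). Put `b = p (α_j + 2)`, `t_l = 2^{-l-6}` and
`a_l = ω_j(t_l) t_l^{-b}`. If `∑_{l ≤ k} a_l ≤ D a_k` for all `k`, then `a_l` grows geometrically,
which improves the exponent `b` and gives `α_{ω_j} < b` (`alphaIndex_lt_of_dyadic_sum_le`).
Otherwise there are `k_i` with `∑_{l ≤ k_i} a_l > 4^i a_{k_i}`. The lacunary function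
`∑_i 2^{-i/p} φ_{k_i}(z_j)`, where `φ_k` is a normalized power of the Cauchy kernel concentrated at
distance `t_k` from `1`, lies in `B_p(ω)`. Let `g` be the conjugate of the argument of `f`, cut
off to a nontangential region at `1` in every variable. If this region is narrow, then all kernels
have positive real part there, nothing cancels, and comparing `D F` with `φ_{k_i}` on the dyadic
discs of generations `l ≤ k_i` shows that the norm of `h^α_g f` exceeds every `c 2^i`.
-/


/-! ### One-dimensional power integrals and the Forelli–Rudin estimate -/

theorem lintegral_Ioc_rpow_le {σ δ : ℝ} (hσ : -1 < σ) (hδ : 0 < δ) :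
    ∫⁻ t in Set.Ioc 0 δ, ENNReal.ofReal (t ^ σ) = ENNReal.ofReal (δ ^ (σ + 1) / (σ + 1)) := by
  have hint : IntegrableOn (fun t : ℝ => t ^ σ) (Set.Ioc 0 δ) :=
    (intervalIntegrable_iff_integrableOn_Ioc_of_le hδ.le).1 (intervalIntegral.intervalIntegrable_rpow' hσ)
  rw [← ofReal_integral_eq_lintegral_ofReal hint]
  · rw [← intervalIntegral.integral_of_le hδ.le, integral_rpow (Or.inl hσ),
      Real.zero_rpow (by linarith), sub_zero]
  · filter_upwards [ae_restrict_mem measurableSet_Ioc] with t ht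
    exact Real.rpow_nonneg ht.1.le _

theorem lintegral_Ioi_rpow_eq {σ δ : ℝ} (hσ : σ < -1) (hδ : 0 < δ) :
    ∫⁻ t in Set.Ioi δ, ENNReal.ofReal (t ^ σ) = ENNReal.ofReal (-δ ^ (σ + 1) / (σ + 1)) := by
  rw [← ofReal_integral_eq_lintegral_ofReal (integrableOn_Ioi_rpow_of_lt hσ hδ)]
  · rw [integral_Ioi_rpow_of_lt hσ hδ]
  · filter_upwards [ae_restrict_mem measurableSet_Ioi] with t ht
    exact Real.rpow_nonneg (hδ.trans ht).le _

/-- The integral is split at `t = δ`. -/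
theorem exists_lintegral_rpow_mul_add_rpow_le {σ e : ℝ} (hσ : -1 < σ) (he : σ + 1 < e) :
    ∃ C : ℝ, 0 < C ∧ ∀ δ : ℝ, 0 < δ →
      ∫⁻ t in Set.Ioi (0 : ℝ), ENNReal.ofReal (t ^ σ * (t + δ) ^ (-e)) ≤
        ENNReal.ofReal (C * δ ^ (σ + 1 - e)) := by
  have h1 : 0 < σ + 1 := by linarith
  have h2 : 0 < e - σ - 1 := by linarith
  refine ⟨1 / (σ + 1) + 1 / (e - σ - 1), by positivity, fun δ hδ => ?_⟩
  rw [← Set.Ioc_union_Ioi_eq_Ioi hδ.le,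
    lintegral_union measurableSet_Ioi (Set.Ioc_disjoint_Ioi le_rfl)]
  have A : ∫⁻ t in Set.Ioc 0 δ, ENNReal.ofReal (t ^ σ * (t + δ) ^ (-e)) ≤
      ENNReal.ofReal (1 / (σ + 1) * δ ^ (σ + 1 - e)) := by
    calc ∫⁻ t in Set.Ioc 0 δ, ENNReal.ofReal (t ^ σ * (t + δ) ^ (-e))
        ≤ ∫⁻ t in Set.Ioc 0 δ, ENNReal.ofReal (δ ^ (-e)) * ENNReal.ofReal (t ^ σ) := by
          refine setLIntegral_mono' measurableSet_Ioc fun t ht => ?_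
          have h0 := Real.rpow_nonneg ht.1.le σ
          rw [← ENNReal.ofReal_mul (by positivity), mul_comm (δ ^ (-e))]
          refine ENNReal.ofReal_le_ofReal (mul_le_mul_of_nonneg_left ?_ h0)
          exact Real.rpow_le_rpow_of_nonpos hδ (by linarith [ht.1]) (by linarith)
      _ = ENNReal.ofReal (1 / (σ + 1) * δ ^ (σ + 1 - e)) := by
          rw [lintegral_const_mul' _ _ ENNReal.ofReal_ne_top, lintegral_Ioc_rpow_le hσ hδ,
            ← ENNReal.ofReal_mul (by positivity), sub_eq_add_neg, Real.rpow_add hδ (σ + 1)]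
          ring_nf
  have B : ∫⁻ t in Set.Ioi δ, ENNReal.ofReal (t ^ σ * (t + δ) ^ (-e)) ≤
      ENNReal.ofReal (1 / (e - σ - 1) * δ ^ (σ + 1 - e)) := by
    calc ∫⁻ t in Set.Ioi δ, ENNReal.ofReal (t ^ σ * (t + δ) ^ (-e))
        ≤ ∫⁻ t in Set.Ioi δ, ENNReal.ofReal (t ^ (σ - e)) := by
          refine setLIntegral_mono' measurableSet_Ioi fun t ht => ?_
          have ht0 : 0 < t := hδ.trans ht
          refine ENNReal.ofReal_le_ofReal ?_
          rw [sub_eq_add_neg, Real.rpow_add ht0]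
          refine mul_le_mul_of_nonneg_left ?_ (by positivity)
          exact Real.rpow_le_rpow_of_nonpos ht0 (by linarith) (by linarith)
      _ = ENNReal.ofReal (1 / (e - σ - 1) * δ ^ (σ + 1 - e)) := by
          rw [lintegral_Ioi_rpow_eq (by linarith) hδ]
          congr 1
          rw [show σ - e + 1 = σ + 1 - e by ring, show e - σ - 1 = -(σ + 1 - e) by ring]
          rw [neg_div, one_div, inv_neg]; ring
  calc _ ≤ _ := add_le_add A B
    _ = _ := by
      rw [← ENNReal.ofReal_add (by positivity) (by positivity), add_mul]

theorem abs_sin_half_ge {θ : ℝ} (h : |θ| ≤ Real.pi) : |θ| / Real.pi ≤ |Real.sin (θ / 2)| := by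
  have h1 : Real.sin (|θ| / 2) ≤ |Real.sin (θ / 2)| := by
    rcases abs_cases θ with ⟨h, _⟩ | ⟨h, _⟩
    · rw [h]; exact le_abs_self _
    · rw [h, neg_div, Real.sin_neg]; exact neg_le_abs _
  refine le_trans ?_ h1
  have := Real.mul_le_sin (x := |θ| / 2) (by positivity) (by linarith)
  calc _ = 2 / Real.pi * (|θ| / 2) := by ring
    _ ≤ _ := this

theorem norm_one_sub_mul_polar_sq (x θ : ℝ) :
    ‖1 - (x : ℂ) * (Real.cos θ + Real.sin θ * Complex.I)‖ ^ 2 =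
      (1 - x) ^ 2 + 4 * x * Real.sin (θ / 2) ^ 2 := by
  rw [← Complex.normSq_eq_norm_sq, Complex.normSq_apply]
  have h1 : Real.cos θ = 1 - 2 * Real.sin (θ / 2) ^ 2 := by
    have := Real.cos_two_mul (θ / 2)
    rw [show 2 * (θ / 2) = θ by ring] at this
    have h2 := Real.sin_sq_add_cos_sq (θ / 2)
    linarith
  have h3 := Real.sin_sq_add_cos_sq θ
  simp only [Complex.sub_re, Complex.one_re, Complex.mul_re, Complex.add_re, Complex.ofReal_re,
    Complex.ofReal_im, Complex.I_re, Complex.I_im, Complex.sub_im, Complex.one_im, Complex.mul_im,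
    Complex.add_im]
  simp only [mul_zero, sub_zero, add_zero, zero_add, mul_one, zero_mul, zero_sub]
  have : Real.sin θ ^ 2 = 1 - Real.cos θ ^ 2 := by linarith
  calc _ = (1 - x * Real.cos θ) ^ 2 + x ^ 2 * Real.sin θ ^ 2 := by ring
    _ = 1 - 2 * x * Real.cos θ + x ^ 2 := by rw [this]; ring
    _ = _ := by rw [h1]; ring

/-- The three quantities `1 - r`, `1 - ρ` and `|θ|` are all controlled by the distance from
`ρ r e^{iθ}` to `1`. -/
theorem add_abs_le_norm_one_sub_polar {ρ r θ : ℝ} (hρ : ρ ∈ Set.Icc (0 : ℝ) 1)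
    (hr : r ∈ Set.Icc (0 : ℝ) 1) (hθ : |θ| ≤ Real.pi) :
    (1 - r) + (1 - ρ) + |θ| ≤
      10 * ‖1 - ((ρ * r : ℝ) : ℂ) * (Real.cos θ + Real.sin θ * Complex.I)‖ := by
  set N := ‖1 - ((ρ * r : ℝ) : ℂ) * (Real.cos θ + Real.sin θ * Complex.I)‖ with hN
  have hN0 : 0 ≤ N := norm_nonneg _
  have hsq : N ^ 2 = (1 - ρ * r) ^ 2 + 4 * (ρ * r) * Real.sin (θ / 2) ^ 2 :=
    norm_one_sub_mul_polar_sq _ _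
  set x := ρ * r with hx
  have hx0 : 0 ≤ x := mul_nonneg hρ.1 hr.1
  have hxr : x ≤ r := by rw [hx]; nlinarith [hρ.2, hr.1]
  have hxρ : x ≤ ρ := by rw [hx]; nlinarith [hr.2, hρ.1]
  have hx1 : x ≤ 1 := hxr.trans hr.2
  have h1 : 1 - x ≤ N := by
    apply abs_le_of_sq_le_sq' _ hN0 |>.2
    rw [hsq]; nlinarith [mul_nonneg hx0 (sq_nonneg (Real.sin (θ / 2)))]
  have hpi : Real.pi < 4 := by linarith [Real.pi_lt_d2]
  have hpi0 := Real.pi_pos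
  have h2 : |θ| ≤ 8 * N := by
    rcases le_total x (1 / 2) with h | h
    · linarith
    · have h3 := abs_sin_half_ge hθ
      have h4 : (|θ| / Real.pi) ^ 2 ≤ N ^ 2 := by
        rw [hsq]
        have : (|θ| / Real.pi) ^ 2 ≤ Real.sin (θ / 2) ^ 2 := by
          rw [← sq_abs (Real.sin (θ / 2))]; gcongr
        nlinarith [sq_nonneg (1 - x), sq_nonneg (Real.sin (θ / 2))]
      have h5 : |θ| / Real.pi ≤ N := (abs_le_of_sq_le_sq' h4 hN0).2
      rw [div_le_iff₀ hpi0] at h5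
      nlinarith
  linarith

theorem measurable_ofReal_rpow_aux (σ c : ℝ) (ζ : ℂ) :
    Measurable fun z : ℂ =>
      ENNReal.ofReal ((1 - ‖z‖) ^ σ * ‖1 - ζ * (starRingEnd ℂ) z‖ ^ (-c)) := by
  have : Measurable (starRingEnd ℂ) := Complex.continuous_conj.measurable
  fun_prop

theorem setLIntegral_ball_rotate (f : ℂ → ℝ≥0∞) (u : Circle) :
    ∫⁻ z in Metric.ball (0 : ℂ) 1, f (u * z) = ∫⁻ z in Metric.ball (0 : ℂ) 1, f z := by
  have hmp : MeasurePreserving (rotation u) volume volume :=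
    (rotation u).measurePreserving
  have hemb : MeasurableEmbedding (rotation u) :=
    (rotation u).toHomeomorph.measurableEmbedding
  have := hmp.setLIntegral_comp_preimage_emb hemb f (Metric.ball (0 : ℂ) 1)
  rw [← this]
  have hpre : (rotation u) ⁻¹' Metric.ball (0 : ℂ) 1 = Metric.ball (0 : ℂ) 1 := by
    ext z
    rw [Set.mem_preimage, mem_ball_zero_iff, mem_ball_zero_iff, LinearIsometryEquiv.norm_map]
  rw [hpre]
  simp [rotation_apply]

/-- The Forelli–Rudin estimate on the disc for power weights. -/
theorem exists_forelliRudin {σ c : ℝ} (hσ : -1 < σ) (hc : σ + 2 < c) :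
    ∃ C : ℝ, 0 < C ∧ ∀ ζ ∈ Metric.ball (0 : ℂ) 1,
      ∫⁻ z in Metric.ball (0 : ℂ) 1,
          ENNReal.ofReal ((1 - ‖z‖) ^ σ * ‖1 - ζ * (starRingEnd ℂ) z‖ ^ (-c)) ≤
        ENNReal.ofReal (C * (1 - ‖ζ‖) ^ (σ + 2 - c)) := by
  obtain ⟨C1, hC1, H1⟩ := exists_lintegral_rpow_mul_add_rpow_le (σ := 0) (e := c)
    (by norm_num) (by linarith)
  obtain ⟨C2, hC2, H2⟩ := exists_lintegral_rpow_mul_add_rpow_le (σ := σ) (e := c - 1)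
    hσ (by linarith)
  refine ⟨10 ^ c * (2 * C1) * C2, by positivity, fun ζ hζ => ?_⟩
  have hζ1 : ‖ζ‖ < 1 := by simpa using hζ
  -- rotate so that `ζ` becomes a nonnegative real number
  obtain ⟨u, hu⟩ : ∃ u : Circle, ζ = ‖ζ‖ * (u : ℂ) := by
    refine ⟨Circle.exp (Complex.arg ζ), ?_⟩
    rw [Circle.coe_exp, Complex.norm_mul_exp_arg_mul_I]
  set ρ := ‖ζ‖ with hρdef
  have hρ0 : 0 ≤ ρ := norm_nonneg _
  rw [← setLIntegral_ball_rotate _ u]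
  have hnorm : ∀ z : ℂ, ‖1 - ζ * (starRingEnd ℂ) (u * z)‖ = ‖1 - (ρ : ℂ) * z‖ := by
    intro z
    have huu : (u : ℂ) * (starRingEnd ℂ) (u : ℂ) = 1 := by
      rw [Complex.mul_conj, Circle.normSq_coe]; simp
    rw [map_mul, hu, show (ρ : ℂ) * u * ((starRingEnd ℂ) (u : ℂ) * (starRingEnd ℂ) z) =
      (ρ : ℂ) * ((u : ℂ) * (starRingEnd ℂ) (u : ℂ)) * (starRingEnd ℂ) z by ring, huu, mul_one]
    rw [← Complex.norm_conj]
    simp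
  have hnu : ∀ z : ℂ, ‖(u : ℂ) * z‖ = ‖z‖ := fun z => by rw [norm_mul, Circle.norm_coe, one_mul]
  simp_rw [hnorm, hnu]
  rw [← lintegral_indicator measurableSet_ball, ← Complex.lintegral_comp_polarCoord_symm,
    polarCoord_target]
  -- bound the integrand in polar coordinates by a product kernel
  set G : ℝ → ℝ → ℝ≥0∞ := fun r θ => (Set.Ioo (0 : ℝ) 1).indicator
    (fun r => ENNReal.ofReal (10 ^ c * (1 - r) ^ σ) *
      ENNReal.ofReal (((1 - r) + (1 - ρ) + |θ|) ^ (-c))) r with hG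
  have hGm : Measurable (Function.uncurry G) := by
    have : Function.uncurry G = (Set.Ioo (0 : ℝ) 1 ×ˢ Set.univ).indicator
        (fun q : ℝ × ℝ => ENNReal.ofReal (10 ^ c * (1 - q.1) ^ σ) *
          ENNReal.ofReal (((1 - q.1) + (1 - ρ) + |q.2|) ^ (-c))) := by
      ext ⟨r, θ⟩
      simp only [Function.uncurry, hG, Set.indicator, Set.mem_prod, Set.mem_univ, and_true]
    rw [this]
    refine Measurable.indicator ?_ (measurableSet_Ioo.prod MeasurableSet.univ)
    have : Measurable fun q : ℝ × ℝ => |q.2| := continuous_abs.measurable.comp measurable_snd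
    fun_prop
  calc _ ≤ ∫⁻ q in Set.Ioi (0 : ℝ) ×ˢ Set.Ioo (-Real.pi) Real.pi, Function.uncurry G q := by
        refine setLIntegral_mono' (measurableSet_Ioi.prod measurableSet_Ioo) ?_
        rintro ⟨r, θ⟩ ⟨hr, hθ⟩
        simp only [Set.mem_Ioi, Set.mem_Ioo] at hr hθ
        simp only [Function.uncurry, hG, Complex.polarCoord_symm_apply, smul_eq_mul]
        by_cases hr1 : r < 1
        · have hn : ‖(r : ℂ) * (Real.cos θ + Real.sin θ * Complex.I)‖ = r := by
            rw [norm_mul, Complex.ofReal_cos, Complex.ofReal_sin, Complex.norm_cos_add_sin_mul_I]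
            simp [abs_of_pos hr]
          rw [Set.indicator_of_mem (by rw [mem_ball_zero_iff, hn]; exact hr1),
            Set.indicator_of_mem (show r ∈ Set.Ioo (0 : ℝ) 1 from ⟨hr, hr1⟩), hn]
          have hr2 : 0 < 1 - r := by linarith
          have hkey := add_abs_le_norm_one_sub_polar (ρ := ρ) (r := r) (θ := θ) ⟨hρ0, hζ1.le⟩
            ⟨hr.le, hr1.le⟩ (abs_le.2 ⟨hθ.1.le, hθ.2.le⟩)
          have harg : (ρ : ℂ) * ((r : ℂ) * (Real.cos θ + Real.sin θ * Complex.I)) =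
              ((ρ * r : ℝ) : ℂ) * (Real.cos θ + Real.sin θ * Complex.I) := by push_cast; ring
          rw [harg]
          set N := ‖1 - ((ρ * r : ℝ) : ℂ) * (Real.cos θ + Real.sin θ * Complex.I)‖
          have hsum : 0 < (1 - r) + (1 - ρ) + |θ| := by
            have := abs_nonneg θ; linarith
          have hN : 0 < N := by linarith
          rw [← ENNReal.ofReal_mul hr.le, ← ENNReal.ofReal_mul (by positivity)]
          refine ENNReal.ofReal_le_ofReal ?_
          have h1 : N ^ (-c) ≤ 10 ^ c * ((1 - r) + (1 - ρ) + |θ|) ^ (-c) := by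
            have := Real.rpow_le_rpow_of_nonpos (z := -c) hsum hkey (by linarith)
            rw [Real.mul_rpow (by norm_num) hN.le, Real.rpow_neg (by norm_num)] at this
            rw [inv_mul_le_iff₀ (by positivity)] at this
            exact this
          have h2 : 0 ≤ (1 - r) ^ σ := by positivity
          calc r * ((1 - r) ^ σ * N ^ (-c)) ≤ 1 * ((1 - r) ^ σ * N ^ (-c)) := by gcongr
            _ = (1 - r) ^ σ * N ^ (-c) := one_mul _
            _ ≤ (1 - r) ^ σ * (10 ^ c * ((1 - r) + (1 - ρ) + |θ|) ^ (-c)) := by gcongr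
            _ = _ := by ring
        · rw [Set.indicator_of_notMem]
          · simp
          · have hn : ‖(r : ℂ) * (Real.cos θ + Real.sin θ * Complex.I)‖ = r := by
              rw [norm_mul, Complex.ofReal_cos, Complex.ofReal_sin, Complex.norm_cos_add_sin_mul_I]
              simp [abs_of_pos hr]
            rw [mem_ball_zero_iff, hn]; exact hr1
    _ = ∫⁻ r in Set.Ioi (0 : ℝ), ∫⁻ θ in Set.Ioo (-Real.pi) Real.pi, G r θ := by
        rw [Measure.volume_eq_prod, ← Measure.prod_restrict]
        exact lintegral_prod _ hGm.aemeasurable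
    _ ≤ ∫⁻ r in Set.Ioi (0 : ℝ), (Set.Ioo (0 : ℝ) 1).indicator (fun r =>
          ENNReal.ofReal (10 ^ c * (2 * C1)) *
            ENNReal.ofReal ((1 - r) ^ σ * ((1 - r) + (1 - ρ)) ^ (-(c - 1)))) r := by
        refine setLIntegral_mono' measurableSet_Ioi fun r _ => ?_
        by_cases hr : r ∈ Set.Ioo (0 : ℝ) 1
        · simp only [hG, Set.indicator_of_mem hr]
          have hr2 : 0 < 1 - r := by linarith [hr.2]
          have hx : 0 < (1 - r) + (1 - ρ) := by linarith
          rw [lintegral_const_mul' _ _ ENNReal.ofReal_ne_top]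
          have hang : ∫⁻ θ in Set.Ioo (-Real.pi) Real.pi,
              ENNReal.ofReal (((1 - r) + (1 - ρ) + |θ|) ^ (-c)) ≤
              ENNReal.ofReal (2 * C1 * ((1 - r) + (1 - ρ)) ^ (1 - c)) := by
            set x := (1 - r) + (1 - ρ)
            have hpos := H1 x hx
            simp only [Real.rpow_zero, one_mul, zero_add] at hpos
            have e1 : ∫⁻ θ in Set.Ioi (0 : ℝ), ENNReal.ofReal ((x + |θ|) ^ (-c)) ≤
                ENNReal.ofReal (C1 * x ^ (1 - c)) := by
              refine le_trans (le_of_eq ?_) hpos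
              refine setLIntegral_congr_fun measurableSet_Ioi fun θ hθ => ?_
              simp only [abs_of_pos (Set.mem_Ioi.1 hθ), add_comm]
            have e2 : ∫⁻ θ in Set.Iio (0 : ℝ), ENNReal.ofReal ((x + |θ|) ^ (-c)) ≤
                ENNReal.ofReal (C1 * x ^ (1 - c)) := by
              refine le_trans (le_of_eq ?_) e1
              have := (Measure.measurePreserving_neg (volume : Measure ℝ)).setLIntegral_comp_preimage_emb
                (MeasurableEquiv.neg ℝ).measurableEmbedding
                (fun θ => ENNReal.ofReal ((x + |θ|) ^ (-c))) (Set.Ioi 0)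
              rw [← this]
              simp
            calc _ ≤ ∫⁻ θ in (Set.Ioi (0 : ℝ) ∪ Set.Iio 0) ∪ {0},
                    ENNReal.ofReal ((x + |θ|) ^ (-c)) := by
                  refine lintegral_mono_set fun θ _ => ?_
                  rcases lt_trichotomy θ 0 with h | h | h
                  · exact Or.inl (Or.inr h)
                  · exact Or.inr h
                  · exact Or.inl (Or.inl h)
              _ ≤ ((∫⁻ θ in Set.Ioi (0 : ℝ), ENNReal.ofReal ((x + |θ|) ^ (-c))) +
                  ∫⁻ θ in Set.Iio (0 : ℝ), ENNReal.ofReal ((x + |θ|) ^ (-c))) +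
                  ∫⁻ θ in ({0} : Set ℝ), ENNReal.ofReal ((x + |θ|) ^ (-c)) :=
                (lintegral_union_le _ _ _).trans (add_le_add (lintegral_union_le _ _ _) le_rfl)
              _ ≤ (ENNReal.ofReal (C1 * x ^ (1 - c)) + ENNReal.ofReal (C1 * x ^ (1 - c))) + 0 := by
                refine add_le_add (add_le_add e1 e2) (le_of_eq ?_)
                rw [Measure.restrict_singleton]; simp
              _ = _ := by
                rw [add_zero, ← ENNReal.ofReal_add (by positivity) (by positivity)]
                ring_nf
          calc _ ≤ ENNReal.ofReal (10 ^ c * (1 - r) ^ σ) *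
                ENNReal.ofReal (2 * C1 * ((1 - r) + (1 - ρ)) ^ (1 - c)) := by gcongr
            _ = _ := by
              rw [← ENNReal.ofReal_mul (by positivity), ← ENNReal.ofReal_mul (by positivity),
                neg_sub]
              ring_nf
        · simp [hG, Set.indicator_of_notMem hr]
    _ = ENNReal.ofReal (10 ^ c * (2 * C1)) * ∫⁻ r in Set.Ioo (0 : ℝ) 1,
            ENNReal.ofReal ((1 - r) ^ σ * ((1 - r) + (1 - ρ)) ^ (-(c - 1))) := by
        rw [setLIntegral_indicator measurableSet_Ioo,
          Set.inter_eq_left.2 Set.Ioo_subset_Ioi_self, lintegral_const_mul' _ _ ENNReal.ofReal_ne_top]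
    _ ≤ ENNReal.ofReal (10 ^ c * (2 * C1)) * ENNReal.ofReal (C2 * (1 - ρ) ^ (σ + 1 - (c - 1))) := by
        gcongr
        refine le_trans ?_ (H2 (1 - ρ) (by linarith))
        have hmp : MeasurePreserving (fun t : ℝ => 1 - t) volume volume :=
          Measure.measurePreserving_sub_left volume 1
        have hemb : MeasurableEmbedding (fun t : ℝ => 1 - t) :=
          (MeasurableEquiv.subLeft (1 : ℝ)).measurableEmbedding
        have h := hmp.setLIntegral_comp_preimage_emb hemb
          (fun t => ENNReal.ofReal (t ^ σ * (t + (1 - ρ)) ^ (-(c - 1)))) (Set.Ioi 0)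
        rw [← h]
        refine lintegral_mono_set fun r hr => ?_
        simpa using hr.2
    _ = _ := by
        rw [← ENNReal.ofReal_mul (by positivity)]
        ring_nf

/-! ### Growth of regular weights -/

/-- A two-sided power bound on the growth of a weight: the form in which the conditions on
`alphaIndex` and `betaIndex` enter the estimates. -/
structure WeightGrowth (ω : ℝ → ℝ) (s A c C : ℝ) : Prop where
  c_pos : 0 < c
  C_pos : 0 < C
  pos : ∀ t ∈ Set.Ioo (0 : ℝ) 1, 0 < ω t
  lower : ∀ r ∈ Set.Ioo (0 : ℝ) 1, ∀ l ∈ Set.Ioc (0 : ℝ) 1, c * l ^ A * ω r ≤ ω (l * r)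
  upper : ∀ r ∈ Set.Ioo (0 : ℝ) 1, ∀ l ∈ Set.Ioc (0 : ℝ) 1, ω (l * r) ≤ C * l ^ s * ω r

theorem mul_mem_Ioo_of_mem {l r : ℝ} (hl : l ∈ Set.Ioc (0 : ℝ) 1) (hr : r ∈ Set.Ioo (0 : ℝ) 1) :
    l * r ∈ Set.Ioo (0 : ℝ) 1 :=
  ⟨mul_pos hl.1 hr.1, by nlinarith [hl.1, hl.2, hr.1, hr.2]⟩

/-- Iterating the lower estimate on `[q, 1]` gives a lower power bound on all of `(0, 1]`. -/
theorem lower_bound_of_ratio {ω : ℝ → ℝ} (hpos : ∀ t ∈ Set.Ioo (0 : ℝ) 1, 0 < ω t) {q m a : ℝ}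
    (hq : q ∈ Set.Ioo (0 : ℝ) 1) (hm : m ∈ Set.Ioo (0 : ℝ) 1)
    (h : ∀ r ∈ Set.Ioo (0 : ℝ) 1, ∀ l ∈ Set.Icc q 1, m ≤ ω (l * r) / ω r)
    (ha : -a = Real.log m / Real.log q⁻¹) :
    ∀ r ∈ Set.Ioo (0 : ℝ) 1, ∀ l ∈ Set.Ioc (0 : ℝ) 1, m * l ^ a * ω r ≤ ω (l * r) := by
  have hlogq : Real.log q < 0 := Real.log_neg hq.1 hq.2
  have hlogm : Real.log m < 0 := Real.log_neg hm.1 hm.2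
  have ha' : a = Real.log m / Real.log q := by
    rw [Real.log_inv, div_neg] at ha; linarith
  have ha0 : 0 < a := by rw [ha']; exact div_pos_of_neg_of_neg hlogm hlogq
  have hqa : q ^ a = m := by
    rw [Real.rpow_def_of_pos hq.1, ha', mul_div_cancel₀ _ hlogq.ne, Real.exp_log hm.1]
  have key : ∀ k : ℕ, ∀ r ∈ Set.Ioo (0 : ℝ) 1, ∀ l ∈ Set.Icc (q ^ (k + 1)) 1,
      m ^ (k + 1) * ω r ≤ ω (l * r) := by
    intro k
    induction k with
    | zero =>
      intro r hr l hl
      have := h r hr l (by simpa using hl)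
      rw [le_div_iff₀ (hpos r hr)] at this
      simpa using this
    | succ k ih =>
      intro r hr l hl
      have hq0 := hq.1
      have hr0 := hpos r hr
      by_cases hlq : q ≤ l
      · have := h r hr l ⟨hlq, hl.2⟩
        rw [le_div_iff₀ hr0] at this
        refine le_trans ?_ this
        have : m ^ (k + 1 + 1) ≤ m := by
          simpa using pow_le_pow_of_le_one hm.1.le hm.2.le (show 1 ≤ k + 1 + 1 by omega)
        gcongr
      · push Not at hlq
        have hl0 : 0 < l := lt_of_lt_of_le (by positivity) hl.1
        have hl' : l / q ∈ Set.Icc (q ^ (k + 1)) 1 := by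
          refine ⟨?_, by rw [div_le_one hq0]; exact hlq.le⟩
          rw [le_div_iff₀ hq0, ← pow_succ]; exact hl.1
        have h1 := ih r hr (l / q) hl'
        have hmem : l / q * r ∈ Set.Ioo (0 : ℝ) 1 :=
          mul_mem_Ioo_of_mem ⟨by positivity, hl'.2⟩ hr
        have h2 := h (l / q * r) hmem q ⟨le_rfl, hq.2.le⟩
        rw [le_div_iff₀ (hpos _ hmem), show q * (l / q * r) = l * r by field_simp] at h2
        calc m ^ (k + 1 + 1) * ω r = m * (m ^ (k + 1) * ω r) := by ring
          _ ≤ m * ω (l / q * r) := by have := hm.1; gcongr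
          _ ≤ _ := h2
  intro r hr l hl
  -- choose `k` with `q ^ (k + 1) < l ≤ q ^ k`
  obtain ⟨k, hk1, hk2⟩ := exists_nat_pow_near_of_lt_one hl.1 hl.2 hq.1 hq.2
  have h1 := key k r hr l ⟨hk1.le, hl.2⟩
  refine le_trans ?_ h1
  have hr0 := hpos r hr
  have : l ^ a ≤ m ^ k := by
    calc l ^ a ≤ (q ^ k) ^ a := Real.rpow_le_rpow hl.1.le hk2 ha0.le
      _ = (q ^ a) ^ k := by
        rw [← Real.rpow_natCast, ← Real.rpow_natCast, ← Real.rpow_mul hq.1.le,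
          ← Real.rpow_mul hq.1.le, mul_comm]
      _ = _ := by rw [hqa]
  rw [pow_succ']
  have := hm.1
  gcongr

theorem RegularWeight.alpha_set_nonempty {ω : ℝ → ℝ} (hω : RegularWeight ω) :
    {a : ℝ | ∃ q ∈ Set.Ioo (0 : ℝ) 1, ∃ m ∈ Set.Ioo (0 : ℝ) 1,
      (∀ r ∈ Set.Ioo (0 : ℝ) 1, ∀ l ∈ Set.Icc q 1, m ≤ ω (l * r) / ω r) ∧
        -a = Real.log m / Real.log q⁻¹}.Nonempty := by
  obtain ⟨M, q, m, -, hq, hm, h⟩ := hω.ratio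
  exact ⟨-(Real.log m / Real.log q⁻¹), q, hq, m, hm, fun r hr l hl => (h r hr l hl).1, neg_neg _⟩

/-- All the exponents admitted in the definition of `alphaIndex` are positive. -/
theorem alpha_set_bddBelow (ω : ℝ → ℝ) :
    BddBelow {a : ℝ | ∃ q ∈ Set.Ioo (0 : ℝ) 1, ∃ m ∈ Set.Ioo (0 : ℝ) 1,
      (∀ r ∈ Set.Ioo (0 : ℝ) 1, ∀ l ∈ Set.Icc q 1, m ≤ ω (l * r) / ω r) ∧
        -a = Real.log m / Real.log q⁻¹} := by
  refine ⟨0, ?_⟩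
  rintro a ⟨q, hq, m, hm, -, ha⟩
  have h1 : Real.log m < 0 := Real.log_neg hm.1 hm.2
  have h2 : Real.log q < 0 := Real.log_neg hq.1 hq.2
  rw [Real.log_inv, div_neg] at ha
  have := div_pos_of_neg_of_neg h1 h2
  linarith

theorem RegularWeight.lower_of_alphaIndex_lt {ω : ℝ → ℝ} (hω : RegularWeight ω) {A : ℝ}
    (hA : alphaIndex ω < A) :
    ∃ c : ℝ, 0 < c ∧ ∀ r ∈ Set.Ioo (0 : ℝ) 1, ∀ l ∈ Set.Ioc (0 : ℝ) 1,
      c * l ^ A * ω r ≤ ω (l * r) := by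
  obtain ⟨a, ⟨q, hq, m, hm, h, ha⟩, haA⟩ := exists_lt_of_csInf_lt hω.alpha_set_nonempty hA
  refine ⟨m, hm.1, fun r hr l hl => ?_⟩
  refine le_trans ?_ (lower_bound_of_ratio hω.pos hq hm h ha r hr l hl)
  have hr0 := hω.pos r hr
  have hm0 := hm.1
  have := Real.rpow_le_rpow_of_exponent_ge hl.1 hl.2 haA.le
  gcongr

theorem exists_upper_of_betaIndex_lt {ω : ℝ → ℝ} (hβ : betaIndex ω < -1) :
    ∃ s C : ℝ, 1 < s ∧ 0 < C ∧ ∀ r ∈ Set.Ioo (0 : ℝ) 1, ∀ l ∈ Set.Ioc (0 : ℝ) 1,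
      ω (l * r) ≤ C * l ^ s * ω r := by
  -- the infimum over the empty set would be `0`
  have hne : {b : ℝ | ∃ C : ℝ, 0 < C ∧ ∀ r ∈ Set.Ioo (0 : ℝ) 1, ∀ l ∈ Set.Ioc (0 : ℝ) 1,
      ω (l * r) ≤ C * l ^ (-b) * ω r}.Nonempty := by
    rw [Set.nonempty_iff_ne_empty]
    intro h
    rw [betaIndex, h, Real.sInf_empty] at hβ
    norm_num at hβ
  obtain ⟨b, ⟨C, hC, h⟩, hb⟩ := exists_lt_of_csInf_lt hne hβ
  exact ⟨-b, C, by linarith, hC, h⟩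

theorem RegularWeight.exists_growth {ω : ℝ → ℝ} (hω : RegularWeight ω) (hβ : betaIndex ω < -1)
    {A : ℝ} (hA : alphaIndex ω < A) :
    ∃ s c C : ℝ, 1 < s ∧ WeightGrowth ω s A c C := by
  obtain ⟨s, C, hs, hC, hu⟩ := exists_upper_of_betaIndex_lt hβ
  obtain ⟨c, hc, hl⟩ := hω.lower_of_alphaIndex_lt hA
  exact ⟨s, c, C, hs, hc, hC, hω.pos, hl, hu⟩

/-- A lower power bound with exponent less than `b` forces `alphaIndex ω < b`. -/
theorem alphaIndex_lt_of_lower {ω : ℝ → ℝ} (hpos : ∀ t ∈ Set.Ioo (0 : ℝ) 1, 0 < ω t) {b B c : ℝ}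
    (hb : 0 < b) (hB : B < b) (hc : 0 < c)
    (h : ∀ r ∈ Set.Ioo (0 : ℝ) 1, ∀ l ∈ Set.Ioc (0 : ℝ) 1, c * l ^ B * ω r ≤ ω (l * r)) :
    alphaIndex ω < b := by
  -- make the exponent positive and the constant less than `1`
  set B' := max B (b / 2) with hB'
  have hB'0 : 0 < B' := lt_of_lt_of_le (by positivity) (le_max_right _ _)
  have hB'b : B' < b := max_lt hB (by linarith)
  set c' := min c (1 / 2) with hc'
  have hc'0 : 0 < c' := lt_min hc (by norm_num)
  have hc'1 : c' < 1 := lt_of_le_of_lt (min_le_right _ _) (by norm_num)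
  -- for small `q` the exponent attached to `(q, c' q ^ B')` is close to `B'`
  set η := (b - B') / 2 with hη
  have hη0 : 0 < η := by rw [hη]; linarith
  set q := c' ^ (1 / η) with hq
  have hq0 : 0 < q := Real.rpow_pos_of_pos hc'0 _
  have hq1 : q < 1 := Real.rpow_lt_one hc'0.le hc'1 (by positivity)
  have hqη : q ^ η = c' := by
    rw [hq, ← Real.rpow_mul hc'0.le, one_div, inv_mul_cancel₀ hη0.ne', Real.rpow_one]
  have hmem : (B' + η) ∈ {a : ℝ | ∃ q ∈ Set.Ioo (0 : ℝ) 1, ∃ m ∈ Set.Ioo (0 : ℝ) 1,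
      (∀ r ∈ Set.Ioo (0 : ℝ) 1, ∀ l ∈ Set.Icc q 1, m ≤ ω (l * r) / ω r) ∧
        -a = Real.log m / Real.log q⁻¹} := by
    refine ⟨q, ⟨hq0, hq1⟩, q ^ (B' + η), ⟨by positivity,
      Real.rpow_lt_one hq0.le hq1 (by positivity)⟩, fun r hr l hl => ?_, ?_⟩
    · have hr0 := hpos r hr
      have hl0 : 0 < l := lt_of_lt_of_le hq0 hl.1
      rw [le_div_iff₀ hr0]
      refine le_trans ?_ (h r hr l ⟨hl0, hl.2⟩)
      have h1 : q ^ (B' + η) ≤ c * l ^ B := by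
        rw [Real.rpow_add hq0, hqη, mul_comm]
        have h2 : q ^ B' ≤ l ^ B := by
          calc q ^ B' ≤ l ^ B' := Real.rpow_le_rpow hq0.le hl.1 hB'0.le
            _ ≤ l ^ B := Real.rpow_le_rpow_of_exponent_ge hl0 hl.2 (le_max_left _ _)
        have h3 : c' ≤ c := min_le_left _ _
        gcongr
      gcongr
    · have hlq : Real.log q ≠ 0 := (Real.log_neg hq0 hq1).ne
      rw [Real.log_rpow hq0, Real.log_inv, div_neg, mul_div_cancel_right₀ _ hlq]
  refine lt_of_le_of_lt (csInf_le (alpha_set_bddBelow ω) hmem) ?_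
  rw [hη]; linarith

/-- The weight `ω`, extended by zero outside `(0, 1)`. -/
noncomputable def zeroExt (ω : ℝ → ℝ) : ℝ → ℝ := (Set.Ioo (0 : ℝ) 1).indicator ω

theorem zeroExt_of_mem {ω : ℝ → ℝ} {t : ℝ} (ht : t ∈ Set.Ioo (0 : ℝ) 1) : zeroExt ω t = ω t :=
  Set.indicator_of_mem ht _

theorem RegularWeight.measurable_zeroExt {ω : ℝ → ℝ} (hω : RegularWeight ω) :
    Measurable (zeroExt ω) := by
  refine measurable_of_restrict_of_restrict_compl (s := Set.Ioo 0 1) measurableSet_Ioo ?_ ?_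
  · have h : (Set.Ioo (0 : ℝ) 1).domRestrict (zeroExt ω) = fun t : Set.Ioo (0 : ℝ) 1 => ω t := by
      ext t
      exact zeroExt_of_mem t.2
    rw [h]
    exact hω.measurable
  · have h : (Set.Ioo (0 : ℝ) 1)ᶜ.domRestrict (zeroExt ω) = fun _ => 0 := by
      ext t
      exact Set.indicator_of_notMem t.2 _
    rw [h]
    exact measurable_const

theorem zeroExt_nonneg {ω : ℝ → ℝ} (hpos : ∀ t ∈ Set.Ioo (0 : ℝ) 1, 0 < ω t) (t : ℝ) :
    0 ≤ zeroExt ω t :=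
  Set.indicator_nonneg (fun t ht => (hpos t ht).le) t

theorem WeightGrowth.le_mul_add {ω : ℝ → ℝ} {s A c C : ℝ} (h : WeightGrowth ω s A c C) {t δ : ℝ}
    (ht : t ∈ Set.Ioo (0 : ℝ) 1) (hδ : δ ∈ Set.Ioo (0 : ℝ) 1) :
    ω t ≤ (C + c⁻¹) * ω δ * ((t / δ) ^ s + (t / δ) ^ A) := by
  have hC := h.C_pos
  have hc := h.c_pos
  have hωδ := h.pos δ hδ
  have ht0 := ht.1
  have hδ0 := hδ.1
  rcases le_total t δ with hle | hle
  · have h1 := h.upper δ hδ (t / δ) ⟨by positivity, (div_le_one hδ0).2 hle⟩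
    rw [div_mul_cancel₀ _ hδ0.ne'] at h1
    calc ω t ≤ C * (t / δ) ^ s * ω δ := h1
      _ = C * ω δ * ((t / δ) ^ s + 0) := by ring
      _ ≤ (C + c⁻¹) * ω δ * ((t / δ) ^ s + (t / δ) ^ A) := by
        gcongr
        · simp only [le_add_iff_nonneg_right]; positivity
        · positivity
  · have h1 := h.lower t ht (δ / t) ⟨by positivity, (div_le_one ht0).2 hle⟩
    rw [div_mul_cancel₀ _ ht0.ne'] at h1
    have h2 : (δ / t) ^ A = ((t / δ) ^ A)⁻¹ := by
      rw [← Real.inv_rpow (by positivity), inv_div]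
    rw [h2] at h1
    have h3 : 0 < (t / δ) ^ A := by positivity
    have h4 : ω t ≤ c⁻¹ * ω δ * (t / δ) ^ A := by
      calc ω t = c⁻¹ * (c * ((t / δ) ^ A)⁻¹ * ω t) * (t / δ) ^ A := by field_simp
        _ ≤ c⁻¹ * ω δ * (t / δ) ^ A := by gcongr
    calc ω t ≤ c⁻¹ * ω δ * (0 + (t / δ) ^ A) := by rw [zero_add]; exact h4
      _ ≤ _ := by
        gcongr
        · simp only [le_add_iff_nonneg_left]; positivity
        · positivity

theorem WeightGrowth.exponent_le {ω : ℝ → ℝ} {s A c C : ℝ} (h : WeightGrowth ω s A c C) :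
    s ≤ A := by
  by_contra! hlt
  have hr : (1 / 2 : ℝ) ∈ Set.Ioo (0 : ℝ) 1 := by norm_num
  have hc := h.c_pos
  have hC := h.C_pos
  have hω := h.pos _ hr
  have hcC : ∀ l ∈ Set.Ioc (0 : ℝ) 1, c ≤ C * l ^ (s - A) := by
    intro l hl
    have h1 := (h.lower _ hr l hl).trans (h.upper _ hr l hl)
    have h2 := le_of_mul_le_mul_right h1 hω
    have hl0 := hl.1
    have h3 : 0 < l ^ A := by positivity
    rw [Real.rpow_sub hl0]
    calc c = c * l ^ A / l ^ A := by field_simp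
      _ ≤ C * l ^ s / l ^ A := by gcongr
      _ = _ := by ring
  have h1 : c ≤ C := by simpa using hcC 1 (by norm_num)
  have hpos : 0 < c / (2 * C) := by positivity
  have hle : c / (2 * C) ≤ 1 := by rw [div_le_one (by positivity)]; linarith
  have hsA : 0 < s - A := by linarith
  have h2 := hcC ((c / (2 * C)) ^ (1 / (s - A)))
    ⟨by positivity, Real.rpow_le_one hpos.le hle (by positivity)⟩
  rw [← Real.rpow_mul hpos.le, one_div, inv_mul_cancel₀ hsA.ne', Real.rpow_one] at h2
  have h3 : C * (c / (2 * C)) = c / 2 := by field_simp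
  linarith

theorem measurable_zeroExt_comp {ω : ℝ → ℝ} (hm : Measurable (zeroExt ω)) :
    Measurable fun z : ℂ => zeroExt ω (1 - ‖z‖) :=
  hm.comp (by fun_prop)

/-- The Forelli–Rudin estimate with a regular weight. -/
theorem WeightGrowth.exists_forelliRudin {ω : ℝ → ℝ} {s A c C τ e : ℝ}
    (h : WeightGrowth ω s A c C) (hτ : -1 < s + τ)
    (he2 : A + τ + 2 < e) :
    ∃ K : ℝ, 0 < K ∧ ∀ ζ ∈ Metric.ball (0 : ℂ) 1, ζ ≠ 0 →
      ∫⁻ z in Metric.ball (0 : ℂ) 1, ENNReal.ofReal (zeroExt ω (1 - ‖z‖) * (1 - ‖z‖) ^ τ *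
          ‖1 - ζ * (starRingEnd ℂ) z‖ ^ (-e)) ≤
        ENNReal.ofReal (K * (zeroExt ω (1 - ‖ζ‖) * (1 - ‖ζ‖) ^ (τ + 2 - e))) := by
  have hsA := h.exponent_le
  have hτA : -1 < A + τ := by linarith
  have he1 : s + τ + 2 < e := by linarith
  obtain ⟨K1, hK1, H1⟩ := _root_.exists_forelliRudin (σ := s + τ) (c := e) hτ he1
  obtain ⟨K2, hK2, H2⟩ := _root_.exists_forelliRudin (σ := A + τ) (c := e) hτA he2
  have hC := h.C_pos
  have hc := h.c_pos
  refine ⟨(C + c⁻¹) * (K1 + K2), by positivity, fun ζ hζ hζ0 => ?_⟩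
  have hζ1 : ‖ζ‖ < 1 := by simpa using hζ
  set δ := 1 - ‖ζ‖ with hδdef
  have hδ : δ ∈ Set.Ioo (0 : ℝ) 1 := ⟨by rw [hδdef]; linarith, by
    rw [hδdef]; linarith [norm_pos_iff.2 hζ0]⟩
  rw [zeroExt_of_mem hδ]
  have hωδ := h.pos δ hδ
  have hδ0 := hδ.1
  calc _ ≤ ∫⁻ z in Metric.ball (0 : ℂ) 1,
        (ENNReal.ofReal ((C + c⁻¹) * ω δ * δ ^ (-s)) *
          ENNReal.ofReal ((1 - ‖z‖) ^ (s + τ) * ‖1 - ζ * (starRingEnd ℂ) z‖ ^ (-e)) +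
        ENNReal.ofReal ((C + c⁻¹) * ω δ * δ ^ (-A)) *
          ENNReal.ofReal ((1 - ‖z‖) ^ (A + τ) * ‖1 - ζ * (starRingEnd ℂ) z‖ ^ (-e))) := by
        refine setLIntegral_mono' measurableSet_ball fun z hz => ?_
        have hz1 : ‖z‖ < 1 := by simpa using hz
        have hz2 : 0 < 1 - ‖z‖ := by linarith
        set t := 1 - ‖z‖ with htdef
        have hN : 0 ≤ ‖1 - ζ * (starRingEnd ℂ) z‖ ^ (-e) := by positivity
        set N := ‖1 - ζ * (starRingEnd ℂ) z‖ ^ (-e)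
        rw [← ENNReal.ofReal_mul (by positivity), ← ENNReal.ofReal_mul (by positivity),
          ← ENNReal.ofReal_add (by positivity) (by positivity)]
        refine ENNReal.ofReal_le_ofReal ?_
        by_cases hz0 : z = 0
        · have : zeroExt ω t = 0 := by
            rw [zeroExt, Set.indicator_of_notMem]; simp [htdef, hz0]
          rw [this]; simp only [zero_mul]; positivity
        have ht : t ∈ Set.Ioo (0 : ℝ) 1 := ⟨hz2, by
          rw [htdef]; linarith [norm_pos_iff.2 hz0]⟩
        rw [zeroExt_of_mem ht]
        have hle := h.le_mul_add ht hδ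
        rw [Real.div_rpow hz2.le hδ0.le, Real.div_rpow hz2.le hδ0.le] at hle
        rw [Real.rpow_add hz2, Real.rpow_add hz2, Real.rpow_neg hδ0.le, Real.rpow_neg hδ0.le]
        have htτ : 0 ≤ t ^ τ * N := by positivity
        calc _ = ω t * (t ^ τ * N) := by ring
          _ ≤ _ := mul_le_mul_of_nonneg_right hle htτ
          _ = _ := by ring
    _ = ENNReal.ofReal ((C + c⁻¹) * ω δ * δ ^ (-s)) *
          (∫⁻ z in Metric.ball (0 : ℂ) 1,
            ENNReal.ofReal ((1 - ‖z‖) ^ (s + τ) * ‖1 - ζ * (starRingEnd ℂ) z‖ ^ (-e))) +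
        ENNReal.ofReal ((C + c⁻¹) * ω δ * δ ^ (-A)) *
          (∫⁻ z in Metric.ball (0 : ℂ) 1,
            ENNReal.ofReal ((1 - ‖z‖) ^ (A + τ) * ‖1 - ζ * (starRingEnd ℂ) z‖ ^ (-e))) := by
        rw [lintegral_add_left ((measurable_ofReal_rpow_aux _ _ _).const_mul _),
          lintegral_const_mul' _ _ ENNReal.ofReal_ne_top,
          lintegral_const_mul' _ _ ENNReal.ofReal_ne_top]
    _ ≤ ENNReal.ofReal ((C + c⁻¹) * ω δ * δ ^ (-s)) *
          ENNReal.ofReal (K1 * δ ^ (s + τ + 2 - e)) +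
        ENNReal.ofReal ((C + c⁻¹) * ω δ * δ ^ (-A)) *
          ENNReal.ofReal (K2 * δ ^ (A + τ + 2 - e)) := by
        gcongr
        · exact H1 ζ hζ
        · exact H2 ζ hζ
    _ = _ := by
        rw [← ENNReal.ofReal_mul (by positivity), ← ENNReal.ofReal_mul (by positivity),
          ← ENNReal.ofReal_add (by positivity) (by positivity)]
        congr 1
        have e1 : δ ^ (-s) * δ ^ (s + τ + 2 - e) = δ ^ (τ + 2 - e) := by
          rw [← Real.rpow_add hδ0]; ring_nf
        have e2 : δ ^ (-A) * δ ^ (A + τ + 2 - e) = δ ^ (τ + 2 - e) := by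
          rw [← Real.rpow_add hδ0]; ring_nf
        calc _ = (C + c⁻¹) * ω δ * K1 * (δ ^ (-s) * δ ^ (s + τ + 2 - e)) +
            (C + c⁻¹) * ω δ * K2 * (δ ^ (-A) * δ ^ (A + τ + 2 - e)) := by ring
          _ = _ := by rw [e1, e2]; ring

/-! ### Local estimates for holomorphic functions of one variable -/

theorem ContinuousOn.measurable_indicator_of_measurableSet {α : Type*} [TopologicalSpace α]
    [MeasurableSpace α] [OpensMeasurableSpace α] {f : α → ℂ} {s : Set α} (hf : ContinuousOn f s)
    (hs : MeasurableSet s) : Measurable (s.indicator f) := by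
  classical
  rw [← Set.piecewise_eq_indicator]
  exact hf.measurable_piecewise continuousOn_const hs

theorem enorm_mul_two_pi_le_lintegral_circle {h : ℂ → ℂ} {c : ℂ} {r : ℝ} (hr : 0 < r)
    (hh : DiffContOnCl ℂ h (Metric.ball c r)) :
    ‖h c‖ₑ * ENNReal.ofReal (2 * Real.pi) ≤
      ∫⁻ θ in Set.Ioo (-Real.pi) Real.pi, ‖h (c + Complex.polarCoord.symm (r, θ))‖ₑ := by
  have hpi := Real.pi_pos
  have h1 : Real.circleAverage h c r = h c :=
    DiffContOnCl.circleAverage (by rwa [abs_of_pos hr])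
  have hper : Function.Periodic (fun θ => h (circleMap c r θ)) (2 * Real.pi) := fun θ => by
    simp only [periodic_circleMap c r θ]
  rw [Real.circleAverage_def] at h1
  have h2 : ∫ θ in (0 : ℝ)..2 * Real.pi, h (circleMap c r θ) =
      ∫ θ in (-Real.pi)..Real.pi, h (circleMap c r θ) := by
    have := hper.intervalIntegral_add_eq 0 (-Real.pi)
    rw [zero_add] at this
    rw [this]; congr 1; ring
  rw [h2, intervalIntegral.integral_of_le (by linarith), integral_Ioc_eq_integral_Ioo] at h1
  rw [← h1, enorm_smul, mul_comm, ← mul_assoc]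
  rw [Real.enorm_of_nonneg (by positivity), ← ENNReal.ofReal_mul (by positivity),
    mul_inv_cancel₀ (by positivity), ENNReal.ofReal_one, one_mul]
  refine (enorm_integral_le_lintegral_enorm _).trans (le_of_eq ?_)
  refine lintegral_congr fun θ => ?_
  rw [Complex.polarCoord_symm_apply, circleMap, Complex.exp_mul_I]
  simp

/-- The area mean value inequality. -/
theorem enorm_mul_area_le_lintegral_ball {h : ℂ → ℂ} {c : ℂ} {R : ℝ} (hR : 0 < R)
    (hh : DifferentiableOn ℂ h (Metric.ball c R)) :
    ‖h c‖ₑ * ENNReal.ofReal (Real.pi * R ^ 2) ≤ ∫⁻ z in Metric.ball c R, ‖h z‖ₑ := by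
  set H : ℂ → ℝ≥0∞ := (Metric.ball c R).indicator fun z => ‖h z‖ₑ with hH
  have hHm : Measurable H := by
    have : H = fun z => ‖(Metric.ball c R).indicator h z‖ₑ := by
      ext z; by_cases hz : z ∈ Metric.ball c R <;> simp [hH, hz]
    rw [this]
    refine Measurable.enorm ?_
    exact hh.continuousOn.measurable_indicator_of_measurableSet measurableSet_ball
  have hpm : Measurable fun q : ℝ × ℝ => H (c + Complex.polarCoord.symm q) := by
    refine hHm.comp ((measurable_const_add c).comp ?_)
    have : Continuous fun q : ℝ × ℝ => (q.1 : ℂ) * (Real.cos q.2 + Real.sin q.2 * Complex.I) := by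
      fun_prop
    have h2 : (Complex.polarCoord.symm : ℝ × ℝ → ℂ) = fun q : ℝ × ℝ =>
        (q.1 : ℂ) * (Real.cos q.2 + Real.sin q.2 * Complex.I) := by
      ext q : 1
      rw [Complex.polarCoord_symm_apply]
    rw [h2]
    exact this.measurable
  calc ‖h c‖ₑ * ENNReal.ofReal (Real.pi * R ^ 2)
      = ∫⁻ r in Set.Ioc 0 R, ENNReal.ofReal r * (‖h c‖ₑ * ENNReal.ofReal (2 * Real.pi)) := by
        have h1 := lintegral_Ioc_rpow_le (σ := 1) (by norm_num) hR
        simp only [Real.rpow_one] at h1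
        have hm : Measurable fun r : ℝ => ENNReal.ofReal r := by fun_prop
        rw [lintegral_mul_const _ hm, h1, mul_comm (ENNReal.ofReal _), mul_assoc,
          ← ENNReal.ofReal_mul (by positivity)]
        congr 2
        rw [show (1 : ℝ) + 1 = 2 by norm_num, Real.rpow_two]
        ring
    _ = ∫⁻ r in Set.Ioo 0 R, ENNReal.ofReal r * (‖h c‖ₑ * ENNReal.ofReal (2 * Real.pi)) :=
        setLIntegral_congr Ioo_ae_eq_Ioc.symm
    _ ≤ ∫⁻ r in Set.Ioo 0 R, ∫⁻ θ in Set.Ioo (-Real.pi) Real.pi,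
          ENNReal.ofReal r * H (c + Complex.polarCoord.symm (r, θ)) := by
        refine setLIntegral_mono' measurableSet_Ioo fun r hr => ?_
        rw [lintegral_const_mul' _ _ ENNReal.ofReal_ne_top]
        gcongr
        have hsub : Metric.closedBall c r ⊆ Metric.ball c R := Metric.closedBall_subset_ball hr.2
        refine (enorm_mul_two_pi_le_lintegral_circle hr.1
          (hh.diffContOnCl_ball hsub)).trans (le_of_eq ?_)
        refine lintegral_congr fun θ => ?_
        rw [hH, Set.indicator_of_mem]
        apply hsub
        rw [Metric.mem_closedBall, dist_eq_norm, add_sub_cancel_left, Complex.norm_polarCoord_symm]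
        exact (abs_of_pos hr.1).le
    _ ≤ ∫⁻ r in Set.Ioi 0, ∫⁻ θ in Set.Ioo (-Real.pi) Real.pi,
          ENNReal.ofReal r * H (c + Complex.polarCoord.symm (r, θ)) :=
        lintegral_mono_set fun r hr => hr.1
    _ = ∫⁻ q in Set.Ioi (0 : ℝ) ×ˢ Set.Ioo (-Real.pi) Real.pi,
          ENNReal.ofReal q.1 * H (c + Complex.polarCoord.symm q) := by
        rw [Measure.volume_eq_prod, ← Measure.prod_restrict, lintegral_prod]
        exact (Measurable.mul (by fun_prop) hpm).aemeasurable
    _ = ∫⁻ z, H (c + z) := by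
        rw [← Complex.lintegral_comp_polarCoord_symm, polarCoord_target]
        rfl
    _ = ∫⁻ z, H z := lintegral_add_left_eq_self H c
    _ = _ := by rw [hH, lintegral_indicator measurableSet_ball]

/-- For `0 < p < 1` a mean value inequality for `|h|^p`. It follows from the one for `|h|`,
applied at the point where `(R - |z - c|)^{2/p} |h(z)|` is largest: near that point `|h|` is
bounded by a multiple of its value there, which allows trading the exponent `1` for `p`. -/
theorem exists_enorm_rpow_mul_le_lintegral_ball {p : ℝ} (hp0 : 0 < p) (hp1 : p < 1) :
    ∃ C : ℝ, 0 < C ∧ ∀ (h : ℂ → ℂ) (c : ℂ) (R : ℝ), 0 < R →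
      DiffContOnCl ℂ h (Metric.ball c R) →
      ‖h c‖ₑ ^ p ≤ ENNReal.ofReal (C * (R ^ 2)⁻¹) * ∫⁻ z in Metric.ball c R, ‖h z‖ₑ ^ p := by
  have hpi := Real.pi_pos
  refine ⟨4 / Real.pi * (2 ^ (2 / p)) ^ (1 - p), by positivity, fun h c R hR hh => ?_⟩
  set B := ((2 : ℝ) ^ (2 / p)) ^ (1 - p) with hBdef
  have hB : 0 < B := by positivity
  have hcont : ContinuousOn (fun z => (R - ‖z - c‖) ^ (2 / p) * ‖h z‖) (Metric.closedBall c R) := by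
    refine ContinuousOn.mul ?_ (hh.continuousOn_ball).norm
    refine ContinuousOn.rpow_const (by fun_prop) fun z _ => Or.inr (by positivity)
  obtain ⟨z0, hz0, hmax⟩ := (isCompact_closedBall c R).exists_isMaxOn
    ⟨c, Metric.mem_closedBall_self hR.le⟩ hcont
  have hmax' : ∀ z ∈ Metric.closedBall c R,
      (R - ‖z - c‖) ^ (2 / p) * ‖h z‖ ≤ (R - ‖z0 - c‖) ^ (2 / p) * ‖h z0‖ := hmax
  set d := R - ‖z0 - c‖ with hd
  have hd0 : 0 ≤ d := by
    rw [mem_closedBall_iff_norm] at hz0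
    linarith
  have hc := hmax' c (Metric.mem_closedBall_self hR.le)
  rw [sub_self, norm_zero, sub_zero] at hc
  by_cases hc0 : h c = 0
  · simp [hc0, hp0]
  have hcpos : 0 < ‖h c‖ := norm_pos_iff.2 hc0
  have hMpos : 0 < d ^ (2 / p) * ‖h z0‖ := lt_of_lt_of_le (by positivity) hc
  have hd1 : 0 < d := by
    rcases hd0.eq_or_lt with h0 | h0
    · rw [← h0, Real.zero_rpow (by positivity), zero_mul] at hMpos
      exact absurd hMpos (lt_irrefl _)
    · exact h0
  have hz0pos : 0 < ‖h z0‖ := pos_of_mul_pos_right hMpos (by positivity)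
  -- on the ball of radius `d / 2` about `z0` the function is at most `2 ^ (2 / p) ‖h z0‖`
  have hsub : Metric.ball z0 (d / 2) ⊆ Metric.ball c R := by
    intro z hz
    rw [mem_ball_iff_norm] at hz ⊢
    have : ‖z - c‖ ≤ ‖z - z0‖ + ‖z0 - c‖ := norm_sub_le_norm_sub_add_norm_sub z z0 c
    linarith
  have hloc : ∀ z ∈ Metric.ball z0 (d / 2), ‖h z‖ ≤ 2 ^ (2 / p) * ‖h z0‖ := by
    intro z hz
    have h1 := hmax' z (Metric.ball_subset_closedBall (hsub hz))
    rw [mem_ball_iff_norm] at hz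
    have h2 : d / 2 ≤ R - ‖z - c‖ := by
      have : ‖z - c‖ ≤ ‖z - z0‖ + ‖z0 - c‖ := norm_sub_le_norm_sub_add_norm_sub z z0 c
      linarith
    have h3 : (d / 2) ^ (2 / p) * ‖h z‖ ≤ d ^ (2 / p) * ‖h z0‖ := by
      refine le_trans ?_ h1
      gcongr
    rw [Real.div_rpow hd0 (by norm_num)] at h3
    have h4 : 0 < d ^ (2 / p) := by positivity
    have h5 : (0 : ℝ) < 2 ^ (2 / p) := by positivity
    rw [div_mul_eq_mul_div, div_le_iff₀ h5] at h3
    refine le_of_mul_le_mul_left ?_ h4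
    linarith
  have harea := enorm_mul_area_le_lintegral_ball (h := h) (c := z0) (R := d / 2) (by positivity)
    (hh.differentiableOn.mono hsub)
  set I := ∫⁻ z in Metric.ball c R, ‖h z‖ₑ ^ p with hI
  have h6 : ∫⁻ z in Metric.ball z0 (d / 2), ‖h z‖ₑ ≤
      ENNReal.ofReal (B * ‖h z0‖ ^ (1 - p)) * I := by
    calc _ ≤ ∫⁻ z in Metric.ball z0 (d / 2), ENNReal.ofReal (B * ‖h z0‖ ^ (1 - p)) * ‖h z‖ₑ ^ p := by
          refine setLIntegral_mono' measurableSet_ball fun z hz => ?_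
          have := hloc z hz
          rw [← ofReal_norm, ENNReal.ofReal_rpow_of_nonneg (norm_nonneg _) hp0.le,
            ← ENNReal.ofReal_mul (by positivity)]
          refine ENNReal.ofReal_le_ofReal ?_
          calc ‖h z‖ = ‖h z‖ ^ (1 - p) * ‖h z‖ ^ p := by
                rw [← Real.rpow_add_of_nonneg (norm_nonneg _) (by linarith) hp0.le]; simp
            _ ≤ (2 ^ (2 / p) * ‖h z0‖) ^ (1 - p) * ‖h z‖ ^ p := by
                gcongr
            _ = _ := by rw [Real.mul_rpow (by positivity) (by positivity)]
      _ = ENNReal.ofReal (B * ‖h z0‖ ^ (1 - p)) * ∫⁻ z in Metric.ball z0 (d / 2), ‖h z‖ₑ ^ p :=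
          lintegral_const_mul' _ _ ENNReal.ofReal_ne_top
      _ ≤ _ := by
          gcongr
          exact lintegral_mono_set hsub
  have h7 := harea.trans h6
  -- the two mean value inequalities combine to the estimate at `z0`, and then at `c`
  have h8 : ENNReal.ofReal (d ^ 2 * ‖h z0‖ ^ p) ≤ ENNReal.ofReal (4 / Real.pi * B) * I := by
    have hz1 : 0 < ‖h z0‖ ^ (1 - p) := by positivity
    have e1 : ENNReal.ofReal (d ^ 2 * ‖h z0‖ ^ p) =
        ENNReal.ofReal (4 / Real.pi * (‖h z0‖ ^ (1 - p))⁻¹) *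
          (‖h z0‖ₑ * ENNReal.ofReal (Real.pi * (d / 2) ^ 2)) := by
      rw [← ofReal_norm, ← ENNReal.ofReal_mul (by positivity), ← ENNReal.ofReal_mul (by positivity)]
      congr 1
      have : ‖h z0‖ = ‖h z0‖ ^ (1 - p) * ‖h z0‖ ^ p := by
        rw [← Real.rpow_add_of_nonneg (norm_nonneg _) (by linarith) hp0.le]; simp
      set a := ‖h z0‖ ^ (1 - p)
      set b := ‖h z0‖ ^ p
      rw [this]
      field_simp
      ring
    rw [e1]
    calc _ ≤ ENNReal.ofReal (4 / Real.pi * (‖h z0‖ ^ (1 - p))⁻¹) *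
          (ENNReal.ofReal (B * ‖h z0‖ ^ (1 - p)) * I) := by gcongr
      _ = _ := by
        rw [← mul_assoc, ← ENNReal.ofReal_mul (by positivity)]
        congr 2
        field_simp
  have h9 : R ^ 2 * ‖h c‖ ^ p ≤ d ^ 2 * ‖h z0‖ ^ p := by
    have := Real.rpow_le_rpow (by positivity) hc hp0.le
    rw [Real.mul_rpow (by positivity) (by positivity), Real.mul_rpow (by positivity) (by positivity),
      ← Real.rpow_mul hR.le, ← Real.rpow_mul hd0, div_mul_cancel₀ _ hp0.ne', Real.rpow_two,
      Real.rpow_two] at this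
    exact this
  calc ‖h c‖ₑ ^ p = ENNReal.ofReal ((R ^ 2)⁻¹) * ENNReal.ofReal (R ^ 2 * ‖h c‖ ^ p) := by
        rw [← ENNReal.ofReal_mul (by positivity), inv_mul_cancel_left₀ (by positivity),
          ← ofReal_norm, ENNReal.ofReal_rpow_of_nonneg (norm_nonneg _) hp0.le]
    _ ≤ ENNReal.ofReal ((R ^ 2)⁻¹) * (ENNReal.ofReal (4 / Real.pi * B) * I) := by
        gcongr
        exact (ENNReal.ofReal_le_ofReal h9).trans h8
    _ = _ := by
        rw [← mul_assoc, ← ENNReal.ofReal_mul (by positivity), mul_comm (R ^ 2)⁻¹]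

/-- Lebesgue measure on the unit disc. -/
noncomputable def discMeasure : Measure ℂ := volume.restrict (Metric.ball (0 : ℂ) 1)

instance : IsFiniteMeasure discMeasure :=
  ⟨by rw [discMeasure, Measure.restrict_apply_univ]; exact measure_ball_lt_top⟩

/-- The disc about `z` on which distances to the unit circle are comparable with `1 - ‖z‖`. -/
def whitneyBall (z : ℂ) : Set ℂ := Metric.ball z ((1 - ‖z‖) / 2)

theorem whitneyBall_bounds {z w : ℂ} (hw : w ∈ whitneyBall z) :
    (1 - ‖z‖) / 2 ≤ 1 - ‖w‖ ∧ 1 - ‖w‖ ≤ 2 * (1 - ‖z‖) ∧ 0 < 1 - ‖z‖ := by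
  rw [whitneyBall, mem_ball_iff_norm] at hw
  have h1 := norm_le_norm_add_norm_sub' w z
  have h2 := norm_le_norm_add_norm_sub w z
  have h3 := norm_nonneg (w - z)
  refine ⟨?_, ?_, ?_⟩ <;> linarith

theorem whitneyBall_subset {z : ℂ} : whitneyBall z ⊆ Metric.ball 0 1 := by
  intro w hw
  obtain ⟨h1, -, h3⟩ := whitneyBall_bounds hw
  rw [mem_ball_zero_iff]
  linarith

theorem measurableSet_whitneyBall_prod :
    MeasurableSet {q : ℂ × ℂ | q.2 ∈ whitneyBall q.1} := by
  have : {q : ℂ × ℂ | q.2 ∈ whitneyBall q.1} = {q : ℂ × ℂ | dist q.2 q.1 < (1 - ‖q.1‖) / 2} := rfl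
  rw [this]
  exact measurableSet_lt (by fun_prop) (by fun_prop)

/-- The kernel of the averaging operator over the discs `whitneyBall z`. -/
noncomputable def avgKernel (C : ℝ) (z w : ℂ) : ℝ≥0∞ :=
  ENNReal.ofReal (C * ((1 - ‖z‖) ^ 2)⁻¹) * (whitneyBall z).indicator 1 w

theorem measurable_avgKernel (C : ℝ) : Measurable fun q : ℂ × ℂ => avgKernel C q.1 q.2 := by
  unfold avgKernel
  refine Measurable.mul (by fun_prop) ?_
  have : (fun q : ℂ × ℂ => (whitneyBall q.1).indicator (1 : ℂ → ℝ≥0∞) q.2) =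
      {q : ℂ × ℂ | q.2 ∈ whitneyBall q.1}.indicator 1 := by
    ext q; simp [Set.indicator]
  rw [this]
  exact measurable_one.indicator measurableSet_whitneyBall_prod

theorem lintegral_mul_avgKernel (C : ℝ) (z : ℂ) (F : ℂ → ℝ≥0∞) :
    ∫⁻ w, F w * avgKernel C z w ∂discMeasure =
      ENNReal.ofReal (C * ((1 - ‖z‖) ^ 2)⁻¹) * ∫⁻ w in whitneyBall z, F w := by
  have hm : MeasurableSet (whitneyBall z) := measurableSet_ball
  have h : ∀ w, F w * avgKernel C z w = (whitneyBall z).indicator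
      (fun w => ENNReal.ofReal (C * ((1 - ‖z‖) ^ 2)⁻¹) * F w) w := by
    intro w
    by_cases hw : w ∈ whitneyBall z <;> simp [avgKernel, hw, mul_comm]
  simp_rw [h]
  rw [lintegral_indicator hm, discMeasure, Measure.restrict_restrict hm,
    Set.inter_eq_left.2 whitneyBall_subset, lintegral_const_mul' _ _ ENNReal.ofReal_ne_top]

theorem exists_enorm_rpow_le_avg {p : ℝ} (hp0 : 0 < p) (hp1 : p < 1) :
    ∃ C : ℝ, 0 < C ∧ ∀ h : ℂ → ℂ, DifferentiableOn ℂ h (Metric.ball 0 1) →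
      ∀ z ∈ Metric.ball (0 : ℂ) 1, ‖h z‖ₑ ^ p ≤ ∫⁻ w, ‖h w‖ₑ ^ p * avgKernel C z w ∂discMeasure := by
  obtain ⟨C, hC, H⟩ := exists_enorm_rpow_mul_le_lintegral_ball hp0 hp1
  refine ⟨C * 4, by positivity, fun h hh z hz => ?_⟩
  have hz1 : 0 < 1 - ‖z‖ := by rw [mem_ball_zero_iff] at hz; linarith
  rw [lintegral_mul_avgKernel]
  have hsub : Metric.closedBall z ((1 - ‖z‖) / 2) ⊆ Metric.ball 0 1 := by
    intro w hw
    rw [mem_closedBall_iff_norm] at hw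
    rw [mem_ball_zero_iff]
    have := norm_le_norm_add_norm_sub' w z
    linarith
  have := H h z ((1 - ‖z‖) / 2) (by positivity) (hh.diffContOnCl_ball hsub)
  refine this.trans (le_of_eq ?_)
  rw [whitneyBall]
  congr 2
  field_simp
  norm_num

theorem exists_lintegral_norm_one_sub_mul_le {β : ℝ} (hβ : 0 < β) :
    ∃ C : ℝ, 0 < C ∧ ∀ x ∈ Metric.ball (0 : ℂ) 1,
      ∫⁻ t in Set.Ioc (0 : ℝ) 1, ENNReal.ofReal (‖1 - (t : ℂ) * x‖ ^ (-(β + 2))) ≤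
        ENNReal.ofReal (C * ‖1 - x‖ ^ (-(β + 1))) := by
  obtain ⟨C, hC, H⟩ := exists_lintegral_rpow_mul_add_rpow_le (σ := 0) (e := β + 2)
    (by norm_num) (by linarith)
  refine ⟨3 ^ (β + 2) * C, by positivity, fun x hx => ?_⟩
  rw [mem_ball_zero_iff] at hx
  set δ := ‖1 - x‖ with hδ
  have hδ0 : 0 < δ := by
    have := norm_sub_norm_le 1 x
    rw [norm_one] at this
    linarith
  calc _ ≤ ∫⁻ t in Set.Ioc (0 : ℝ) 1,
        ENNReal.ofReal (3 ^ (β + 2)) * ENNReal.ofReal (((1 - t) + δ) ^ (-(β + 2))) := by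
        refine setLIntegral_mono' measurableSet_Ioc fun t ht => ?_
        rw [← ENNReal.ofReal_mul (by positivity)]
        refine ENNReal.ofReal_le_ofReal ?_
        -- `1 - t ≤ ‖1 - t x‖` and `‖1 - x‖ ≤ ‖1 - t x‖ + (1 - t)`
        have h1 : 1 - t ≤ ‖1 - (t : ℂ) * x‖ := by
          have := norm_sub_norm_le 1 ((t : ℂ) * x)
          rw [norm_one, norm_mul, Complex.norm_real, Real.norm_of_nonneg ht.1.le] at this
          nlinarith [ht.1]
        have h2 : δ ≤ ‖1 - (t : ℂ) * x‖ + (1 - t) := by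
          have e : 1 - x = (1 - (t : ℂ) * x) - ((1 - t : ℝ) : ℂ) * x := by push_cast; ring
          rw [hδ, e]
          refine (norm_sub_le _ _).trans ?_
          rw [norm_mul, Complex.norm_real, Real.norm_of_nonneg (by linarith [ht.2])]
          nlinarith [ht.2]
        have h3 : 0 < (1 - t) + δ := by linarith [ht.2]
        have h4 : ((1 - t) + δ) ≤ 3 * ‖1 - (t : ℂ) * x‖ := by linarith
        have h5 : 0 < ‖1 - (t : ℂ) * x‖ := by linarith
        have h6 := Real.rpow_le_rpow_of_nonpos (z := -(β + 2)) h3 h4 (by linarith)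
        rw [Real.mul_rpow (by norm_num) h5.le, Real.rpow_neg (by norm_num),
          inv_mul_le_iff₀ (by positivity)] at h6
        exact h6
    _ = ENNReal.ofReal (3 ^ (β + 2)) *
        ∫⁻ t in Set.Ioc (0 : ℝ) 1, ENNReal.ofReal (((1 - t) + δ) ^ (-(β + 2))) :=
        lintegral_const_mul' _ _ ENNReal.ofReal_ne_top
    _ ≤ ENNReal.ofReal (3 ^ (β + 2)) * ENNReal.ofReal (C * δ ^ (0 + 1 - (β + 2))) := by
        gcongr
        refine le_trans ?_ (H δ hδ0)
        have hmp : MeasurePreserving (fun t : ℝ => 1 - t) volume volume :=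
          Measure.measurePreserving_sub_left volume 1
        have hemb : MeasurableEmbedding (fun t : ℝ => 1 - t) :=
          (MeasurableEquiv.subLeft (1 : ℝ)).measurableEmbedding
        have h := hmp.setLIntegral_comp_preimage_emb hemb
          (fun t => ENNReal.ofReal (t ^ (0 : ℝ) * (t + δ) ^ (-(β + 2)))) (Set.Ioi 0)
        rw [← h, setLIntegral_congr Ioo_ae_eq_Ioc.symm]
        simp only [Real.rpow_zero, one_mul]
        refine lintegral_mono_set fun r hr => ?_
        simpa using hr.2
    _ = _ := by
        rw [← ENNReal.ofReal_mul (by positivity)]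
        ring_nf

/-- The kernel `(1 - |w|)^A / |1 - w z̄|^c`. -/
noncomputable def powKernel (A c : ℝ) (z w : ℂ) : ℝ :=
  (1 - ‖w‖) ^ A * ‖1 - w * (starRingEnd ℂ) z‖ ^ (-c)

theorem measurable_powKernel (A c : ℝ) : Measurable fun q : ℂ × ℂ => powKernel A c q.1 q.2 := by
  unfold powKernel
  have : Measurable (starRingEnd ℂ) := Complex.continuous_conj.measurable
  have h2 : Measurable fun q : ℂ × ℂ => (starRingEnd ℂ) q.1 := this.comp measurable_fst
  fun_prop

/-- A holomorphic function is recovered from `D h = (w h)'` by radial integration,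
`h z = ∫₀¹ D h (t z) dt`. -/
theorem enorm_le_lintegral_radial {h : ℂ → ℂ} (hh : DifferentiableOn ℂ h (Metric.ball 0 1))
    {z : ℂ} (hz : z ∈ Metric.ball (0 : ℂ) 1) :
    ‖h z‖ₑ ≤ ∫⁻ t in Set.Ioc (0 : ℝ) 1, ‖deriv (fun w => w * h w) ((t : ℂ) * z)‖ₑ := by
  have hG : DifferentiableOn ℂ (fun w => w * h w) (Metric.ball 0 1) :=
    differentiableOn_id.mul hh
  have hDc : ContinuousOn (deriv fun w => w * h w) (Metric.ball 0 1) :=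
    (hG.deriv Metric.isOpen_ball).continuousOn
  have hmem : ∀ t ∈ Set.Icc (0 : ℝ) 1, (t : ℂ) * z ∈ Metric.ball (0 : ℂ) 1 := by
    intro t ht
    rw [mem_ball_zero_iff] at hz ⊢
    rw [norm_mul, Complex.norm_real, Real.norm_of_nonneg ht.1]
    nlinarith [ht.2, norm_nonneg z]
  have hcont : ContinuousOn (fun t : ℝ => deriv (fun w => w * h w) ((t : ℂ) * z))
      (Set.Icc 0 1) := by
    refine hDc.comp ?_ hmem
    fun_prop
  by_cases hz0 : z = 0
  · subst hz0
    have hd : deriv (fun w => w * h w) 0 = h 0 := by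
      have h0 : DifferentiableAt ℂ h 0 := hh.differentiableAt (Metric.isOpen_ball.mem_nhds hz)
      rw [deriv_fun_mul differentiableAt_fun_id h0]
      simp
    simp [hd]
  have hFTC : ∫ t in (0 : ℝ)..1, z * deriv (fun w => w * h w) ((t : ℂ) * z) = z * h z := by
    have := intervalIntegral.integral_eq_sub_of_hasDerivAt
      (f := fun t : ℝ => ((t : ℂ) * z) * h ((t : ℂ) * z))
      (f' := fun t : ℝ => z * deriv (fun w => w * h w) ((t : ℂ) * z)) (a := 0) (b := 1) ?_ ?_
    · rw [this]; simp
    · intro t ht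
      rw [Set.uIcc_of_le zero_le_one] at ht
      have h1 : HasDerivAt (fun w => w * h w) (deriv (fun w => w * h w) ((t : ℂ) * z))
          ((t : ℂ) * z) :=
        (hG.differentiableAt (Metric.isOpen_ball.mem_nhds (hmem t ht))).hasDerivAt
      have h2 : HasDerivAt (fun t : ℝ => (t : ℂ) * z) z t := by
        simpa using (Complex.ofRealCLM.hasDerivAt (x := t)).mul_const z
      have := h1.comp t h2
      rw [mul_comm] at this
      exact this
    · refine ContinuousOn.intervalIntegrable ?_
      rw [Set.uIcc_of_le zero_le_one]
      exact continuousOn_const.mul hcont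
  rw [intervalIntegral.integral_const_mul] at hFTC
  have h3 := mul_left_cancel₀ hz0 hFTC
  rw [← h3, intervalIntegral.integral_of_le zero_le_one]
  exact enorm_integral_le_lintegral_enorm _

theorem powKernel_aux_le {β : ℝ} (hβ : 0 < β) {t : ℝ} (ht : t ∈ Set.Ioc (0 : ℝ) 1) {z w : ℂ}
    (hz : z ∈ Metric.ball (0 : ℂ) 1) (hw : w ∈ whitneyBall ((t : ℂ) * z)) :
    ((1 - ‖(t : ℂ) * z‖) ^ 2)⁻¹ ≤
      2 ^ β * 3 ^ (β + 2) * (1 - ‖w‖) ^ β *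
        ‖1 - (t : ℂ) * (w * (starRingEnd ℂ) z)‖ ^ (-(β + 2)) := by
  obtain ⟨h1, -, h3⟩ := whitneyBall_bounds hw
  rw [whitneyBall, mem_ball_iff_norm] at hw
  rw [mem_ball_zero_iff] at hz
  set d := 1 - ‖(t : ℂ) * z‖ with hd
  have htz : ‖(t : ℂ) * z‖ = 1 - d := by rw [hd]; ring
  have htz0 : 0 ≤ 1 - d := htz ▸ norm_nonneg _
  have hw1 : 0 < 1 - ‖w‖ := by linarith
  set N := ‖1 - (t : ℂ) * (w * (starRingEnd ℂ) z)‖ with hN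
  have hN3 : N ≤ 3 * d := by
    have e : 1 - (t : ℂ) * (w * (starRingEnd ℂ) z) =
        (1 - ((t : ℂ) * z) * (starRingEnd ℂ) ((t : ℂ) * z)) -
          (w - (t : ℂ) * z) * (starRingEnd ℂ) ((t : ℂ) * z) := by
      simp only [map_mul, Complex.conj_ofReal]; ring
    rw [hN, e]
    refine (norm_sub_le _ _).trans ?_
    rw [norm_mul, Complex.norm_conj, htz, Complex.mul_conj, Complex.normSq_eq_norm_sq, htz]
    have : ‖(1 : ℂ) - (((1 - d) ^ 2 : ℝ) : ℂ)‖ = 1 - (1 - d) ^ 2 := by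
      rw [← Complex.ofReal_one, ← Complex.ofReal_sub, Complex.norm_real, Real.norm_of_nonneg]
      nlinarith
    rw [this]
    nlinarith [norm_nonneg (w - (t : ℂ) * z)]
  have hN0 : 0 < N := by
    have := norm_sub_norm_le 1 ((t : ℂ) * (w * (starRingEnd ℂ) z))
    rw [norm_one, norm_mul, norm_mul, Complex.norm_conj, Complex.norm_real,
      Real.norm_of_nonneg ht.1.le] at this
    have h5 : t * (‖w‖ * ‖z‖) < 1 := by
      have h6 : ‖w‖ * ‖z‖ < 1 := by nlinarith [norm_nonneg z, norm_nonneg w]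
      nlinarith [ht.1, ht.2, mul_nonneg (norm_nonneg w) (norm_nonneg z)]
    linarith
  have k1 : d ^ β ≤ 2 ^ β * (1 - ‖w‖) ^ β := by
    rw [← Real.mul_rpow (by norm_num) hw1.le]
    exact Real.rpow_le_rpow h3.le (by linarith) hβ.le
  have k2 : d ^ (-(β + 2)) ≤ 3 ^ (β + 2) * N ^ (-(β + 2)) := by
    have h6 := Real.rpow_le_rpow_of_nonpos (x := N / 3) (y := d) (z := -(β + 2)) (by positivity)
      (by linarith) (by linarith)
    rw [Real.div_rpow hN0.le (by norm_num), Real.rpow_neg (x := 3) (by norm_num), div_inv_eq_mul,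
      mul_comm] at h6
    exact h6
  calc (d ^ 2)⁻¹ = d ^ β * d ^ (-(β + 2)) := by
        rw [← Real.rpow_add h3, show β + -(β + 2) = -2 by ring, Real.rpow_neg h3.le, Real.rpow_two]
    _ ≤ (2 ^ β * (1 - ‖w‖) ^ β) * (3 ^ (β + 2) * N ^ (-(β + 2))) := by gcongr
    _ = _ := by ring

/-- A holomorphic function on the disc is dominated by an integral operator applied to
`D h = (w h)'`: combine radial integration with the area mean value inequality for `D h`. -/
theorem exists_enorm_le_powKernel {β : ℝ} (hβ : 0 < β) :
    ∃ C : ℝ, 0 < C ∧ ∀ h : ℂ → ℂ, DifferentiableOn ℂ h (Metric.ball 0 1) →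
      ∀ z ∈ Metric.ball (0 : ℂ) 1, ‖h z‖ₑ ≤ ∫⁻ w, ‖deriv (fun w => w * h w) w‖ₑ *
        ENNReal.ofReal (C * powKernel β (β + 1) z w) ∂discMeasure := by
  obtain ⟨C, hC, H⟩ := exists_lintegral_norm_one_sub_mul_le hβ
  have hpi := Real.pi_pos
  set C1 : ℝ := 4 / Real.pi * (2 ^ β * 3 ^ (β + 2)) with hC1
  have hC10 : 0 < C1 := by positivity
  refine ⟨C1 * C, by positivity, fun h hh z hz => ?_⟩
  have hG : DifferentiableOn ℂ (fun w => w * h w) (Metric.ball 0 1) := differentiableOn_id.mul hh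
  have hDd := hG.deriv Metric.isOpen_ball
  set Dh := deriv fun w => w * h w with hDh
  have hmem : ∀ t ∈ Set.Ioc (0 : ℝ) 1, (t : ℂ) * z ∈ Metric.ball (0 : ℂ) 1 := by
    intro t ht
    rw [mem_ball_zero_iff] at hz ⊢
    rw [norm_mul, Complex.norm_real, Real.norm_of_nonneg ht.1.le]
    nlinarith [ht.2, norm_nonneg z]
  set E : ℂ → ℝ≥0∞ := fun w => ‖(Metric.ball (0 : ℂ) 1).indicator Dh w‖ₑ with hE
  have hEm : Measurable E :=
    (hDd.continuousOn.measurable_indicator_of_measurableSet measurableSet_ball).enorm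
  have hEeq : ∀ w ∈ Metric.ball (0 : ℂ) 1, E w = ‖Dh w‖ₑ := fun w hw => by
    simp only [hE, Set.indicator_of_mem hw]
  have hEeq' : ∀ k : ℂ → ℝ≥0∞, ∫⁻ w, E w * k w ∂discMeasure = ∫⁻ w, ‖Dh w‖ₑ * k w ∂discMeasure :=
    fun k => setLIntegral_congr_fun measurableSet_ball fun w hw => by simp only [hEeq w hw]
  have hconj : Measurable (starRingEnd ℂ) := Complex.continuous_conj.measurable
  calc ‖h z‖ₑ ≤ ∫⁻ t in Set.Ioc (0 : ℝ) 1, ‖Dh ((t : ℂ) * z)‖ₑ := enorm_le_lintegral_radial hh hz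
    _ ≤ ∫⁻ t in Set.Ioc (0 : ℝ) 1, ∫⁻ w, E w * ENNReal.ofReal (C1 * (1 - ‖w‖) ^ β *
          ‖1 - (t : ℂ) * (w * (starRingEnd ℂ) z)‖ ^ (-(β + 2))) ∂discMeasure := by
        refine setLIntegral_mono' measurableSet_Ioc fun t ht => ?_
        have ht1 := hmem t ht
        have hd : 0 < 1 - ‖(t : ℂ) * z‖ := by rw [mem_ball_zero_iff] at ht1; linarith
        have harea := enorm_mul_area_le_lintegral_ball (h := Dh) (c := (t : ℂ) * z)
          (R := (1 - ‖(t : ℂ) * z‖) / 2) (by positivity) (hDd.mono whitneyBall_subset)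
        set d := 1 - ‖(t : ℂ) * z‖
        calc ‖Dh ((t : ℂ) * z)‖ₑ = ENNReal.ofReal (4 / Real.pi * (d ^ 2)⁻¹) *
              (‖Dh ((t : ℂ) * z)‖ₑ * ENNReal.ofReal (Real.pi * (d / 2) ^ 2)) := by
              rw [mul_comm (‖_‖ₑ), ← mul_assoc, ← ENNReal.ofReal_mul (by positivity)]
              have : 4 / Real.pi * (d ^ 2)⁻¹ * (Real.pi * (d / 2) ^ 2) = 1 := by
                field_simp; norm_num
              rw [this, ENNReal.ofReal_one, one_mul]
          _ ≤ ENNReal.ofReal (4 / Real.pi * (d ^ 2)⁻¹) *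
              ∫⁻ w in whitneyBall ((t : ℂ) * z), ‖Dh w‖ₑ := by gcongr; exact harea
          _ = ∫⁻ w in whitneyBall ((t : ℂ) * z), ENNReal.ofReal (4 / Real.pi * (d ^ 2)⁻¹) * ‖Dh w‖ₑ :=
              (lintegral_const_mul' _ _ ENNReal.ofReal_ne_top).symm
          _ ≤ ∫⁻ w in whitneyBall ((t : ℂ) * z), E w * ENNReal.ofReal (C1 * (1 - ‖w‖) ^ β *
              ‖1 - (t : ℂ) * (w * (starRingEnd ℂ) z)‖ ^ (-(β + 2))) := by
              refine setLIntegral_mono' measurableSet_ball fun w hw => ?_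
              rw [hEeq w (whitneyBall_subset hw), mul_comm]
              refine mul_le_mul' le_rfl (ENNReal.ofReal_le_ofReal ?_)
              have := powKernel_aux_le hβ ht hz hw
              calc 4 / Real.pi * (d ^ 2)⁻¹ ≤ 4 / Real.pi * (2 ^ β * 3 ^ (β + 2) * (1 - ‖w‖) ^ β *
                  ‖1 - (t : ℂ) * (w * (starRingEnd ℂ) z)‖ ^ (-(β + 2))) := by gcongr
                _ = _ := by rw [hC1]; ring
          _ ≤ ∫⁻ w, E w * ENNReal.ofReal (C1 * (1 - ‖w‖) ^ β *
              ‖1 - (t : ℂ) * (w * (starRingEnd ℂ) z)‖ ^ (-(β + 2))) ∂discMeasure := by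
              rw [discMeasure]
              exact lintegral_mono_set whitneyBall_subset
    _ = ∫⁻ w, (∫⁻ t in Set.Ioc (0 : ℝ) 1, E w * ENNReal.ofReal (C1 * (1 - ‖w‖) ^ β *
          ‖1 - (t : ℂ) * (w * (starRingEnd ℂ) z)‖ ^ (-(β + 2)))) ∂discMeasure := by
        refine lintegral_lintegral_swap (Measurable.aemeasurable ?_)
        have h1 : Measurable fun q : ℝ × ℂ => E q.2 := hEm.comp measurable_snd
        unfold Function.uncurry
        refine h1.mul ?_
        fun_prop
    _ ≤ ∫⁻ w, E w * ENNReal.ofReal (C1 * C * powKernel β (β + 1) z w) ∂discMeasure := by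
        refine setLIntegral_mono' measurableSet_ball fun w hw => ?_
        have hw1 : 0 < 1 - ‖w‖ := by rw [mem_ball_zero_iff] at hw; linarith
        have hEt : E w ≠ ∞ := enorm_ne_top
        rw [lintegral_const_mul' _ _ hEt]
        gcongr
        have hx : w * (starRingEnd ℂ) z ∈ Metric.ball (0 : ℂ) 1 := by
          rw [mem_ball_zero_iff] at hz hw ⊢
          rw [norm_mul, Complex.norm_conj]
          nlinarith [norm_nonneg z, norm_nonneg w]
        calc _ = ENNReal.ofReal (C1 * (1 - ‖w‖) ^ β) * ∫⁻ t in Set.Ioc (0 : ℝ) 1,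
              ENNReal.ofReal (‖1 - (t : ℂ) * (w * (starRingEnd ℂ) z)‖ ^ (-(β + 2))) := by
              rw [← lintegral_const_mul' _ _ ENNReal.ofReal_ne_top]
              refine lintegral_congr fun t => ?_
              rw [← ENNReal.ofReal_mul (by positivity)]
          _ ≤ ENNReal.ofReal (C1 * (1 - ‖w‖) ^ β) *
              ENNReal.ofReal (C * ‖1 - w * (starRingEnd ℂ) z‖ ^ (-(β + 1))) := by
              gcongr; exact H _ hx
          _ = _ := by
              rw [← ENNReal.ofReal_mul (by positivity), powKernel]
              ring_nf
    _ = _ := hEeq' _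

/-! ### Integration over the polydisc -/

theorem lintegral_pi_prod_eq_prod {n : ℕ} {E : Type*} [MeasurableSpace E] (μ : Fin n → Measure E)
    [∀ i, SigmaFinite (μ i)] {f : Fin n → E → ℝ≥0∞} (hf : ∀ i, Measurable (f i)) :
    ∫⁻ x : Fin n → E, ∏ i, f i (x i) ∂(Measure.pi μ) = ∏ i, ∫⁻ x, f i x ∂(μ i) := by
  induction n with
  | zero => simp
  | succ n ih =>
    rw [← ((measurePreserving_piFinSuccAbove μ 0).symm).lintegral_comp_emb
      (MeasurableEquiv.measurableEmbedding _)]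
    simp_rw [MeasurableEquiv.piFinSuccAbove_symm_apply, Fin.insertNthEquiv,
      Fin.prod_univ_succ, Fin.insertNth_zero, Equiv.coe_fn_mk, Fin.cons_succ,
      Fin.zero_succAbove, cast_eq, Fin.cons_zero]
    rw [← ih (fun i => μ i.succ) (fun i => hf i.succ)]
    refine lintegral_prod_mul (μ := μ 0) (ν := Measure.pi fun i : Fin n => μ i.succ) (f := f 0)
      (g := fun x => ∏ i : Fin n, f i.succ (x i)) (hf 0).aemeasurable (Measurable.aemeasurable ?_)
    exact Finset.measurable_prod _ fun i _ => (hf i.succ).comp (measurable_pi_apply i)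

/-- Lebesgue measure on the polydisc, as a product of measures on discs. -/
noncomputable abbrev polydiscMeasure (n : ℕ) : Measure (Fin n → ℂ) :=
  Measure.pi fun _ => discMeasure

theorem polydisc_eq_pi (n : ℕ) : polydisc n = Set.univ.pi fun _ => Metric.ball (0 : ℂ) 1 := by
  ext z; simp [polydisc]

theorem restrict_polydisc (n : ℕ) :
    (volume : Measure (Fin n → ℂ)).restrict (polydisc n) = polydiscMeasure n := by
  rw [polydisc_eq_pi, volume_pi, Measure.restrict_pi_pi]
  rfl

theorem isOpen_polydisc (n : ℕ) : IsOpen (polydisc n) := by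
  rw [polydisc_eq_pi]
  exact isOpen_set_pi Set.finite_univ fun _ _ => Metric.isOpen_ball

theorem measurableSet_polydisc (n : ℕ) : MeasurableSet (polydisc n) :=
  (isOpen_polydisc n).measurableSet

theorem mem_ball_of_mem_polydisc {n : ℕ} {z : Fin n → ℂ} (hz : z ∈ polydisc n) (j : Fin n) :
    z j ∈ Metric.ball (0 : ℂ) 1 := by
  rw [mem_ball_zero_iff]; exact hz j

theorem update_mem_polydisc {n : ℕ} {z : Fin n → ℂ} (hz : z ∈ polydisc n) {j : Fin n} {w : ℂ}
    (hw : w ∈ Metric.ball (0 : ℂ) 1) : Function.update z j w ∈ polydisc n := by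
  intro i
  by_cases h : i = j
  · subst h; simpa using hw
  · rw [Function.update_of_ne h]; exact hz i

theorem lintegral_polydiscMeasure (n : ℕ) (F : (Fin n → ℂ) → ℝ≥0∞) :
    ∫⁻ z in polydisc n, F z = ∫⁻ z, F z ∂polydiscMeasure n := by
  rw [restrict_polydisc]

theorem ae_mem_polydisc (n : ℕ) : ∀ᵐ z ∂polydiscMeasure n, z ∈ polydisc n := by
  rw [← restrict_polydisc]
  exact ae_restrict_mem (measurableSet_polydisc n)

/-- Almost every point of the polydisc has all coordinates different from zero. -/
theorem ae_forall_ne_zero (n : ℕ) : ∀ᵐ z ∂polydiscMeasure n, ∀ j, z j ≠ 0 := by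
  rw [ae_all_iff]
  intro j
  have : NullSingletonClass discMeasure := by unfold discMeasure; infer_instance
  exact Measure.ae_eval_ne (fun _ => discMeasure) j 0

/-- Iterating one-variable integral inequalities `Φ_l(x) ≤ ∫ Φ_{j :: l} k_j`, over all
coordinates `j`, yields the corresponding inequality for the product kernel. -/
theorem le_lintegral_prod_of_forall_le {n : ℕ} {Φ : List (Fin n) → (Fin n → ℂ) → ℝ≥0∞}
    {k : Fin n → ℂ → ℂ → ℝ≥0∞} (hΦ : ∀ l, l.Nodup → Measurable (Φ l))
    (hk : ∀ j z, Measurable (k j z))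
    (h : ∀ j l, (j :: l).Nodup → ∀ x, Φ l x ≤
      ∫⁻ w, Φ (j :: l) (Function.update x j w) * k j (x j) w ∂discMeasure)
    (x : Fin n → ℂ) :
    Φ [] x ≤ ∫⁻ y, Φ (List.finRange n) y * ∏ j, k j (x j) (y j) ∂polydiscMeasure n := by
  have key : ∀ l : List (Fin n), l.Nodup → Φ [] x ≤
      (∫⋯∫⁻_l.toFinset, (fun y => Φ l y * ∏ j ∈ l.toFinset, k j (x j) (y j))
        ∂(fun _ => discMeasure)) x := by
    intro l
    induction l with
    | nil => intro _; simp
    | cons j l ih =>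
      intro hl
      have hjl : j ∉ l.toFinset := by
        rw [List.mem_toFinset]; exact (List.nodup_cons.1 hl).1
      refine (ih (List.nodup_cons.1 hl).2).trans ?_
      set G : (Fin n → ℂ) → ℝ≥0∞ :=
        fun y => Φ (j :: l) y * ∏ i ∈ (j :: l).toFinset, k i (x i) (y i) with hG
      have hGm : Measurable G := by
        refine (hΦ _ hl).mul (Finset.measurable_prod _ fun i _ => ?_)
        exact (hk i (x i)).comp (measurable_pi_apply i)
      rw [List.toFinset_cons, lmarginal_insert' G hGm hjl]
      unfold lmarginal
      refine lintegral_mono fun y => ?_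
      set y' := Function.updateFinset x l.toFinset y with hy'
      have hyj : y' j = x j := by
        rw [hy', Function.updateFinset, dif_neg hjl]
      have hG' : ∀ w, G (Function.update y' j w) =
          Φ (j :: l) (Function.update y' j w) * k j (y' j) w *
            ∏ i ∈ l.toFinset, k i (x i) (y' i) := by
        intro w
        simp only [hG]
        rw [List.toFinset_cons, Finset.prod_insert hjl, Function.update_self, hyj, ← mul_assoc]
        congr 1
        refine Finset.prod_congr rfl fun i hi => ?_
        rw [Function.update_of_ne (ne_of_mem_of_not_mem hi hjl)]
      simp only [hG']
      have hm : Measurable fun w => Φ (j :: l) (Function.update y' j w) * k j (y' j) w :=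
        ((hΦ _ hl).comp (measurable_update y')).mul (hk _ _)
      rw [lintegral_mul_const _ hm]
      gcongr
      exact h j l hl y'
  have := key (List.finRange n) (List.nodup_finRange n)
  rwa [List.toFinset_finRange, lmarginal_univ] at this

/-! ### Separately holomorphic functions on the polydisc -/

/-- Continuous functions on the polydisc that are holomorphic in each variable. The class is
convenient because it is visibly stable under the operators `∂/∂z_j`; it coincides with the class
of holomorphic functions. -/
structure SepHolomorphic {n : ℕ} (f : (Fin n → ℂ) → ℂ) : Prop where
  continuousOn : ContinuousOn f (polydisc n)
  slice : ∀ z ∈ polydisc n, ∀ j : Fin n,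
    DifferentiableOn ℂ (fun w => f (Function.update z j w)) (Metric.ball 0 1)

theorem differentiable_update {n : ℕ} (z : Fin n → ℂ) (j : Fin n) :
    Differentiable ℂ fun w : ℂ => Function.update z j w := fun w =>
  (hasFDerivAt_update (E := fun _ : Fin n => ℂ) (𝕜 := ℂ) z (i := j) w).differentiableAt

theorem DifferentiableOn.sepHolomorphic {n : ℕ} {f : (Fin n → ℂ) → ℂ}
    (hf : DifferentiableOn ℂ f (polydisc n)) : SepHolomorphic f where
  continuousOn := hf.continuousOn
  slice z hz j := by
    exact hf.comp (differentiable_update z j).differentiableOn fun w hw => update_mem_polydisc hz hw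

theorem SepHolomorphic.coord_mul {n : ℕ} {f : (Fin n → ℂ) → ℂ} (hf : SepHolomorphic f)
    (i : Fin n) : SepHolomorphic fun z => z i * f z where
  continuousOn := (continuous_apply i).continuousOn.mul hf.continuousOn
  slice z hz j := by
    refine DifferentiableOn.mul ?_ (hf.slice z hz j)
    exact ((differentiable_apply i).comp (differentiable_update z j)).differentiableOn

open Filter Topology in
theorem SepHolomorphic.continuousOn_partialDeriv {n : ℕ} {f : (Fin n → ℂ) → ℂ}
    (hf : SepHolomorphic f) (j : Fin n) : ContinuousOn (partialDeriv j f) (polydisc n) := by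
  intro z0 hz0
  -- the slices through `z` converge locally uniformly as `z → z0`, hence so do their derivatives
  have hcont : ContinuousOn (fun q : (Fin n → ℂ) × ℂ => f (Function.update q.1 j q.2))
      (polydisc n ×ˢ Metric.ball 0 1) := by
    refine hf.continuousOn.comp ?_ fun q hq => update_mem_polydisc hq.1 hq.2
    exact (continuous_fst.update j continuous_snd).continuousOn
  have hlu : TendstoLocallyUniformlyOn (fun z w => f (Function.update z j w))
      (fun w => f (Function.update z0 j w)) (𝓝[polydisc n] z0) (Metric.ball 0 1) := by
    rw [Metric.tendstoLocallyUniformlyOn_iff]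
    intro ε hε w0 hw0
    have hc := hcont (z0, w0) ⟨hz0, hw0⟩
    have hc' := Metric.continuousWithinAt_iff'.1 hc (ε / 2) (by positivity)
    rw [nhdsWithin_prod_eq] at hc'
    obtain ⟨P, hP, Q, hQ, hPQ⟩ := eventually_prod_iff.1 hc'
    refine ⟨{w | Q w}, hQ, ?_⟩
    filter_upwards [hP] with z hz w hw
    have hz0P : P z0 := hP.self_of_nhdsWithin hz0
    have h1 := hPQ hz hw
    have h2 := hPQ hz0P hw
    have := dist_triangle_right (f (Function.update z0 j w)) (f (Function.update z j w))
      (f (Function.update z0 j w0))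
    simp only at h1 h2
    linarith
  have hd := hlu.deriv (by
    filter_upwards [self_mem_nhdsWithin] with z hz
    exact hf.slice z hz j) Metric.isOpen_ball
  have hj : Tendsto (fun z : Fin n → ℂ => z j) (𝓝[polydisc n] z0) (𝓝[Metric.ball 0 1] (z0 j)) := by
    refine tendsto_nhdsWithin_iff.2 ⟨(continuous_apply j).continuousWithinAt, ?_⟩
    filter_upwards [self_mem_nhdsWithin] with z hz
    exact mem_ball_of_mem_polydisc hz j
  have hcd : ContinuousOn (deriv fun w => f (Function.update z0 j w)) (Metric.ball 0 1) :=
    ((hf.slice z0 hz0 j).deriv Metric.isOpen_ball).continuousOn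
  have := hd.tendsto_comp (hcd _ (mem_ball_of_mem_polydisc hz0 j))
    (mem_ball_of_mem_polydisc hz0 j) hj
  exact this

/-- The mean value inequality for `w ↦ ψ w - w * d`. -/
theorem norm_sub_inv_mul_sub_le {ψ : ℂ → ℂ} {a h d : ℂ} {r C : ℝ}
    (hd : ∀ w ∈ Metric.ball a r, HasDerivAt ψ (deriv ψ w) w)
    (hb : ∀ w ∈ Metric.ball a r, ‖deriv ψ w - d‖ ≤ C) (hh : ‖h‖ < r) (h0 : h ≠ 0) :
    ‖d - h⁻¹ * (ψ (a + h) - ψ a)‖ ≤ C := by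
  have hr : 0 < r := (norm_nonneg h).trans_lt hh
  have hmv := (convex_ball a r).norm_image_sub_le_of_norm_hasDerivWithin_le
    (f := fun w => ψ w - w * d) (f' := fun w => deriv ψ w - 1 * d) (C := C) (x := a) (y := a + h)
    (fun w hw => ((hd w hw).sub ((hasDerivAt_id w).mul_const d)).hasDerivWithinAt)
    (fun w hw => by rw [one_mul]; exact hb w hw) (Metric.mem_ball_self hr)
    (by rw [mem_ball_iff_norm]; simpa using hh)
  have e1 : ψ (a + h) - (a + h) * d - (ψ a - a * d) =
      -(h * (d - h⁻¹ * (ψ (a + h) - ψ a))) := by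
    field_simp
    ring
  simp only [e1, norm_neg, norm_mul, add_sub_cancel_left] at hmv
  rw [mul_comm C] at hmv
  exact le_of_mul_le_mul_left hmv (norm_pos_iff.2 h0)

open Filter Topology in
/-- A partial derivative of a separately holomorphic function is holomorphic in the other
variables, being a locally uniform limit of difference quotients. -/
theorem SepHolomorphic.partialDeriv {n : ℕ} {f : (Fin n → ℂ) → ℂ}
    (hf : SepHolomorphic f) (j : Fin n) : SepHolomorphic (partialDeriv j f) where
  continuousOn := hf.continuousOn_partialDeriv j
  slice z hz i := by
    by_cases hij : i = j
    · subst hij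
      have := (hf.slice z hz i).deriv Metric.isOpen_ball
      refine this.congr fun w hw => ?_
      simp only [_root_.partialDeriv, Function.update_self, Function.update_idem]
    -- `Ψ s w` is `f` as a function of the `i`-th and `j`-th coordinates
    set Ψ : ℂ → ℂ → ℂ := fun s w => f (Function.update (Function.update z i s) j w) with hΨ
    have hzj := mem_ball_of_mem_polydisc hz j
    have hp : ∀ s, _root_.partialDeriv j f (Function.update z i s) = deriv (Ψ s) (z j) := by
      intro s
      simp only [_root_.partialDeriv, hΨ]
      rw [Function.update_of_ne (Ne.symm hij)]
    have hp' : ∀ s w, _root_.partialDeriv j f (Function.update (Function.update z i s) j w) =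
        deriv (Ψ s) w := by
      intro s w
      simp only [_root_.partialDeriv, hΨ, Function.update_self, Function.update_idem]
    simp only [hp]
    have hmem : ∀ s ∈ Metric.ball (0 : ℂ) 1, ∀ w ∈ Metric.ball (0 : ℂ) 1,
        Function.update (Function.update z i s) j w ∈ polydisc n := fun s hs w hw =>
      update_mem_polydisc (update_mem_polydisc hz hs) hw
    have hlim : TendstoLocallyUniformlyOn
        (fun (h : ℂ) (s : ℂ) => h⁻¹ * (Ψ s (z j + h) - Ψ s (z j))) (fun s => deriv (Ψ s) (z j))
        (𝓝[≠] 0) (Metric.ball 0 1) := by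
      rw [Metric.tendstoLocallyUniformlyOn_iff]
      intro ε hε s0 hs0
      have hc : ContinuousOn (fun q : ℂ × ℂ => deriv (Ψ q.1) q.2)
          (Metric.ball 0 1 ×ˢ Metric.ball 0 1) := by
        have : (fun q : ℂ × ℂ => deriv (Ψ q.1) q.2) = fun q : ℂ × ℂ =>
            _root_.partialDeriv j f (Function.update (Function.update z i q.1) j q.2) := by
          ext q; rw [hp']
        rw [this]
        refine (hf.continuousOn_partialDeriv j).comp ?_ fun q hq => hmem _ hq.1 _ hq.2
        exact (((continuous_const (y := z)).update i continuous_fst).update j continuous_snd).continuousOn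
      have hopen : IsOpen (Metric.ball (0 : ℂ) 1 ×ˢ Metric.ball (0 : ℂ) 1) :=
        Metric.isOpen_ball.prod Metric.isOpen_ball
      have hc0 : ContinuousAt (fun q : ℂ × ℂ => deriv (Ψ q.1) q.2) (s0, z j) :=
        hc.continuousAt (hopen.mem_nhds ⟨hs0, hzj⟩)
      have hball : ∀ᶠ q in 𝓝 (s0, z j), q ∈ Metric.ball (0 : ℂ) 1 ×ˢ Metric.ball (0 : ℂ) 1 :=
        hopen.mem_nhds ⟨hs0, hzj⟩
      have hev := (Metric.continuousAt_iff'.1 hc0 (ε / 4) (by positivity)).and hball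
      obtain ⟨r, hr, hrsub⟩ := Metric.eventually_nhds_iff_ball.1 hev
      have hsub : ∀ s ∈ Metric.ball s0 r, ∀ w ∈ Metric.ball (z j) r,
          dist (deriv (Ψ s) w) (deriv (Ψ s0) (z j)) < ε / 4 ∧
            s ∈ Metric.ball (0 : ℂ) 1 ∧ w ∈ Metric.ball (0 : ℂ) 1 := by
        intro s hs w hw
        have : (s, w) ∈ Metric.ball (s0, z j) r := by
          rw [← ball_prod_same]; exact ⟨hs, hw⟩
        obtain ⟨h1, h2⟩ := hrsub (s, w) this
        rw [Set.mem_prod] at h2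
        exact ⟨h1, h2.1, h2.2⟩
      refine ⟨Metric.ball s0 r, mem_nhdsWithin_of_mem_nhds (Metric.ball_mem_nhds _ hr), ?_⟩
      have hh : ∀ᶠ h : ℂ in 𝓝[≠] 0, h ∈ Metric.ball (0 : ℂ) r ∧ h ≠ 0 := by
        filter_upwards [mem_nhdsWithin_of_mem_nhds (Metric.ball_mem_nhds (0 : ℂ) hr),
          self_mem_nhdsWithin] with h h1 h2
        exact ⟨h1, h2⟩
      filter_upwards [hh] with h hh s hs
      obtain ⟨hh1, hh0⟩ := hh
      rw [mem_ball_zero_iff] at hh1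
      rw [dist_eq_norm]
      refine lt_of_le_of_lt (norm_sub_inv_mul_sub_le (r := r) (C := ε / 2) (fun w hw => ?_)
        (fun w hw => ?_) hh1 hh0) (by linarith)
      · obtain ⟨-, h1, h2⟩ := hsub s hs w hw
        exact ((hf.slice _ (update_mem_polydisc hz h1) j).differentiableAt
          (Metric.isOpen_ball.mem_nhds h2)).hasDerivAt
      · have h1 := (hsub s hs w hw).1
        have h2 := (hsub s hs (z j) (Metric.mem_ball_self hr)).1
        rw [← dist_eq_norm]
        have := dist_triangle_right (deriv (Ψ s) w) (deriv (Ψ s) (z j)) (deriv (Ψ s0) (z j))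
        linarith
    refine hlim.differentiableOn ?_ Metric.isOpen_ball
    have hclose : ∀ᶠ h : ℂ in 𝓝[≠] 0, z j + h ∈ Metric.ball (0 : ℂ) 1 := by
      have : Tendsto (fun h : ℂ => z j + h) (𝓝[≠] 0) (𝓝 (z j)) := by
        have : Tendsto (fun h : ℂ => z j + h) (𝓝 0) (𝓝 (z j + 0)) :=
          (continuous_const.add continuous_id).tendsto 0
        rw [add_zero] at this
        exact this.mono_left nhdsWithin_le_nhds
      exact this.eventually (Metric.isOpen_ball.mem_nhds hzj)
    filter_upwards [hclose] with h hh
    refine DifferentiableOn.const_mul (DifferentiableOn.sub ?_ ?_) _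
    all_goals
      simp only [hΨ]
      simp_rw [Function.update_comm hij]
    · exact hf.slice _ (update_mem_polydisc hz hh) i
    · exact hf.slice _ (update_mem_polydisc hz hzj) i

/-! ### The operator `D` as a composition of one-variable operators -/

/-- The one-variable operator `D_j h = ∂(z_j h)/∂z_j`. -/
noncomputable def coordD {n : ℕ} (j : Fin n) (h : (Fin n → ℂ) → ℂ) : (Fin n → ℂ) → ℂ :=
  partialDeriv j fun z => z j * h z

theorem coordD_apply {n : ℕ} (j : Fin n) (h : (Fin n → ℂ) → ℂ) (z : Fin n → ℂ) :
    coordD j h z = deriv (fun w => w * h (Function.update z j w)) (z j) := by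
  simp only [coordD, partialDeriv, Function.update_self]

theorem coordD_update {n : ℕ} (j : Fin n) (h : (Fin n → ℂ) → ℂ) (z : Fin n → ℂ) (w : ℂ) :
    coordD j h (Function.update z j w) =
      deriv (fun w => w * h (Function.update z j w)) w := by
  simp only [coordD_apply, Function.update_self, Function.update_idem]

theorem SepHolomorphic.coordD {n : ℕ} {f : (Fin n → ℂ) → ℂ} (hf : SepHolomorphic f) (j : Fin n) :
    SepHolomorphic (coordD j f) :=
  (hf.coord_mul j).partialDeriv j

theorem SepHolomorphic.foldr_coordD {n : ℕ} {f : (Fin n → ℂ) → ℂ} (hf : SepHolomorphic f)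
    (l : List (Fin n)) : SepHolomorphic (l.foldr _root_.coordD f) := by
  induction l with
  | nil => exact hf
  | cons j l ih => exact ih.coordD j

theorem partialDeriv_coord_mul {n : ℕ} {i j : Fin n} (hij : i ≠ j) (F : (Fin n → ℂ) → ℂ) :
    partialDeriv j (fun z => z i * F z) = fun z => z i * partialDeriv j F z := by
  ext z
  simp only [partialDeriv, Function.update_of_ne hij]
  exact deriv_const_mul_field _

theorem foldr_partialDeriv_coord_mul {n : ℕ} {i : Fin n} (F : (Fin n → ℂ) → ℂ)
    {l : List (Fin n)} (hi : i ∉ l) :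
    l.foldr partialDeriv (fun z => z i * F z) = fun z => z i * l.foldr partialDeriv F z := by
  induction l with
  | nil => rfl
  | cons j l ih =>
    rw [List.mem_cons, not_or] at hi
    rw [List.foldr_cons, ih hi.2, partialDeriv_coord_mul hi.1]
    rfl

theorem besovD_eq_foldr_coordD {n : ℕ} (f : (Fin n → ℂ) → ℂ) :
    besovD f = (List.finRange n).foldr coordD f := by
  have key : ∀ l : List (Fin n), l.Nodup →
      l.foldr partialDeriv (fun z => (l.map z).prod * f z) = l.foldr coordD f := by
    intro l
    induction l with
    | nil => intro _; simp
    | cons j l ih =>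
      intro hl
      obtain ⟨hj, hl'⟩ := List.nodup_cons.1 hl
      simp only [List.map_cons, List.prod_cons, mul_assoc, List.foldr_cons]
      rw [foldr_partialDeriv_coord_mul _ hj, ih hl']
      rfl
  rw [← key _ (List.nodup_finRange n), besovD]
  simp only [Fin.prod_univ_def]

theorem SepHolomorphic.besovD {n : ℕ} {f : (Fin n → ℂ) → ℂ} (hf : SepHolomorphic f) :
    SepHolomorphic (besovD f) := by
  rw [besovD_eq_foldr_coordD]; exact hf.foldr_coordD _

theorem SepHolomorphic.measurable_indicator {n : ℕ} {f : (Fin n → ℂ) → ℂ}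
    (hf : SepHolomorphic f) : Measurable ((polydisc n).indicator f) :=
  hf.continuousOn.measurable_indicator_of_measurableSet (measurableSet_polydisc n)

theorem lintegral_polydisc_congr {n : ℕ} {F G : (Fin n → ℂ) → ℝ≥0∞}
    (h : ∀ z ∈ polydisc n, F z = G z) :
    ∫⁻ z, F z ∂polydiscMeasure n = ∫⁻ z, G z ∂polydiscMeasure n := by
  refine lintegral_congr_ae ?_
  filter_upwards [ae_mem_polydisc n] with z hz using h z hz

theorem lintegral_polydisc_mono {n : ℕ} {F G : (Fin n → ℂ) → ℝ≥0∞}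
    (h : ∀ z ∈ polydisc n, F z ≤ G z) :
    ∫⁻ z, F z ∂polydiscMeasure n ≤ ∫⁻ z, G z ∂polydiscMeasure n := by
  refine lintegral_mono_ae ?_
  filter_upwards [ae_mem_polydisc n] with z hz using h z hz

theorem lintegral_disc_congr {F G : ℂ → ℝ≥0∞} (h : ∀ z ∈ Metric.ball (0 : ℂ) 1, F z = G z) :
    ∫⁻ z, F z ∂discMeasure = ∫⁻ z, G z ∂discMeasure :=
  setLIntegral_congr_fun measurableSet_ball h

/-- A holomorphic function on the polydisc is dominated by an integral operator applied to
`D f`. -/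
theorem exists_enorm_le_lintegral_besovD (n : ℕ) {β : ℝ} (hβ : 0 < β) :
    ∃ C : ℝ, 0 < C ∧ ∀ f : (Fin n → ℂ) → ℂ, SepHolomorphic f → ∀ z ∈ polydisc n,
      ‖f z‖ₑ ≤ ENNReal.ofReal (C ^ n) * ∫⁻ y, ‖besovD f y‖ₑ *
        ∏ j, ENNReal.ofReal (powKernel β (β + 1) (z j) (y j)) ∂polydiscMeasure n := by
  obtain ⟨C, hC, H⟩ := exists_enorm_le_powKernel hβ
  refine ⟨C, hC, fun f hf z hz => ?_⟩
  set Φ : List (Fin n) → (Fin n → ℂ) → ℝ≥0∞ :=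
    fun l x => ‖(polydisc n).indicator (l.foldr coordD f) x‖ₑ with hΦ
  have h1 := le_lintegral_prod_of_forall_le (Φ := Φ)
    (k := fun _ z w => ENNReal.ofReal (C * powKernel β (β + 1) z w))
    (fun l _ => (hf.foldr_coordD l).measurable_indicator.enorm)
    (fun _ z => (((measurable_powKernel β (β + 1)).comp measurable_prodMk_left).const_mul
      C).ennreal_ofReal) ?_ z
  · have h2 : Φ [] z = ‖f z‖ₑ := by simp [hΦ, Set.indicator_of_mem hz]
    rw [h2] at h1
    refine h1.trans (le_of_eq ?_)
    rw [← lintegral_const_mul' _ _ ENNReal.ofReal_ne_top]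
    refine lintegral_polydisc_congr fun y hy => ?_
    simp only [hΦ, Set.indicator_of_mem hy, besovD_eq_foldr_coordD]
    simp_rw [ENNReal.ofReal_mul hC.le]
    rw [Finset.prod_mul_distrib, Finset.prod_const, Finset.card_univ, Fintype.card_fin,
      ENNReal.ofReal_pow hC.le]
    ring
  · intro j l _ x
    by_cases hx : x ∈ polydisc n
    · have hslice := (hf.foldr_coordD l).slice x hx j
      have := H _ hslice (x j) (mem_ball_of_mem_polydisc hx j)
      simp only [Function.update_eq_self] at this
      simp only [hΦ, Set.indicator_of_mem hx]
      refine this.trans (le_of_eq ?_)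
      refine lintegral_disc_congr fun w hw => ?_
      rw [Set.indicator_of_mem (update_mem_polydisc hx hw), List.foldr_cons, coordD_update]
    · simp [hΦ, hx]

theorem measurable_avgKernel_right (C : ℝ) (z : ℂ) : Measurable (avgKernel C z) := by
  have h := (measurable_avgKernel C).comp (measurable_prodMk_left (x := z))
  exact h

theorem exists_enorm_rpow_le_avg_polydisc (n : ℕ) {p : ℝ} (hp0 : 0 < p) (hp1 : p < 1) :
    ∃ C : ℝ, 0 < C ∧ ∀ f : (Fin n → ℂ) → ℂ, SepHolomorphic f → ∀ z ∈ polydisc n,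
      ‖f z‖ₑ ^ p ≤ ∫⁻ y, ‖f y‖ₑ ^ p * ∏ j, avgKernel C (z j) (y j) ∂polydiscMeasure n := by
  obtain ⟨C, hC, H⟩ := exists_enorm_rpow_le_avg hp0 hp1
  refine ⟨C, hC, fun f hf z hz => ?_⟩
  set Φ : List (Fin n) → (Fin n → ℂ) → ℝ≥0∞ :=
    fun _ x => ‖(polydisc n).indicator f x‖ₑ ^ p with hΦ
  have h1 := le_lintegral_prod_of_forall_le (Φ := Φ) (k := fun _ => avgKernel C)
    (fun l _ => hf.measurable_indicator.enorm.pow_const p)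
    (fun _ z => measurable_avgKernel_right C z) ?_ z
  · have h2 : Φ [] z = ‖f z‖ₑ ^ p := by simp [hΦ, Set.indicator_of_mem hz]
    rw [h2] at h1
    refine h1.trans (le_of_eq (lintegral_polydisc_congr fun y hy => ?_))
    simp only [hΦ, Set.indicator_of_mem hy]
  · intro j l _ x
    by_cases hx : x ∈ polydisc n
    · have := H _ (hf.slice x hx j) (x j) (mem_ball_of_mem_polydisc hx j)
      simp only [Function.update_eq_self] at this
      simp only [hΦ, Set.indicator_of_mem hx]
      refine this.trans (le_of_eq (lintegral_disc_congr fun w hw => ?_))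
      rw [Set.indicator_of_mem (update_mem_polydisc hx hw)]
    · simp [hΦ, hx, hp0]

/-! ### Embedding of weighted `L^p` into weighted `L^1` for holomorphic functions, `p < 1` -/

/-- A positive function on the disc that varies by at most a factor `M` on Whitney discs. -/
structure SlowlyVarying (M : ℝ) (κ : ℂ → ℝ) : Prop where
  pos : ∀ z ∈ Metric.ball (0 : ℂ) 1, 0 < κ z
  le : ∀ z ∈ Metric.ball (0 : ℂ) 1, ∀ w ∈ whitneyBall z, κ z ≤ M * κ w

theorem avgKernel_mul_le {p C M : ℝ} (hp0 : 0 < p) (hp1 : p < 1) (hC : 0 < C) (hM : 0 < M)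
    {κ : ℂ → ℝ} (hκ : SlowlyVarying M κ) {z w : ℂ} (hz : z ∈ Metric.ball (0 : ℂ) 1) :
    avgKernel C z w * ENNReal.ofReal (κ z ^ p * (1 - ‖z‖) ^ (2 * p)) ≤
      ENNReal.ofReal (C * M ^ p * 2 ^ (2 - 2 * p)) *
        ENNReal.ofReal (κ w ^ p * (1 - ‖w‖) ^ (2 * p - 2)) := by
  by_cases hw : w ∈ whitneyBall z
  · obtain ⟨h1, h2, h3⟩ := whitneyBall_bounds hw
    have hκz := hκ.pos z hz
    have hκw := hκ.pos w (whitneyBall_subset hw)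
    have hδw : 0 < 1 - ‖w‖ := by linarith
    rw [avgKernel, Set.indicator_of_mem hw, Pi.one_apply, mul_one,
      ← ENNReal.ofReal_mul (by positivity), ← ENNReal.ofReal_mul (by positivity)]
    refine ENNReal.ofReal_le_ofReal ?_
    set δ := 1 - ‖z‖
    set ε := 1 - ‖w‖
    have e1 : κ z ^ p ≤ M ^ p * κ w ^ p := by
      rw [← Real.mul_rpow hM.le hκw.le]
      exact Real.rpow_le_rpow hκz.le (hκ.le z hz w hw) hp0.le
    have e2 : δ ^ (2 * p - 2) ≤ 2 ^ (2 - 2 * p) * ε ^ (2 * p - 2) := by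
      have := Real.rpow_le_rpow_of_nonpos (x := ε / 2) (y := δ) (z := 2 * p - 2) (by positivity)
        (by linarith) (by linarith)
      rw [Real.div_rpow hδw.le (by norm_num), div_eq_mul_inv, ← Real.rpow_neg (by norm_num),
        mul_comm (ε ^ _), neg_sub] at this
      exact this
    calc C * (δ ^ 2)⁻¹ * (κ z ^ p * δ ^ (2 * p)) = C * κ z ^ p * δ ^ (2 * p - 2) := by
          rw [Real.rpow_sub h3, Real.rpow_two]; ring
      _ ≤ C * (M ^ p * κ w ^ p) * (2 ^ (2 - 2 * p) * ε ^ (2 * p - 2)) := by gcongr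
      _ = _ := by ring
  · rw [avgKernel, Set.indicator_of_notMem hw]
    simp

/-- For `0 < p < 1` the `p`-th power of a weighted `L^1` norm of a holomorphic function is
controlled by the `p`-th power integral. The point is that by the mean value inequality
`|f|^p κ^p (1 - |ζ|)^{2p}` is pointwise bounded by the right-hand side. -/
theorem exists_lintegral_rpow_le (n : ℕ) {p M : ℝ} (hp0 : 0 < p) (hp1 : p < 1) (hM : 0 < M) :
    ∃ C : ℝ, 0 < C ∧ ∀ (f : (Fin n → ℂ) → ℂ) (κ : Fin n → ℂ → ℝ), SepHolomorphic f →
      (∀ j, SlowlyVarying M (κ j)) →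
      (∫⁻ y, ‖f y‖ₑ * ∏ j, ENNReal.ofReal (κ j (y j)) ∂polydiscMeasure n) ^ p ≤
        ENNReal.ofReal C * ∫⁻ y, ‖f y‖ₑ ^ p *
          ∏ j, ENNReal.ofReal (κ j (y j) ^ p * (1 - ‖y j‖) ^ (2 * p - 2)) ∂polydiscMeasure n := by
  obtain ⟨C, hC, H⟩ := exists_enorm_rpow_le_avg_polydisc n hp0 hp1
  set C1 : ℝ := (C * M ^ p * 2 ^ (2 - 2 * p)) ^ n with hC1
  have hC10 : 0 < C1 := by positivity
  refine ⟨C1 ^ (1 - p), by positivity, fun f κ hf hκ => ?_⟩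
  set A := ∫⁻ y, ‖f y‖ₑ ^ p *
    ∏ j, ENNReal.ofReal (κ j (y j) ^ p * (1 - ‖y j‖) ^ (2 * p - 2)) ∂polydiscMeasure n with hA
  have hq : 0 < 1 / p - 1 := by
    rw [sub_pos, lt_div_iff₀ hp0]; linarith
  by_cases hAtop : A = ∞
  · rw [hAtop, ENNReal.mul_top]
    · exact le_top
    · rw [Ne, ENNReal.ofReal_eq_zero, not_le]; positivity
  -- the pointwise bound
  have hpt : ∀ z ∈ polydisc n, ‖f z‖ₑ ^ p *
      ∏ j, ENNReal.ofReal (κ j (z j) ^ p * (1 - ‖z j‖) ^ (2 * p)) ≤ ENNReal.ofReal C1 * A := by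
    intro z hz
    calc _ ≤ (∫⁻ y, ‖f y‖ₑ ^ p * ∏ j, avgKernel C (z j) (y j) ∂polydiscMeasure n) *
          ∏ j, ENNReal.ofReal (κ j (z j) ^ p * (1 - ‖z j‖) ^ (2 * p)) := by
          gcongr; exact H f hf z hz
      _ = ∫⁻ y, ‖f y‖ₑ ^ p * (∏ j, avgKernel C (z j) (y j)) *
          ∏ j, ENNReal.ofReal (κ j (z j) ^ p * (1 - ‖z j‖) ^ (2 * p)) ∂polydiscMeasure n := by
          rw [lintegral_mul_const' _ _ (ENNReal.prod_ne_top fun _ _ => ENNReal.ofReal_ne_top)]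
      _ ≤ ∫⁻ y, ENNReal.ofReal C1 * (‖f y‖ₑ ^ p *
          ∏ j, ENNReal.ofReal (κ j (y j) ^ p * (1 - ‖y j‖) ^ (2 * p - 2))) ∂polydiscMeasure n := by
          refine lintegral_mono fun y => ?_
          rw [mul_assoc, ← Finset.prod_mul_distrib, mul_left_comm]
          gcongr
          calc _ ≤ ∏ j, ENNReal.ofReal (C * M ^ p * 2 ^ (2 - 2 * p)) *
                ENNReal.ofReal (κ j (y j) ^ p * (1 - ‖y j‖) ^ (2 * p - 2)) :=
                Finset.prod_le_prod' fun j _ => avgKernel_mul_le hp0 hp1 hC hM (hκ j)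
                  (mem_ball_of_mem_polydisc hz j)
            _ = _ := by
                rw [Finset.prod_mul_distrib, Finset.prod_const, Finset.card_univ,
                  Fintype.card_fin, hC1, ENNReal.ofReal_pow (by positivity)]
      _ = _ := lintegral_const_mul' _ _ ENNReal.ofReal_ne_top
  have hCA : ENNReal.ofReal C1 * A ≠ ∞ := ENNReal.mul_ne_top ENNReal.ofReal_ne_top hAtop
  have hint : ∫⁻ y, ‖f y‖ₑ * ∏ j, ENNReal.ofReal (κ j (y j)) ∂polydiscMeasure n ≤
      (ENNReal.ofReal C1 * A) ^ (1 / p - 1) * A := by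
    rw [← lintegral_const_mul' _ _ (ENNReal.rpow_ne_top_of_nonneg hq.le hCA)]
    refine lintegral_polydisc_mono fun y hy => ?_
    refine le_trans (le_of_eq ?_) (mul_le_mul_left (ENNReal.rpow_le_rpow (hpt y hy) hq.le) _)
    -- an identity between finite quantities
    have hκ0 : ∀ j, 0 < κ j (y j) := fun j => (hκ j).pos _ (mem_ball_of_mem_polydisc hy j)
    have hδ0 : ∀ j, 0 < 1 - ‖y j‖ := fun j => by linarith [hy j]
    have hK : 0 < ∏ j, κ j (y j) := Finset.prod_pos fun j _ => hκ0 j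
    have hd : 0 < ∏ j, (1 - ‖y j‖) := Finset.prod_pos fun j _ => hδ0 j
    have hprod : ∀ e : ℝ, ∏ j, ENNReal.ofReal (κ j (y j) ^ p * (1 - ‖y j‖) ^ e) =
        ENNReal.ofReal ((∏ j, κ j (y j)) ^ p * (∏ j, (1 - ‖y j‖)) ^ e) := by
      intro e
      rw [← ENNReal.ofReal_prod_of_nonneg fun j _ =>
        mul_nonneg (Real.rpow_nonneg (hκ0 j).le _) (Real.rpow_nonneg (hδ0 j).le _),
        Finset.prod_mul_distrib, Real.finsetProd_rpow _ _ fun j _ => (hκ0 j).le,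
        Real.finsetProd_rpow _ _ fun j _ => (hδ0 j).le]
    rw [hprod, hprod, ← ENNReal.ofReal_prod_of_nonneg fun j _ => (hκ0 j).le]
    set K := ∏ j, κ j (y j)
    set d := ∏ j, (1 - ‖y j‖)
    rw [← ofReal_norm, ENNReal.ofReal_rpow_of_nonneg (norm_nonneg _) hp0.le]
    set a := ‖f y‖ with ha
    have ha0 : 0 ≤ a := norm_nonneg _
    rw [← ENNReal.ofReal_mul ha0, ← ENNReal.ofReal_mul (by positivity),
      ← ENNReal.ofReal_mul (by positivity), ENNReal.ofReal_rpow_of_nonneg (by positivity) hq.le,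
      ← ENNReal.ofReal_mul (by positivity)]
    congr 1
    rcases ha0.eq_or_lt with h0 | h0
    · rw [← h0, Real.zero_rpow hp0.ne']; simp
    have hpow : a ^ p * (K ^ p * d ^ (2 * p)) = (a * K * d ^ (2 : ℝ)) ^ p := by
      rw [Real.mul_rpow (by positivity) (by positivity), Real.mul_rpow (by positivity) (by positivity),
        ← Real.rpow_mul hd.le, mul_assoc]
    have hpow2 : a ^ p * (K ^ p * d ^ (2 * p - 2)) = (a * K * d ^ (2 : ℝ)) ^ p * (d ^ (2 : ℝ))⁻¹ := by
      rw [← hpow, Real.rpow_sub hd]; ring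
    rw [hpow2, hpow, ← mul_assoc, ← Real.rpow_mul (by positivity), ← Real.rpow_add (by positivity),
      show p * (1 / p - 1) + p = 1 by field_simp; ring, Real.rpow_one]
    field_simp
  calc _ ≤ ((ENNReal.ofReal C1 * A) ^ (1 / p - 1) * A) ^ p := by gcongr
    _ = ENNReal.ofReal (C1 ^ (1 - p)) * A := by
      rw [ENNReal.mul_rpow_of_nonneg _ _ hp0.le, ← ENNReal.rpow_mul,
        show (1 / p - 1) * p = 1 - p by field_simp,
        ENNReal.mul_rpow_of_nonneg _ _ (by linarith), mul_assoc,
        ← ENNReal.rpow_add_of_nonneg _ _ (by linarith) hp0.le, sub_add_cancel, ENNReal.rpow_one,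
        ENNReal.ofReal_rpow_of_nonneg hC10.le (by linarith)]

theorem rpow_le_two_rpow_abs_mul {x y a : ℝ} (hx : 0 < x) (h1 : x ≤ 2 * y) (h2 : y ≤ 2 * x) :
    x ^ a ≤ 2 ^ |a| * y ^ a := by
  have hy : 0 < y := by linarith
  rcases le_total 0 a with ha | ha
  · rw [abs_of_nonneg ha, ← Real.mul_rpow (by norm_num) hy.le]
    exact Real.rpow_le_rpow hx.le h1 ha
  · rw [abs_of_nonpos ha]
    have := Real.rpow_le_rpow_of_nonpos (x := y / 2) (y := x) (z := a) (by positivity)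
      (by linarith) ha
    rwa [Real.div_rpow hy.le (by norm_num), div_eq_mul_inv, ← Real.rpow_neg (by norm_num),
      mul_comm (y ^ a)] at this

theorem one_sub_norm_le_norm_one_sub {z w : ℂ} (hz : z ∈ Metric.ball (0 : ℂ) 1) :
    1 - ‖w‖ ≤ ‖1 - w * (starRingEnd ℂ) z‖ := by
  rw [mem_ball_zero_iff] at hz
  have := norm_sub_norm_le 1 (w * (starRingEnd ℂ) z)
  rw [norm_one, norm_mul, Complex.norm_conj] at this
  nlinarith [norm_nonneg w]

theorem norm_one_sub_mul_conj_pos {z w : ℂ} (hz : z ∈ Metric.ball (0 : ℂ) 1)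
    (hw : w ∈ Metric.ball (0 : ℂ) 1) : 0 < ‖1 - w * (starRingEnd ℂ) z‖ := by
  have := one_sub_norm_le_norm_one_sub (w := w) hz
  rw [mem_ball_zero_iff] at hw
  linarith

theorem slowlyVarying_powKernel {a e : ℝ} (he : 0 ≤ e) {z : ℂ} (hz : z ∈ Metric.ball (0 : ℂ) 1) :
    SlowlyVarying (2 ^ |a| * 2 ^ e) (powKernel a e z) where
  pos w hw := by
    have h1 := norm_one_sub_mul_conj_pos hz hw
    rw [mem_ball_zero_iff] at hw
    have h2 : 0 < 1 - ‖w‖ := by linarith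
    unfold powKernel
    positivity
  le w hw y hy := by
    obtain ⟨h1, h2, h3⟩ := whitneyBall_bounds hy
    have hN := norm_one_sub_mul_conj_pos hz hw
    have hN' := norm_one_sub_mul_conj_pos hz (whitneyBall_subset hy)
    have hδN := one_sub_norm_le_norm_one_sub (w := w) hz
    unfold powKernel
    have e1 := rpow_le_two_rpow_abs_mul (a := a) h3 (y := 1 - ‖y‖) (by linarith) h2
    have hNN : ‖1 - y * (starRingEnd ℂ) z‖ ≤ 2 * ‖1 - w * (starRingEnd ℂ) z‖ := by
      have e : 1 - y * (starRingEnd ℂ) z =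
          (1 - w * (starRingEnd ℂ) z) - (y - w) * (starRingEnd ℂ) z := by ring
      rw [whitneyBall, mem_ball_iff_norm] at hy
      rw [mem_ball_zero_iff] at hz
      calc _ ≤ ‖1 - w * (starRingEnd ℂ) z‖ + ‖(y - w) * (starRingEnd ℂ) z‖ := by
            rw [e]; exact norm_sub_le _ _
        _ ≤ _ := by
            rw [norm_mul, Complex.norm_conj]
            nlinarith [norm_nonneg (y - w), norm_nonneg z]
    have e2 : ‖1 - w * (starRingEnd ℂ) z‖ ^ (-e) ≤ 2 ^ e * ‖1 - y * (starRingEnd ℂ) z‖ ^ (-e) := by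
      have := Real.rpow_le_rpow_of_nonpos (z := -e) hN' hNN (by linarith)
      rw [Real.mul_rpow (by norm_num) hN.le, Real.rpow_neg (x := 2) (by norm_num)] at this
      calc _ = 2 ^ e * ((2 ^ e)⁻¹ * ‖1 - w * (starRingEnd ℂ) z‖ ^ (-e)) := by
            rw [mul_inv_cancel_left₀ (by positivity)]
        _ ≤ _ := by gcongr
    have hδy : 0 < 1 - ‖y‖ := by linarith
    calc _ ≤ (2 ^ |a| * (1 - ‖y‖) ^ a) * (2 ^ e * ‖1 - y * (starRingEnd ℂ) z‖ ^ (-e)) := by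
          gcongr
      _ = _ := by ring

theorem SlowlyVarying.mono {M M' : ℝ} {κ : ℂ → ℝ} (h : SlowlyVarying M κ) (hM : M ≤ M') :
    SlowlyVarying M' κ where
  pos := h.pos
  le z hz w hw := (h.le z hz w hw).trans
    (mul_le_mul_of_nonneg_right hM (h.pos w (whitneyBall_subset hw)).le)

/-! ### Weighted `p`-norm bounds for integral operators on holomorphic functions -/

/-- The product weight `∏ ω_j(1 - |z_j|) (1 - |z_j|)^{τ_j}`, with values in `[0, ∞]`. -/
noncomputable def prodWeight {n : ℕ} (ω : Fin n → ℝ → ℝ) (τ : Fin n → ℝ) (z : Fin n → ℂ) : ℝ≥0∞ :=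
  ∏ j, ENNReal.ofReal (zeroExt (ω j) (1 - ‖z j‖) * (1 - ‖z j‖) ^ τ j)

theorem measurable_weight_factor {ω : ℝ → ℝ} (hm : Measurable (zeroExt ω)) (τ : ℝ) :
    Measurable fun z : ℂ => ENNReal.ofReal (zeroExt ω (1 - ‖z‖) * (1 - ‖z‖) ^ τ) := by
  have := measurable_zeroExt_comp hm
  fun_prop

theorem measurable_prodWeight {n : ℕ} {ω : Fin n → ℝ → ℝ} (hm : ∀ j, Measurable (zeroExt (ω j)))
    (τ : Fin n → ℝ) : Measurable (prodWeight ω τ) := by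
  unfold prodWeight
  exact Finset.measurable_prod _ fun j _ =>
    (measurable_weight_factor (hm j) (τ j)).comp (measurable_pi_apply j)

theorem prodWeight_ne_top {n : ℕ} (ω : Fin n → ℝ → ℝ) (τ : Fin n → ℝ) (z : Fin n → ℂ) :
    prodWeight ω τ z ≠ ∞ :=
  ENNReal.prod_ne_top fun _ _ => ENNReal.ofReal_ne_top

/-- A Schur-type test: an integral operator with kernel `∏ (1 - |y_j|)^{a_j} |1 - y_j z̄_j|^{-e_j}`
acts on the `p`-th power integrable holomorphic functions. The embedding `L^p ⊂ L^1` for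
holomorphic functions replaces the kernel by its `p`-th power, and then Tonelli's theorem reduces
matters to the one-variable Forelli–Rudin estimate. -/
theorem exists_schur_bound {n : ℕ} {p : ℝ} (hp0 : 0 < p) (hp1 : p < 1) {ω : Fin n → ℝ → ℝ}
    {s A c C : Fin n → ℝ} (hg : ∀ j, WeightGrowth (ω j) (s j) (A j) (c j) (C j))
    (hm : ∀ j, Measurable (zeroExt (ω j))) {a e τ : Fin n → ℝ} (he : ∀ j, 0 ≤ e j)
    (h1 : ∀ j, -1 < s j + τ j) (h2 : ∀ j, A j + τ j + 2 < p * e j) :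
    ∃ K : ℝ, 0 < K ∧ ∀ (ψ : (Fin n → ℂ) → ℂ) (g : ℝ≥0∞) (H : (Fin n → ℂ) → ℝ≥0∞),
      SepHolomorphic ψ →
      (∀ z ∈ polydisc n, H z ≤ g * ∫⁻ y, ‖ψ y‖ₑ *
        ∏ j, ENNReal.ofReal (powKernel (a j) (e j) (z j) (y j)) ∂polydiscMeasure n) →
      ∫⁻ z, H z ^ p * prodWeight ω τ z ∂polydiscMeasure n ≤ ENNReal.ofReal K * g ^ p *
        ∫⁻ y, ‖ψ y‖ₑ ^ p * prodWeight ω (fun j => p * a j + 2 * p + τ j - p * e j) y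
          ∂polydiscMeasure n := by
  choose K hK HK using fun j => (hg j).exists_forelliRudin (τ := τ j) (e := p * e j) (h1 j) (h2 j)
  set M : ℝ := ∑ j, (2 : ℝ) ^ |a j| * 2 ^ e j + 1 with hM
  have hM0 : 0 < M := by positivity
  have hMj : ∀ j, (2 : ℝ) ^ |a j| * 2 ^ e j ≤ M := fun j => by
    have := Finset.single_le_sum (f := fun j => (2 : ℝ) ^ |a j| * 2 ^ e j)
      (fun i _ => by positivity) (Finset.mem_univ j)
    linarith
  obtain ⟨C1, hC1, HC1⟩ := exists_lintegral_rpow_le n hp0 hp1 hM0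
  have hKprod : 0 < ∏ j, K j := Finset.prod_pos fun j _ => hK j
  refine ⟨C1 * ∏ j, K j, by positivity, fun ψ g H hψ hH => ?_⟩
  obtain ⟨E, hE⟩ : ∃ E : (Fin n → ℂ) → ℝ≥0∞, E = fun y => ‖(polydisc n).indicator ψ y‖ₑ :=
    ⟨_, rfl⟩
  have hEm : Measurable E := hE ▸ hψ.measurable_indicator.enorm
  have hEeq : ∀ y ∈ polydisc n, E y = ‖ψ y‖ₑ := fun y hy => by
    simp only [hE, Set.indicator_of_mem hy]
  -- the kernel after passing to `p`-th powers
  obtain ⟨k, hk⟩ : ∃ k : Fin n → ℂ → ℂ → ℝ≥0∞, k = fun j z y =>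
    ENNReal.ofReal (powKernel (a j) (e j) z y ^ p * (1 - ‖y‖) ^ (2 * p - 2)) := ⟨_, rfl⟩
  have hkm : ∀ j, Measurable fun q : ℂ × ℂ => k j q.1 q.2 := by
    intro j
    have := measurable_powKernel (a j) (e j)
    simp only [hk]
    fun_prop
  have hkw : ∀ j, Measurable fun q : ℂ × ℂ =>
      ENNReal.ofReal (zeroExt (ω j) (1 - ‖q.1‖) * (1 - ‖q.1‖) ^ τ j) := fun j =>
    (measurable_weight_factor (hm j) (τ j)).comp measurable_fst
  have hproj : ∀ j : Fin n, Measurable fun q : (Fin n → ℂ) × (Fin n → ℂ) => (q.1 j, q.2 j) :=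
    fun j => by fun_prop
  have hstep : ∀ z ∈ polydisc n, H z ^ p ≤
      ENNReal.ofReal C1 * g ^ p * ∫⁻ y, E y ^ p * ∏ j, k j (z j) (y j) ∂polydiscMeasure n := by
    intro z hz
    have hsv : ∀ j, SlowlyVarying M (powKernel (a j) (e j) (z j)) := fun j =>
      (slowlyVarying_powKernel (he j) (mem_ball_of_mem_polydisc hz j)).mono (hMj j)
    have := HC1 ψ _ hψ hsv
    calc H z ^ p ≤ _ := ENNReal.rpow_le_rpow (hH z hz) hp0.le
      _ = g ^ p * _ := ENNReal.mul_rpow_of_nonneg _ _ hp0.le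
      _ ≤ g ^ p * _ := mul_le_mul' le_rfl this
      _ = _ := by
        rw [← mul_assoc, mul_comm (g ^ p), hk]
        congr 1
        refine lintegral_polydisc_congr fun y hy => ?_
        rw [hEeq y hy]
  calc _ ≤ ∫⁻ z, ENNReal.ofReal C1 * g ^ p * ((∫⁻ y, E y ^ p * ∏ j, k j (z j) (y j)
          ∂polydiscMeasure n) * prodWeight ω τ z) ∂polydiscMeasure n := by
        refine lintegral_polydisc_mono fun z hz => ?_
        rw [← mul_assoc]
        gcongr
        exact hstep z hz
    _ = ENNReal.ofReal C1 * g ^ p * ∫⁻ z, ((∫⁻ y, E y ^ p * ∏ j, k j (z j) (y j)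
          ∂polydiscMeasure n) * prodWeight ω τ z) ∂polydiscMeasure n := by
        rw [lintegral_const_mul]
        refine Measurable.mul ?_ (measurable_prodWeight hm τ)
        refine Measurable.lintegral_prod_right' (f := fun q : (Fin n → ℂ) × (Fin n → ℂ) =>
          E q.2 ^ p * ∏ j, k j (q.1 j) (q.2 j)) ?_
        refine ((hEm.comp measurable_snd).pow_const p).mul (Finset.measurable_prod _ fun j _ => ?_)
        exact (hkm j).comp (hproj j)
    _ = ENNReal.ofReal C1 * g ^ p * ∫⁻ y, (∫⁻ z, E y ^ p * ∏ j, (k j (z j) (y j) *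
          ENNReal.ofReal (zeroExt (ω j) (1 - ‖z j‖) * (1 - ‖z j‖) ^ τ j)) ∂polydiscMeasure n)
          ∂polydiscMeasure n := by
        congr 1
        rw [← lintegral_lintegral_swap]
        · refine lintegral_congr fun z => ?_
          rw [← lintegral_mul_const' _ _ (prodWeight_ne_top ω τ z)]
          refine lintegral_congr fun y => ?_
          rw [mul_assoc, prodWeight, Finset.prod_mul_distrib]
        · have hj : ∀ j, Measurable fun q : (Fin n → ℂ) × (Fin n → ℂ) => k j (q.1 j) (q.2 j) *
              ENNReal.ofReal (zeroExt (ω j) (1 - ‖q.1 j‖) * (1 - ‖q.1 j‖) ^ τ j) := fun j =>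
            ((hkm j).mul (hkw j)).comp (hproj j)
          have hE2 : Measurable fun q : (Fin n → ℂ) × (Fin n → ℂ) => E q.2 ^ p :=
            (hEm.comp measurable_snd).pow_const p
          exact (hE2.mul (Finset.measurable_prod _ fun j _ => hj j)).aemeasurable
    _ ≤ ENNReal.ofReal C1 * g ^ p * ∫⁻ y, ENNReal.ofReal (∏ j, K j) * (‖ψ y‖ₑ ^ p *
          prodWeight ω (fun j => p * a j + 2 * p + τ j - p * e j) y) ∂polydiscMeasure n := by
        refine mul_le_mul' le_rfl (lintegral_mono_ae ?_)
        filter_upwards [ae_mem_polydisc n, ae_forall_ne_zero n] with y hy hy0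
        rw [hEeq y hy, lintegral_const_mul' _ _
          (ENNReal.rpow_ne_top_of_nonneg hp0.le enorm_ne_top), mul_left_comm]
        gcongr
        rw [lintegral_pi_prod_eq_prod (fun _ => discMeasure) (f := fun j z => k j z (y j) *
          ENNReal.ofReal (zeroExt (ω j) (1 - ‖z‖) * (1 - ‖z‖) ^ τ j))]
        · rw [ENNReal.ofReal_prod_of_nonneg fun j _ => (hK j).le, prodWeight,
            ← Finset.prod_mul_distrib]
          refine Finset.prod_le_prod' fun j _ => ?_
          have hyj := mem_ball_of_mem_polydisc hy j
          have hδ : 0 < 1 - ‖y j‖ := by linarith [hy j]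
          have hFR := HK j (y j) hyj (hy0 j)
          calc _ = ∫⁻ z, ENNReal.ofReal ((1 - ‖y j‖) ^ (p * a j + (2 * p - 2))) *
                ENNReal.ofReal (zeroExt (ω j) (1 - ‖z‖) * (1 - ‖z‖) ^ τ j *
                  ‖1 - y j * (starRingEnd ℂ) z‖ ^ (-(p * e j))) ∂discMeasure := by
                refine lintegral_disc_congr fun z hz => ?_
                have hδz : 0 < 1 - ‖z‖ := by rw [mem_ball_zero_iff] at hz; linarith
                have hN := norm_one_sub_mul_conj_pos hz hyj
                have hpk : powKernel (a j) (e j) z (y j) ^ p = (1 - ‖y j‖) ^ (p * a j) *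
                    ‖1 - y j * (starRingEnd ℂ) z‖ ^ (-(p * e j)) := by
                  rw [powKernel, Real.mul_rpow (by positivity) (by positivity),
                    ← Real.rpow_mul hδ.le, ← Real.rpow_mul hN.le, mul_comm (a j),
                    neg_mul, mul_comm (e j)]
                simp only [hk]
                rw [hpk, Real.rpow_add hδ, ← ENNReal.ofReal_mul (by positivity),
                  ← ENNReal.ofReal_mul (by positivity)]
                congr 1
                ring
            _ = ENNReal.ofReal ((1 - ‖y j‖) ^ (p * a j + (2 * p - 2))) *
                ∫⁻ z, ENNReal.ofReal (zeroExt (ω j) (1 - ‖z‖) * (1 - ‖z‖) ^ τ j *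
                  ‖1 - y j * (starRingEnd ℂ) z‖ ^ (-(p * e j))) ∂discMeasure :=
                lintegral_const_mul' _ _ ENNReal.ofReal_ne_top
            _ ≤ ENNReal.ofReal ((1 - ‖y j‖) ^ (p * a j + (2 * p - 2))) *
                ENNReal.ofReal (K j * (zeroExt (ω j) (1 - ‖y j‖) *
                  (1 - ‖y j‖) ^ (τ j + 2 - p * e j))) := mul_le_mul' le_rfl hFR
            _ = _ := by
                rw [← ENNReal.ofReal_mul (by positivity), ← ENNReal.ofReal_mul (hK j).le]
                congr 1
                rw [show p * a j + 2 * p + τ j - p * e j =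
                  (p * a j + (2 * p - 2)) + (τ j + 2 - p * e j) by ring,
                  Real.rpow_add hδ (p * a j + (2 * p - 2)) (τ j + 2 - p * e j)]
                ring
        · intro j
          exact ((hkm j).comp measurable_prodMk_right).mul (measurable_weight_factor (hm j) (τ j))
    _ = _ := by
        rw [lintegral_const_mul' _ _ ENNReal.ofReal_ne_top, ENNReal.ofReal_mul hC1.le]
        ring

/-! ### Differentiation of parametric integrals over the polydisc -/

/-- A kernel `κ z ζ` on the disc, holomorphic in `z` with derivative `κ'`, continuous in `ζ` and
bounded for `z` in compact subsets. -/
structure DiscKernel (κ κ' : ℂ → ℂ → ℂ) : Prop where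
  hasDerivAt : ∀ ζ ∈ Metric.ball (0 : ℂ) 1, ∀ z ∈ Metric.ball (0 : ℂ) 1,
    HasDerivAt (fun w => κ w ζ) (κ' z ζ) z
  continuousOn : ∀ z ∈ Metric.ball (0 : ℂ) 1, ContinuousOn (κ z) (Metric.ball 0 1)
  continuousOn' : ∀ z ∈ Metric.ball (0 : ℂ) 1, ContinuousOn (κ' z) (Metric.ball 0 1)
  bound : ∀ r < (1 : ℝ), ∃ B : ℝ, ∀ z, ‖z‖ ≤ r → ∀ ζ ∈ Metric.ball (0 : ℂ) 1,
    ‖κ z ζ‖ ≤ B ∧ ‖κ' z ζ‖ ≤ B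

theorem ContinuousOn.aestronglyMeasurable_polydisc {n : ℕ} {f : (Fin n → ℂ) → ℂ}
    (hf : ContinuousOn f (polydisc n)) : AEStronglyMeasurable f (polydiscMeasure n) := by
  rw [← restrict_polydisc]
  exact hf.aestronglyMeasurable (measurableSet_polydisc n)

theorem ContinuousOn.comp_coord_polydisc {n : ℕ} {f : ℂ → ℂ}
    (hf : ContinuousOn f (Metric.ball 0 1)) (j : Fin n) :
    ContinuousOn (fun ζ : Fin n → ℂ => f (ζ j)) (polydisc n) :=
  hf.comp (continuous_apply j).continuousOn fun _ hζ => mem_ball_of_mem_polydisc hζ j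

/-- The kernel of `D`: the derivative of `z κ(z, ζ)` in `z`. -/
theorem DiscKernel.hasDerivAt_mul {κ κ' : ℂ → ℂ → ℂ} (h : DiscKernel κ κ') {ζ z : ℂ}
    (hζ : ζ ∈ Metric.ball (0 : ℂ) 1) (hz : z ∈ Metric.ball (0 : ℂ) 1) :
    HasDerivAt (fun w => w * κ w ζ) (κ z ζ + z * κ' z ζ) z := by
  have := (hasDerivAt_id' z).fun_mul (h.hasDerivAt ζ hζ z hz)
  rwa [one_mul] at this

theorem hasDerivAt_mul_integral {n : ℕ} {κ κ' : ℂ → ℂ → ℂ} (h : DiscKernel κ κ') (j : Fin n)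
    {R : (Fin n → ℂ) → ℂ} (hR : Integrable R (polydiscMeasure n)) {z : ℂ}
    (hz : z ∈ Metric.ball (0 : ℂ) 1) :
    HasDerivAt (fun w => w * ∫ ζ, R ζ * κ w (ζ j) ∂polydiscMeasure n)
      (∫ ζ, R ζ * (κ z (ζ j) + z * κ' z (ζ j)) ∂polydiscMeasure n) z := by
  have hz' := hz
  rw [mem_ball_zero_iff] at hz'
  obtain ⟨B, hB⟩ := h.bound ((1 + ‖z‖) / 2) (by linarith)
  have hsub : ∀ w ∈ Metric.ball z ((1 - ‖z‖) / 2), ‖w‖ ≤ (1 + ‖z‖) / 2 ∧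
      w ∈ Metric.ball (0 : ℂ) 1 := by
    intro w hw
    rw [mem_ball_iff_norm] at hw
    have := norm_le_norm_add_norm_sub' w z
    refine ⟨by linarith, ?_⟩
    rw [mem_ball_zero_iff]; linarith
  have hfun : (fun w => w * ∫ ζ, R ζ * κ w (ζ j) ∂polydiscMeasure n) =
      fun w => ∫ ζ, R ζ * (w * κ w (ζ j)) ∂polydiscMeasure n := by
    ext w
    rw [← integral_const_mul]
    refine integral_congr_ae (Filter.Eventually.of_forall fun ζ => ?_)
    simp only
    ring
  rw [hfun]
  have hcoord : ∀ᵐ ζ ∂polydiscMeasure n, ζ j ∈ Metric.ball (0 : ℂ) 1 := by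
    filter_upwards [ae_mem_polydisc n] with ζ hζ using mem_ball_of_mem_polydisc hζ j
  have hmeas : ∀ w ∈ Metric.ball (0 : ℂ) 1, AEStronglyMeasurable (fun ζ : Fin n → ℂ => κ w (ζ j))
      (polydiscMeasure n) := fun w hw =>
    ((h.continuousOn w hw).comp_coord_polydisc j).aestronglyMeasurable_polydisc
  have hmeas' : AEStronglyMeasurable (fun ζ : Fin n → ℂ => κ' z (ζ j)) (polydiscMeasure n) :=
    ((h.continuousOn' z hz).comp_coord_polydisc j).aestronglyMeasurable_polydisc
  refine (hasDerivAt_integral_of_dominated_loc_of_deriv_le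
    (F := fun w ζ => R ζ * (w * κ w (ζ j)))
    (F' := fun w ζ => R ζ * (κ w (ζ j) + w * κ' w (ζ j)))
    (bound := fun ζ => ‖R ζ‖ * (B + B)) (s := Metric.ball z ((1 - ‖z‖) / 2))
    (Metric.ball_mem_nhds _ (by linarith)) ?_ ?_ ?_ ?_ ?_ ?_).2
  · filter_upwards [Metric.isOpen_ball.mem_nhds hz] with w hw
    exact hR.aestronglyMeasurable.mul ((hmeas w hw).const_mul w)
  · refine hR.mul_bdd (c := B) ((hmeas z hz).const_mul z) ?_
    filter_upwards [hcoord] with ζ hζ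
    have h1 := (hB z (by linarith) _ hζ).1
    rw [norm_mul]
    nlinarith [norm_nonneg z, norm_nonneg (κ z (ζ j))]
  · exact hR.aestronglyMeasurable.mul ((hmeas z hz).add (hmeas'.const_mul z))
  · filter_upwards [hcoord] with ζ hζ w hw
    obtain ⟨h1, h2⟩ := hB w (hsub w hw).1 _ hζ
    have hw1 := (hsub w hw).2
    rw [mem_ball_zero_iff] at hw1
    rw [norm_mul]
    refine mul_le_mul_of_nonneg_left ?_ (norm_nonneg _)
    refine (norm_add_le _ _).trans (add_le_add h1 ?_)
    rw [norm_mul]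
    nlinarith [norm_nonneg w, norm_nonneg (κ' w (ζ j))]
  · exact hR.norm.mul_const _
  · filter_upwards [hcoord] with ζ hζ w hw
    exact (h.hasDerivAt_mul hζ (hsub w hw).2).const_mul _

/-- The integral `∫ Q(ζ) ∏ κ_j(z_j, ζ_j)` over the polydisc, as a function of `z`. -/
noncomputable def kernelIntegral {n : ℕ} (κ : Fin n → ℂ → ℂ → ℂ) (Q : (Fin n → ℂ) → ℂ) :
    (Fin n → ℂ) → ℂ :=
  fun z => ∫ ζ, Q ζ * ∏ j, κ j (z j) (ζ j) ∂polydiscMeasure n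

theorem aestronglyMeasurable_prod_kernel {n : ℕ} (s : Finset (Fin n)) {κ : Fin n → ℂ → ℂ}
    (h : ∀ j, ContinuousOn (κ j) (Metric.ball 0 1)) :
    AEStronglyMeasurable (fun ζ : Fin n → ℂ => ∏ j ∈ s, κ j (ζ j)) (polydiscMeasure n) :=
  (continuousOn_finsetProd s fun j _ => (h j).comp_coord_polydisc j).aestronglyMeasurable_polydisc

theorem Integrable.mul_prod_kernel {n : ℕ} {Q : (Fin n → ℂ) → ℂ}
    (hQ : Integrable Q (polydiscMeasure n)) (s : Finset (Fin n)) {κ : Fin n → ℂ → ℂ}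
    (h : ∀ j, ContinuousOn (κ j) (Metric.ball 0 1))
    (hb : ∀ j, ∃ B, ∀ ζ ∈ Metric.ball (0 : ℂ) 1, ‖κ j ζ‖ ≤ B) :
    Integrable (fun ζ => Q ζ * ∏ j ∈ s, κ j (ζ j)) (polydiscMeasure n) := by
  choose B hB using hb
  refine hQ.mul_bdd (c := ∏ j ∈ s, B j) (aestronglyMeasurable_prod_kernel s h) ?_
  filter_upwards [ae_mem_polydisc n] with ζ hζ
  rw [norm_prod]
  exact Finset.prod_le_prod (fun _ _ => norm_nonneg _) fun j _ =>
    hB j _ (mem_ball_of_mem_polydisc hζ j)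

/-- Applying the operators `D_j`, `j ∈ l`, to a kernel integral replaces the factors `κ_j`,
`j ∈ l`, by `κ_j + z_j κ_j'`. -/
theorem foldr_coordD_kernelIntegral {n : ℕ} {κ κ' : Fin n → ℂ → ℂ → ℂ}
    (h : ∀ j, DiscKernel (κ j) (κ' j)) {Q : (Fin n → ℂ) → ℂ}
    (hQ : Integrable Q (polydiscMeasure n)) {l : List (Fin n)} (hl : l.Nodup) {z : Fin n → ℂ}
    (hz : z ∈ polydisc n) :
    l.foldr coordD (kernelIntegral κ Q) z = kernelIntegral
      (fun j z ζ => if j ∈ l then κ j z ζ + z * κ' j z ζ else κ j z ζ) Q z := by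
  induction l generalizing z with
  | nil => simp [kernelIntegral]
  | cons i l ih =>
    obtain ⟨hi, hl'⟩ := List.nodup_cons.1 hl
    set κl : Fin n → ℂ → ℂ → ℂ :=
      fun j z ζ => if j ∈ l then κ j z ζ + z * κ' j z ζ else κ j z ζ with hκl
    rw [List.foldr_cons, coordD_apply]
    have hzi := mem_ball_of_mem_polydisc hz i
    -- the factors not involving the `i`-th variable
    set R : (Fin n → ℂ) → ℂ := fun ζ => Q ζ * ∏ j ∈ Finset.univ.erase i, κl j (z j) (ζ j) with hR
    have hRint : Integrable R (polydiscMeasure n) := by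
      refine Integrable.mul_prod_kernel hQ _ (fun j => ?_) (fun j => ?_)
      · have hzj := mem_ball_of_mem_polydisc hz j
        simp only [hκl]
        split_ifs
        · exact ((h j).continuousOn _ hzj).add (continuousOn_const.mul ((h j).continuousOn' _ hzj))
        · exact (h j).continuousOn _ hzj
      · obtain ⟨B, hB⟩ := (h j).bound _ (hz j)
        refine ⟨B + ‖z j‖ * B, fun ζ hζ => ?_⟩
        obtain ⟨h1, h2⟩ := hB (z j) le_rfl ζ hζ
        have hB0 : 0 ≤ B := (norm_nonneg _).trans h1
        simp only [hκl]
        split_ifs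
        · refine (norm_add_le _ _).trans (add_le_add h1 ?_)
          rw [norm_mul]
          gcongr
        · have := mul_nonneg (norm_nonneg (z j)) hB0
          linarith
    have hslice : ∀ w ∈ Metric.ball (0 : ℂ) 1,
        l.foldr coordD (kernelIntegral κ Q) (Function.update z i w) =
          ∫ ζ, R ζ * κ i w (ζ i) ∂polydiscMeasure n := by
      intro w hw
      rw [ih hl' (update_mem_polydisc hz hw), kernelIntegral]
      refine integral_congr_ae (Filter.Eventually.of_forall fun ζ => ?_)
      simp only [hR]
      rw [← Finset.mul_prod_erase _ _ (Finset.mem_univ i), Function.update_self]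
      have : ∏ j ∈ Finset.univ.erase i, κl j (Function.update z i w j) (ζ j) =
          ∏ j ∈ Finset.univ.erase i, κl j (z j) (ζ j) :=
        Finset.prod_congr rfl fun j hj => by
          rw [Function.update_of_ne (Finset.ne_of_mem_erase hj)]
      rw [this]
      simp only [hκl, if_neg hi]
      ring
    have hev : (fun w => w * l.foldr coordD (kernelIntegral κ Q) (Function.update z i w))
        =ᶠ[nhds (z i)] fun w => w * ∫ ζ, R ζ * κ i w (ζ i) ∂polydiscMeasure n := by
      filter_upwards [Metric.isOpen_ball.mem_nhds hzi] with w hw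
      rw [hslice w hw]
    rw [hev.deriv_eq, (hasDerivAt_mul_integral (h i) i hRint hzi).deriv, kernelIntegral]
    refine integral_congr_ae (Filter.Eventually.of_forall fun ζ => ?_)
    simp only [hR]
    rw [← Finset.mul_prod_erase _ _ (Finset.mem_univ i)]
    have : ∏ j ∈ Finset.univ.erase i, (if j ∈ i :: l then κ j (z j) (ζ j) + z j * κ' j (z j) (ζ j)
        else κ j (z j) (ζ j)) = ∏ j ∈ Finset.univ.erase i, κl j (z j) (ζ j) :=
      Finset.prod_congr rfl fun j hj => by
        have hji := Finset.ne_of_mem_erase hj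
        simp only [hκl, List.mem_cons, hji, false_or]
    rw [this]
    simp only [List.mem_cons, true_or, if_true]
    ring

theorem besovD_kernelIntegral {n : ℕ} {κ κ' : Fin n → ℂ → ℂ → ℂ}
    (h : ∀ j, DiscKernel (κ j) (κ' j)) {Q : (Fin n → ℂ) → ℂ}
    (hQ : Integrable Q (polydiscMeasure n)) {z : Fin n → ℂ} (hz : z ∈ polydisc n) :
    besovD (kernelIntegral κ Q) z =
      kernelIntegral (fun j z ζ => κ j z ζ + z * κ' j z ζ) Q z := by
  rw [besovD_eq_foldr_coordD, foldr_coordD_kernelIntegral h hQ (List.nodup_finRange n) hz]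
  simp

theorem differentiableOn_kernelIntegral {n : ℕ} {κ κ' : Fin n → ℂ → ℂ → ℂ}
    (h : ∀ j, DiscKernel (κ j) (κ' j)) {Q : (Fin n → ℂ) → ℂ}
    (hQ : Integrable Q (polydiscMeasure n)) :
    DifferentiableOn ℂ (kernelIntegral κ Q) (polydisc n) := by
  intro z hz
  refine DifferentiableAt.differentiableWithinAt ?_
  obtain ⟨ε, hε, hball⟩ := Metric.isOpen_iff.1 (isOpen_polydisc n) z hz
  -- a compact neighbourhood of `z` on which all kernels are bounded
  set r : Fin n → ℝ := fun j => (1 + ‖z j‖) / 2 with hr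
  have hr1 : ∀ j, r j < 1 := fun j => by
    have : ‖z j‖ < 1 := hz j
    simp only [hr]; linarith
  choose B hB using fun j => (h j).bound (r j) (hr1 j)
  set S : Set (Fin n → ℂ) := {x | ∀ j, ‖x j‖ < r j} with hS
  have hSsub : S ⊆ polydisc n := fun x hx j => (hx j).trans (hr1 j)
  have hSopen : IsOpen S := by
    have : S = ⋂ j, {x : Fin n → ℂ | ‖x j‖ < r j} := by ext x; simp [hS]
    rw [this]
    exact isOpen_iInter_of_finite fun j =>
      isOpen_lt (continuous_apply j).norm continuous_const
  have hzS : z ∈ S := fun j => by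
    have : ‖z j‖ < 1 := hz j
    simp only [hr]; linarith
  set P : Fin n → (Fin n → ℂ) →L[ℂ] ℂ := fun j => ContinuousLinearMap.proj j with hP
  have hBnn : ∀ j, ∀ ζ ∈ Metric.ball (0 : ℂ) 1, 0 ≤ B j := fun j ζ hζ =>
    (norm_nonneg _).trans (hB j (z j) (hzS j).le ζ hζ).1
  refine (hasFDerivAt_integral_of_dominated_of_fderiv_le (𝕜 := ℂ)
    (F := fun x ζ => Q ζ * ∏ j, κ j (x j) (ζ j))
    (F' := fun x ζ => Q ζ • ∑ i, (∏ j ∈ Finset.univ.erase i, κ j (x j) (ζ j)) •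
      (κ' i (x i) (ζ i) • P i))
    (bound := fun ζ => ‖Q ζ‖ * ∑ i, (∏ j ∈ Finset.univ.erase i, B j) * (B i * ‖P i‖))
    (hSopen.mem_nhds hzS) ?_ ?_ ?_ ?_ ?_ ?_).differentiableAt
  · filter_upwards [hSopen.mem_nhds hzS] with x hx
    exact hQ.aestronglyMeasurable.mul (aestronglyMeasurable_prod_kernel _ fun j =>
      (h j).continuousOn _ (mem_ball_of_mem_polydisc (hSsub hx) j))
  · refine Integrable.mul_prod_kernel hQ _ (fun j =>
      (h j).continuousOn _ (mem_ball_of_mem_polydisc hz j)) fun j => ⟨B j, fun ζ hζ => ?_⟩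
    exact (hB j _ (hzS j).le ζ hζ).1
  · refine hQ.aestronglyMeasurable.smul (Finset.aestronglyMeasurable_fun_sum _ fun i _ => ?_)
    refine AEStronglyMeasurable.smul (aestronglyMeasurable_prod_kernel _ fun j =>
      (h j).continuousOn _ (mem_ball_of_mem_polydisc hz j)) ?_
    exact (((h i).continuousOn' _ (mem_ball_of_mem_polydisc hz i)).comp_coord_polydisc
      i).aestronglyMeasurable_polydisc.smul_const _
  · filter_upwards [ae_mem_polydisc n] with ζ hζ x hx
    rw [norm_smul]
    refine mul_le_mul_of_nonneg_left ?_ (norm_nonneg _)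
    refine (norm_sum_le _ _).trans (Finset.sum_le_sum fun i _ => ?_)
    rw [norm_smul, norm_smul, norm_prod]
    refine mul_le_mul ?_ ?_ (by positivity) (Finset.prod_nonneg fun j _ =>
      hBnn j _ (mem_ball_of_mem_polydisc hζ j))
    · exact Finset.prod_le_prod (fun _ _ => norm_nonneg _) fun j _ =>
        (hB j _ (hx j).le _ (mem_ball_of_mem_polydisc hζ j)).1
    · exact mul_le_mul_of_nonneg_right (hB i _ (hx i).le _ (mem_ball_of_mem_polydisc hζ i)).2
        (norm_nonneg _)
  · exact hQ.norm.mul_const _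
  · filter_upwards [ae_mem_polydisc n] with ζ hζ x hx
    have hprod := HasFDerivAt.finsetProd (u := Finset.univ) (x := x)
      (g := fun i (x : Fin n → ℂ) => κ i (x i) (ζ i)) (g' := fun i => κ' i (x i) (ζ i) • P i)
      (fun i _ => by
        have h1 := (h i).hasDerivAt _ (mem_ball_of_mem_polydisc hζ i) _
          (mem_ball_of_mem_polydisc (hSsub hx) i)
        exact h1.comp_hasFDerivAt (f := fun x : Fin n → ℂ => x i) x (P i).hasFDerivAt)
    exact hprod.const_mul (Q ζ)

/-! ### The kernel of the little Hankel operator -/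

/-- The kernel `(1 - ζ̄ z)^{-a}`. -/
noncomputable def cpowKernel (a : ℝ) (z ζ : ℂ) : ℂ := (1 - (starRingEnd ℂ) ζ * z) ^ ((-a : ℝ) : ℂ)

/-- The derivative in `z` of the kernel `(1 - ζ̄ z)^{-a}`. -/
noncomputable def cpowKernel' (a : ℝ) (z ζ : ℂ) : ℂ :=
  a * (starRingEnd ℂ) ζ * (1 - (starRingEnd ℂ) ζ * z) ^ ((-(a + 1) : ℝ) : ℂ)

theorem re_one_sub_conj_mul_pos {z ζ : ℂ} (hζ : ζ ∈ Metric.ball (0 : ℂ) 1)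
    (hz : z ∈ Metric.ball (0 : ℂ) 1) : 0 < (1 - (starRingEnd ℂ) ζ * z).re := by
  rw [mem_ball_zero_iff] at hζ hz
  have h1 := Complex.re_le_norm ((starRingEnd ℂ) ζ * z)
  rw [norm_mul, Complex.norm_conj] at h1
  rw [Complex.sub_re, Complex.one_re]
  nlinarith [norm_nonneg z, norm_nonneg ζ]

theorem norm_one_sub_conj_mul (z ζ : ℂ) :
    ‖1 - (starRingEnd ℂ) ζ * z‖ = ‖1 - ζ * (starRingEnd ℂ) z‖ := by
  rw [← Complex.norm_conj]; simp

theorem norm_cpowKernel (a : ℝ) (z ζ : ℂ) :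
    ‖cpowKernel a z ζ‖ = ‖1 - ζ * (starRingEnd ℂ) z‖ ^ (-a) := by
  rw [cpowKernel, Complex.norm_cpow_real, norm_one_sub_conj_mul]

theorem norm_cpowKernel' {a : ℝ} (ha : 0 ≤ a) (z ζ : ℂ) :
    ‖cpowKernel' a z ζ‖ = a * ‖ζ‖ * ‖1 - ζ * (starRingEnd ℂ) z‖ ^ (-(a + 1)) := by
  rw [cpowKernel', norm_mul, norm_mul, Complex.norm_cpow_real, norm_one_sub_conj_mul,
    Complex.norm_conj, Complex.norm_real, Real.norm_of_nonneg ha]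

theorem discKernel_cpowKernel {a : ℝ} (ha : 0 ≤ a) :
    DiscKernel (cpowKernel a) (cpowKernel' a) where
  hasDerivAt ζ hζ z hz := by
    have hre := re_one_sub_conj_mul_pos hζ hz
    have h1 : HasDerivAt (fun w => 1 - (starRingEnd ℂ) ζ * w) (-(starRingEnd ℂ) ζ) z := by
      simpa using ((hasDerivAt_id z).const_mul ((starRingEnd ℂ) ζ)).const_sub 1
    have := h1.cpow_const (c := ((-a : ℝ) : ℂ)) (Or.inl hre)
    refine this.congr_deriv ?_
    rw [cpowKernel']
    push_cast
    rw [neg_add, ← sub_eq_add_neg]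
    ring
  continuousOn z hz := by
    refine ContinuousOn.cpow_const ?_ fun ζ hζ => Or.inl (re_one_sub_conj_mul_pos hζ hz)
    exact (continuous_const.sub (Complex.continuous_conj.mul continuous_const)).continuousOn
  continuousOn' z hz := by
    refine ContinuousOn.mul (by fun_prop) ?_
    refine ContinuousOn.cpow_const ?_ fun ζ hζ => Or.inl (re_one_sub_conj_mul_pos hζ hz)
    exact (continuous_const.sub (Complex.continuous_conj.mul continuous_const)).continuousOn
  bound r hr := by
    have hr0 : 0 < 1 - r := by linarith
    refine ⟨max ((1 - r) ^ (-a)) (a * (1 - r) ^ (-(a + 1))), fun z hz ζ hζ => ?_⟩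
    have hN : 1 - r ≤ ‖1 - ζ * (starRingEnd ℂ) z‖ := by
      rw [mem_ball_zero_iff] at hζ
      have := norm_sub_norm_le 1 (ζ * (starRingEnd ℂ) z)
      rw [norm_one, norm_mul, Complex.norm_conj] at this
      nlinarith [norm_nonneg ζ, norm_nonneg z]
    have h1 := Real.rpow_le_rpow_of_nonpos (z := -a) hr0 hN (by linarith)
    have h2 := Real.rpow_le_rpow_of_nonpos (z := -(a + 1)) hr0 hN (by linarith)
    rw [norm_cpowKernel, norm_cpowKernel' ha]
    refine ⟨h1.trans (le_max_left _ _), le_trans ?_ (le_max_right _ _)⟩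
    rw [mem_ball_zero_iff] at hζ
    calc _ ≤ a * 1 * (1 - r) ^ (-(a + 1)) := by gcongr
      _ = _ := by ring

theorem norm_cpowKernel_add_le {a : ℝ} (ha : 0 ≤ a) {z ζ : ℂ} (hz : z ∈ Metric.ball (0 : ℂ) 1)
    (hζ : ζ ∈ Metric.ball (0 : ℂ) 1) :
    ‖cpowKernel a z ζ + z * cpowKernel' a z ζ‖ ≤
      (a + 2) * ‖1 - ζ * (starRingEnd ℂ) z‖ ^ (-(a + 1)) := by
  have hN := norm_one_sub_mul_conj_pos hz hζ
  rw [mem_ball_zero_iff] at hz hζ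
  have hN2 : ‖1 - ζ * (starRingEnd ℂ) z‖ ≤ 2 := by
    refine (norm_sub_le _ _).trans ?_
    rw [norm_one, norm_mul, Complex.norm_conj]
    nlinarith [norm_nonneg z, norm_nonneg ζ]
  set N := ‖1 - ζ * (starRingEnd ℂ) z‖ with hNdef
  refine (norm_add_le _ _).trans ?_
  rw [norm_mul, norm_cpowKernel, norm_cpowKernel' ha, ← hNdef]
  have e1 : N ^ (-a) = N * N ^ (-(a + 1)) := by
    calc N ^ (-a) = N ^ (1 + -(a + 1)) := by congr 1; ring
      _ = _ := by rw [Real.rpow_add hN, Real.rpow_one]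
  have hp : 0 ≤ N ^ (-(a + 1)) := by positivity
  rw [e1]
  have h1 : N * N ^ (-(a + 1)) ≤ 2 * N ^ (-(a + 1)) := by gcongr
  have h2 : ‖z‖ * (a * ‖ζ‖ * N ^ (-(a + 1))) ≤ 1 * (a * 1 * N ^ (-(a + 1))) := by gcongr
  linarith

/-! ### The Besov quasi-norm as a weighted integral -/

theorem foldr_coordD_congr {n : ℕ} {f g : (Fin n → ℂ) → ℂ} (h : ∀ z ∈ polydisc n, f z = g z)
    (l : List (Fin n)) {z : Fin n → ℂ} (hz : z ∈ polydisc n) :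
    l.foldr coordD f z = l.foldr coordD g z := by
  induction l generalizing z with
  | nil => exact h z hz
  | cons j l ih =>
    rw [List.foldr_cons, List.foldr_cons, coordD_apply, coordD_apply]
    refine Filter.EventuallyEq.deriv_eq ?_
    filter_upwards [Metric.isOpen_ball.mem_nhds (mem_ball_of_mem_polydisc hz j)] with w hw
    rw [ih (update_mem_polydisc hz hw)]

theorem besovD_congr {n : ℕ} {f g : (Fin n → ℂ) → ℂ} (h : ∀ z ∈ polydisc n, f z = g z)
    {z : Fin n → ℂ} (hz : z ∈ polydisc n) : besovD f z = besovD g z := by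
  rw [besovD_eq_foldr_coordD, besovD_eq_foldr_coordD, foldr_coordD_congr h _ hz]

theorem one_sub_norm_mem_Ioo {z : ℂ} (hz : ‖z‖ < 1) (h0 : z ≠ 0) :
    1 - ‖z‖ ∈ Set.Ioo (0 : ℝ) 1 :=
  ⟨by linarith, by linarith [norm_pos_iff.2 h0]⟩

theorem rpow_one_sub_sq_le {x a : ℝ} (hx0 : 0 ≤ x) (hx1 : x < 1) (ha : a ≤ 0) :
    (1 - x ^ 2) ^ a ≤ (1 - x) ^ a ∧ (1 - x) ^ a ≤ 2 ^ (-a) * (1 - x ^ 2) ^ a := by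
  have h1 : 0 < 1 - x := by linarith
  have h2 : 0 < 1 + x := by linarith
  rw [show 1 - x ^ 2 = (1 - x) * (1 + x) by ring, Real.mul_rpow h1.le h2.le]
  have h3 : 0 < (1 - x) ^ a := by positivity
  have h4 : (1 + x) ^ a ≤ 1 := Real.rpow_le_one_of_one_le_of_nonpos (by linarith) ha
  have h5 : (2 : ℝ) ^ a ≤ (1 + x) ^ a := Real.rpow_le_rpow_of_nonpos h2 (by linarith) ha
  have h6 : (2 : ℝ) ^ (-a) * 2 ^ a = 1 := by
    rw [← Real.rpow_add two_pos]; simp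
  have h7 : (0 : ℝ) < 2 ^ (-a) := by positivity
  refine ⟨by nlinarith, ?_⟩
  calc (1 - x) ^ a = (2 ^ (-a) * 2 ^ a) * (1 - x) ^ a := by rw [h6, one_mul]
    _ ≤ (2 ^ (-a) * (1 + x) ^ a) * (1 - x) ^ a := by gcongr
    _ = _ := by ring

/-- Up to a constant, `1 - |z_j|²` may be replaced by `1 - |z_j|` in the definition of the
Besov quasi-norm. -/
theorem besovPow_le_lintegral {n : ℕ} {p : ℝ} (hp0 : 0 < p) (hp1 : p < 1) {ω : Fin n → ℝ → ℝ}
    (hω : ∀ j, RegularWeight (ω j)) (f : (Fin n → ℂ) → ℂ) :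
    besovPow p ω f ≤
        ∫⁻ z, ‖besovD f z‖ₑ ^ p * prodWeight ω (fun _ => p - 2) z ∂polydiscMeasure n ∧
      ∫⁻ z, ‖besovD f z‖ₑ ^ p * prodWeight ω (fun _ => p - 2) z ∂polydiscMeasure n ≤
        ENNReal.ofReal ((2 ^ (2 - p)) ^ n) * besovPow p ω f := by
  have hrepr : ∀ z ∈ polydisc n, ENNReal.ofReal
      (‖besovD f z‖ ^ p * ∏ j, ω j (1 - ‖z j‖) / (1 - ‖z j‖ ^ 2) ^ (2 - p)) =
      ‖besovD f z‖ₑ ^ p * ENNReal.ofReal (∏ j, ω j (1 - ‖z j‖) * (1 - ‖z j‖ ^ 2) ^ (p - 2)) := by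
    intro z hz
    rw [ENNReal.ofReal_mul (by positivity), ← ENNReal.ofReal_rpow_of_nonneg (norm_nonneg _) hp0.le,
      ofReal_norm]
    congr 3
    funext j
    have : 0 ≤ 1 - ‖z j‖ ^ 2 := by
      have h1 : ‖z j‖ < 1 := hz j
      nlinarith [norm_nonneg (z j)]
    rw [div_eq_mul_inv, ← Real.rpow_neg this, neg_sub]
  rw [besovPow, lintegral_polydiscMeasure]
  refine ⟨lintegral_mono_ae ?_, ?_⟩
  · filter_upwards [ae_mem_polydisc n, ae_forall_ne_zero n] with z hz hz0
    rw [hrepr z hz, prodWeight, ENNReal.ofReal_prod_of_nonneg]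
    · refine mul_le_mul' le_rfl (Finset.prod_le_prod' fun j _ => ENNReal.ofReal_le_ofReal ?_)
      have hδ := one_sub_norm_mem_Ioo (hz j) (hz0 j)
      rw [zeroExt_of_mem hδ]
      exact mul_le_mul_of_nonneg_left (rpow_one_sub_sq_le (norm_nonneg _) (hz j) (by linarith)).1
        ((hω j).pos _ hδ).le
    · intro j _
      have hδ := one_sub_norm_mem_Ioo (hz j) (hz0 j)
      have h1 : ‖z j‖ < 1 := hz j
      have : 0 ≤ 1 - ‖z j‖ ^ 2 := by nlinarith [norm_nonneg (z j)]
      exact mul_nonneg ((hω j).pos _ hδ).le (by positivity)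
  · rw [← lintegral_const_mul' _ _ ENNReal.ofReal_ne_top]
    refine lintegral_mono_ae ?_
    filter_upwards [ae_mem_polydisc n, ae_forall_ne_zero n] with z hz hz0
    rw [hrepr z hz, mul_left_comm, prodWeight, ENNReal.ofReal_prod_of_nonneg,
      ENNReal.ofReal_pow (by positivity)]
    · gcongr
      have : ENNReal.ofReal ((2 : ℝ) ^ (2 - p)) ^ n =
          ∏ _j : Fin n, ENNReal.ofReal ((2 : ℝ) ^ (2 - p)) := by simp
      rw [this, ← Finset.prod_mul_distrib]
      refine Finset.prod_le_prod' fun j _ => ?_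
      rw [← ENNReal.ofReal_mul (by positivity)]
      refine ENNReal.ofReal_le_ofReal ?_
      have hδ := one_sub_norm_mem_Ioo (hz j) (hz0 j)
      rw [zeroExt_of_mem hδ]
      have h2 := (rpow_one_sub_sq_le (a := p - 2) (norm_nonneg _) (hz j) (by linarith)).2
      rw [neg_sub] at h2
      calc _ ≤ ω j (1 - ‖z j‖) * (2 ^ (2 - p) * (1 - ‖z j‖ ^ 2) ^ (p - 2)) :=
            mul_le_mul_of_nonneg_left h2 ((hω j).pos _ hδ).le
        _ = _ := by ring
    · intro j _
      have hδ := one_sub_norm_mem_Ioo (hz j) (hz0 j)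
      have h1 : ‖z j‖ < 1 := hz j
      have : 0 ≤ 1 - ‖z j‖ ^ 2 := by nlinarith [norm_nonneg (z j)]
      exact mul_nonneg ((hω j).pos _ hδ).le (by positivity)

/-! ### The little Hankel operator as a kernel integral -/

/-- The complex conjugate of `∏ (1 - |ζ_j|²)^{α_j} f(ζ) g(ζ)`; its kernel integral is the complex
conjugate of the little Hankel operator. -/
noncomputable def hankelDensity {n : ℕ} (α : Fin n → ℝ) (g f : (Fin n → ℂ) → ℂ)
    (ζ : Fin n → ℂ) : ℂ :=
  (starRingEnd ℂ) ((∏ j, (((1 - ‖ζ j‖ ^ 2) ^ (α j) : ℝ) : ℂ)) * f ζ * g ζ)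

theorem conj_hankelIntegrand {n : ℕ} (α : Fin n → ℝ) (g f : (Fin n → ℂ) → ℂ) {z ζ : Fin n → ℂ}
    (hz : z ∈ polydisc n) (hζ : ζ ∈ polydisc n) :
    (starRingEnd ℂ) (hankelIntegrand α g f z ζ) =
      hankelDensity α g f ζ * ∏ j, cpowKernel (α j + 2) (z j) (ζ j) := by
  have hfac : ∀ j, (starRingEnd ℂ) ((1 - ζ j * (starRingEnd ℂ) (z j)) ^ ((α j + 2 : ℝ) : ℂ)) =
      (cpowKernel (α j + 2) (z j) (ζ j))⁻¹ := by
    intro j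
    have hre := re_one_sub_conj_mul_pos (mem_ball_of_mem_polydisc hζ j)
      (mem_ball_of_mem_polydisc hz j)
    have hconj : (starRingEnd ℂ) (1 - (starRingEnd ℂ) (ζ j) * z j) =
        1 - ζ j * (starRingEnd ℂ) (z j) := by simp
    have harg : (1 - (starRingEnd ℂ) (ζ j) * z j).arg ≠ Real.pi := by
      intro h
      have := (Complex.arg_eq_pi_iff.1 h).1
      linarith
    have h1 := Complex.conj_cpow _ ((α j + 2 : ℝ) : ℂ) harg
    rw [hconj, Complex.conj_ofReal] at h1
    rw [h1, Complex.conj_conj, cpowKernel, Complex.ofReal_neg, Complex.cpow_neg, inv_inv]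
  rw [hankelIntegrand, hankelDensity, Finset.prod_div_distrib]
  simp only [map_mul, map_div₀, map_prod, Complex.conj_ofReal]
  simp_rw [hfac]
  rw [Finset.prod_inv_distrib]
  rw [div_inv_eq_mul]
  ring

theorem integrable_conj_iff {n : ℕ} {F : (Fin n → ℂ) → ℂ} :
    Integrable (fun ζ => (starRingEnd ℂ) (F ζ)) (polydiscMeasure n) ↔
      Integrable F (polydiscMeasure n) :=
  Complex.conjLIE.toContinuousLinearEquiv.integrable_comp_iff (φ := F)

theorem hankelDefined_iff {n : ℕ} {α : Fin n → ℝ} (hα : ∀ j, -1 < α j)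
    (g f : (Fin n → ℂ) → ℂ) :
    HankelDefined α g f ↔ Integrable (hankelDensity α g f) (polydiscMeasure n) := by
  have key : ∀ z ∈ polydisc n, IntegrableOn (hankelIntegrand α g f z) (polydisc n) ↔
      Integrable (fun ζ => hankelDensity α g f ζ * ∏ j, cpowKernel (α j + 2) (z j) (ζ j))
        (polydiscMeasure n) := by
    intro z hz
    rw [IntegrableOn, restrict_polydisc, ← integrable_conj_iff]
    refine integrable_congr ?_
    filter_upwards [ae_mem_polydisc n] with ζ hζ using conj_hankelIntegrand α g f hz hζ
  refine ⟨fun h => ?_, fun h z hz => ?_⟩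
  · have h0 : (0 : Fin n → ℂ) ∈ polydisc n := fun j => by simp
    have := (key 0 h0).1 (h 0 h0)
    simpa [cpowKernel] using this
  · rw [key z hz]
    have hd : ∀ j, DiscKernel (cpowKernel (α j + 2)) (cpowKernel' (α j + 2)) := fun j =>
      discKernel_cpowKernel (by linarith [hα j])
    refine Integrable.mul_prod_kernel h _ (fun j => (hd j).continuousOn _
      (mem_ball_of_mem_polydisc hz j)) fun j => ?_
    obtain ⟨B, hB⟩ := (hd j).bound _ (hz j)
    exact ⟨B, fun ζ hζ => (hB (z j) le_rfl ζ hζ).1⟩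

theorem conjFun_hankel_eq {n : ℕ} (α : Fin n → ℝ) (g f : (Fin n → ℂ) → ℂ) {z : Fin n → ℂ}
    (hz : z ∈ polydisc n) : conjFun (hankel α g f) z =
      kernelIntegral (fun j => cpowKernel (α j + 2)) (hankelDensity α g f) z := by
  rw [conjFun, hankel, restrict_polydisc, ← integral_conj, kernelIntegral]
  refine integral_congr_ae ?_
  filter_upwards [ae_mem_polydisc n] with ζ hζ using conj_hankelIntegrand α g f hz hζ

/-- The kernel `∂_z (z (1 - ζ̄ z)^{-a})` of `D` applied to the conjugate Hankel operator. -/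
noncomputable def cpowKernelD (a : ℝ) (z ζ : ℂ) : ℂ := cpowKernel a z ζ + z * cpowKernel' a z ζ

theorem besovD_conjFun_hankel {n : ℕ} {α : Fin n → ℝ} (hα : ∀ j, -1 < α j)
    {g f : (Fin n → ℂ) → ℂ} (h : Integrable (hankelDensity α g f) (polydiscMeasure n))
    {z : Fin n → ℂ} (hz : z ∈ polydisc n) : besovD (conjFun (hankel α g f)) z =
      ∫ ζ, hankelDensity α g f ζ * ∏ j, cpowKernelD (α j + 2) (z j) (ζ j) ∂polydiscMeasure n := by
  have hd : ∀ j, DiscKernel (cpowKernel (α j + 2)) (cpowKernel' (α j + 2)) := fun j =>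
    discKernel_cpowKernel (by linarith [hα j])
  rw [besovD_congr (fun z hz => conjFun_hankel_eq α g f hz) hz, besovD_kernelIntegral hd h hz]
  rfl

theorem differentiableOn_conjFun_hankel {n : ℕ} {α : Fin n → ℝ} (hα : ∀ j, -1 < α j)
    {g f : (Fin n → ℂ) → ℂ} (h : Integrable (hankelDensity α g f) (polydiscMeasure n)) :
    DifferentiableOn ℂ (conjFun (hankel α g f)) (polydisc n) := by
  have hd : ∀ j, DiscKernel (cpowKernel (α j + 2)) (cpowKernel' (α j + 2)) := fun j =>
    discKernel_cpowKernel (by linarith [hα j])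
  exact (differentiableOn_kernelIntegral hd h).congr fun z hz => conjFun_hankel_eq α g f hz

theorem rpow_one_sub_sq_le_two_rpow_abs_mul {x a : ℝ} (hx0 : 0 ≤ x) (hx1 : x < 1) :
    (1 - x ^ 2) ^ a ≤ 2 ^ |a| * (1 - x) ^ a := by
  have h1 : 0 < 1 - x := by linarith
  rw [show 1 - x ^ 2 = (1 + x) * (1 - x) by ring, Real.mul_rpow (by linarith) h1.le]
  gcongr
  calc (1 + x) ^ a ≤ (1 + x) ^ |a| := Real.rpow_le_rpow_of_exponent_le (by linarith) (le_abs_self a)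
    _ ≤ 2 ^ |a| := by gcongr; linarith

/-! ### Boundedness of the little Hankel operator -/

theorem WeightGrowth.exists_rpow_le {ω : ℝ → ℝ} {s A c C : ℝ} (h : WeightGrowth ω s A c C)
    (hs : 0 ≤ s) {B : ℝ} (hB : A ≤ B) :
    ∃ K > 0, ∀ r ∈ Set.Ioo (0 : ℝ) 1, r ^ B ≤ K * ω r := by
  have hhalf : (1 / 2 : ℝ) ∈ Set.Ioo (0 : ℝ) 1 := ⟨by norm_num, by norm_num⟩
  have hω := h.pos _ hhalf
  have hA0 : 0 ≤ A := hs.trans h.exponent_le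
  have hB0 : 0 ≤ B := hA0.trans hB
  have hc := h.c_pos
  have hC := h.C_pos
  refine ⟨(C + c⁻¹) / ω (1 / 2), by positivity, fun r hr => ?_⟩
  have hωr := h.pos r hr
  have hrB : r ^ B ≤ 1 := Real.rpow_le_one hr.1.le hr.2.le hB0
  rw [div_mul_eq_mul_div, le_div_iff₀ hω]
  rcases le_or_gt (1 / 2) r with hr2 | hr2
  · have hl : 1 / (2 * r) ∈ Set.Ioc (0 : ℝ) 1 := by
      have := hr.1
      refine ⟨by positivity, ?_⟩
      rw [div_le_one (by positivity)]; linarith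
    have h1 := h.upper r hr _ hl
    have h2 : 1 / (2 * r) * r = 1 / 2 := by have := hr.1; field_simp
    rw [h2] at h1
    have h3 : (1 / (2 * r)) ^ s ≤ 1 := Real.rpow_le_one hl.1.le hl.2 hs
    calc r ^ B * ω (1 / 2) ≤ 1 * (C * (1 / (2 * r)) ^ s * ω r) := by gcongr
      _ ≤ 1 * (C * 1 * ω r) := by gcongr
      _ ≤ (C + c⁻¹) * ω r := by
        have : 0 < c⁻¹ * ω r := by positivity
        linarith
  · have hl : 2 * r ∈ Set.Ioc (0 : ℝ) 1 := ⟨by linarith [hr.1], by linarith⟩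
    have h1 := h.lower _ hhalf _ hl
    rw [show 2 * r * (1 / 2) = r by ring] at h1
    have h2 : r ^ B ≤ (2 * r) ^ A :=
      (Real.rpow_le_rpow_of_exponent_ge hr.1 hr.2.le hB).trans
        (Real.rpow_le_rpow hr.1.le (by linarith [hr.1]) hA0)
    calc r ^ B * ω (1 / 2) ≤ (2 * r) ^ A * ω (1 / 2) := by gcongr
      _ = c⁻¹ * (c * (2 * r) ^ A * ω (1 / 2)) := by field_simp
      _ ≤ c⁻¹ * ω r := by gcongr
      _ ≤ (C + c⁻¹) * ω r := by nlinarith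

/-- Under the growth condition on the weights, weighted `p`-integrability of a holomorphic function
against `∏ ω_j(1 - |y_j|) (1 - |y_j|)^{-2}` forces integrability against
`∏ (1 - |y_j|)^{α_j}`. -/
theorem exists_lintegral_rpow_le_prodWeight {n : ℕ} {p : ℝ} (hp0 : 0 < p) (hp1 : p < 1)
    {ω : Fin n → ℝ → ℝ} {s A c C α : Fin n → ℝ}
    (hg : ∀ j, WeightGrowth (ω j) (s j) (A j) (c j) (C j)) (hs : ∀ j, 0 ≤ s j)
    (hA : ∀ j, A j ≤ p * (α j + 2)) :
    ∃ K : ℝ, 0 < K ∧ ∀ φ : (Fin n → ℂ) → ℂ, SepHolomorphic φ →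
      (∫⁻ y, ‖φ y‖ₑ * ∏ j, ENNReal.ofReal ((1 - ‖y j‖) ^ α j) ∂polydiscMeasure n) ^ p ≤
        ENNReal.ofReal K * ∫⁻ y, ‖φ y‖ₑ ^ p * prodWeight ω (fun _ => -2) y ∂polydiscMeasure n := by
  set M : ℝ := ∑ j, (2 : ℝ) ^ |α j| * 2 ^ (0 : ℝ) + 1 with hM
  have hM0 : 0 < M := by positivity
  have hMj : ∀ j, (2 : ℝ) ^ |α j| * 2 ^ (0 : ℝ) ≤ M := fun j => by
    have := Finset.single_le_sum (f := fun j => (2 : ℝ) ^ |α j| * 2 ^ (0 : ℝ))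
      (fun i _ => by positivity) (Finset.mem_univ j)
    linarith
  obtain ⟨C1, hC1, HC1⟩ := exists_lintegral_rpow_le n hp0 hp1 hM0
  choose K hK HK using fun j => (hg j).exists_rpow_le (hs j) (hA j)
  have hKprod : 0 < ∏ j, K j := Finset.prod_pos fun j _ => hK j
  refine ⟨C1 * ∏ j, K j, by positivity, fun φ hφ => ?_⟩
  have h0 : (0 : ℂ) ∈ Metric.ball (0 : ℂ) 1 := Metric.mem_ball_self one_pos
  have h1 := HC1 φ (fun j => powKernel (α j) 0 0) hφ fun j =>
    (slowlyVarying_powKernel le_rfl h0).mono (hMj j)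
  have hker : ∀ (j : Fin n) (w : ℂ), powKernel (α j) 0 0 w = (1 - ‖w‖) ^ α j := by
    intro j w; simp [powKernel]
  simp_rw [hker] at h1
  refine h1.trans ?_
  rw [ENNReal.ofReal_mul hC1.le, mul_assoc]
  refine mul_le_mul' le_rfl ?_
  rw [← lintegral_const_mul' _ _ ENNReal.ofReal_ne_top]
  refine lintegral_mono_ae ?_
  filter_upwards [ae_mem_polydisc n, ae_forall_ne_zero n] with y hy hy0
  rw [mul_left_comm, prodWeight, ENNReal.ofReal_prod_of_nonneg fun j _ => (hK j).le,
    ← Finset.prod_mul_distrib]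
  gcongr with j _
  rw [← ENNReal.ofReal_mul (hK j).le]
  refine ENNReal.ofReal_le_ofReal ?_
  have hδ := one_sub_norm_mem_Ioo (hy j) (hy0 j)
  have hδ0 := hδ.1
  rw [zeroExt_of_mem hδ, ← Real.rpow_mul hδ.1.le, ← Real.rpow_add hδ.1,
    show α j * p + (2 * p - 2) = p * (α j + 2) + -2 by ring, Real.rpow_add hδ.1, ← mul_assoc]
  gcongr
  exact HK j _ hδ

theorem ae_enorm_le_linftyNorm {n : ℕ} (g : (Fin n → ℂ) → ℂ) :
    ∀ᵐ ζ ∂polydiscMeasure n, ‖g ζ‖ₑ ≤ linftyNorm g := by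
  rw [linftyNorm, restrict_polydisc, eLpNorm_exponent_top]
  exact enorm_ae_le_eLpNormEssSup g _

theorem enorm_hankelDensity_le {n : ℕ} (α : Fin n → ℝ) {g f φ : (Fin n → ℂ) → ℂ}
    (hfφ : ∀ z ∈ polydisc n, ‖f z‖ = ‖φ z‖) :
    ∀ᵐ ζ ∂polydiscMeasure n, ‖hankelDensity α g f ζ‖ₑ ≤
      ENNReal.ofReal (∏ j, 2 ^ |α j|) * linftyNorm g *
        (‖φ ζ‖ₑ * ∏ j, ENNReal.ofReal ((1 - ‖ζ j‖) ^ α j)) := by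
  filter_upwards [ae_mem_polydisc n, ae_enorm_le_linftyNorm g] with ζ hζ hg
  have h1 : ‖f ζ‖ₑ = ‖φ ζ‖ₑ := by rw [← ofReal_norm, hfφ ζ hζ, ofReal_norm]
  have h2 : ‖hankelDensity α g f ζ‖ₑ =
      (∏ j, ENNReal.ofReal ((1 - ‖ζ j‖ ^ 2) ^ α j)) * ‖φ ζ‖ₑ * ‖g ζ‖ₑ := by
    rw [hankelDensity, RCLike.enorm_conj, enorm_mul, enorm_mul, h1, ← Complex.ofReal_prod,
      ← ofReal_norm (Complex.ofReal _), Complex.norm_real, Real.norm_of_nonneg,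
      ENNReal.ofReal_prod_of_nonneg]
    all_goals
      have h3 : ∀ j, 0 ≤ (1 - ‖ζ j‖ ^ 2) ^ α j := fun j => by
        have h4 : ‖ζ j‖ < 1 := hζ j
        have : 0 ≤ 1 - ‖ζ j‖ ^ 2 := by nlinarith [norm_nonneg (ζ j)]
        positivity
    · exact fun j _ => h3 j
    · exact Finset.prod_nonneg fun j _ => h3 j
  rw [h2]
  calc _ ≤ (∏ j, (ENNReal.ofReal (2 ^ |α j|) * ENNReal.ofReal ((1 - ‖ζ j‖) ^ α j))) * ‖φ ζ‖ₑ *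
        linftyNorm g := by
        gcongr with j _
        rw [← ENNReal.ofReal_mul (by positivity)]
        exact ENNReal.ofReal_le_ofReal
          (rpow_one_sub_sq_le_two_rpow_abs_mul (norm_nonneg _) (hζ j))
    _ = _ := by
        rw [Finset.prod_mul_distrib, ENNReal.ofReal_prod_of_nonneg fun j _ => by positivity]
        ring

/-- Sufficiency, with the norm estimate. The argument of the operator is a function `f` with
`|f| = |φ|`, where `φ ∈ B_p(ω)`; this covers both `f = φ` and `f = φ̄`. -/
theorem exists_hankel_bound {n : ℕ} {p : ℝ} (hp0 : 0 < p) (hp1 : p < 1)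
    {ω : Fin n → ℝ → ℝ} (hω : ∀ j, RegularWeight (ω j)) (hβ : ∀ j, betaIndex (ω j) < -1)
    {α : Fin n → ℝ} (hα : ∀ j, -1 < α j) (h : ∀ j, alphaIndex (ω j) / p - 2 < α j) :
    ∃ C : ℝ≥0, ∀ f φ g : (Fin n → ℂ) → ℂ, (∀ z ∈ polydisc n, ‖f z‖ = ‖φ z‖) →
      AEStronglyMeasurable f (polydiscMeasure n) → MemBesov p ω φ → MemLinfty g →
      HankelDefined α g f ∧ MemConjBesov p ω (hankel α g f) ∧
        besovNorm p ω (conjFun (hankel α g f)) ≤ C * linftyNorm g * besovNorm p ω φ := by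
  have hex : ∀ j, ∃ A, alphaIndex (ω j) < A ∧ A < p * (α j + 2) := fun j => by
    refine exists_between ?_
    have := h j
    rw [sub_lt_iff_lt_add, div_lt_iff₀ hp0] at this
    linarith
  choose A hA1 hA2 using hex
  choose s c C hs hg using fun j => (hω j).exists_growth (hβ j) (hA1 j)
  have hm : ∀ j, Measurable (zeroExt (ω j)) := fun j => (hω j).measurable_zeroExt
  -- a reproducing kernel of sufficiently high order
  obtain ⟨β, hβ0, hβA⟩ : ∃ β : ℝ, 0 < β ∧ ∀ j, A j < p * (β + 1) := by
    refine ⟨∑ j, |A j| / p + 1, by positivity, fun j => ?_⟩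
    have h1 := Finset.single_le_sum (f := fun j => |A j| / p)
      (fun i _ => by positivity) (Finset.mem_univ j)
    have h2 : |A j| = p * (|A j| / p) := by field_simp
    have h3 := mul_le_mul_of_nonneg_left h1 hp0.le
    have := le_abs_self (A j)
    nlinarith
  obtain ⟨C0, hC0, H0⟩ := exists_enorm_le_lintegral_besovD n hβ0
  obtain ⟨K1, hK1, H1⟩ := exists_schur_bound hp0 hp1 hg hm (a := fun _ => β)
    (e := fun _ => β + 1) (τ := fun _ => -2) (fun _ => by linarith)
    (fun j => by linarith [hs j]) (fun j => by linarith [hβA j])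
  obtain ⟨K2, hK2, H2⟩ := exists_schur_bound hp0 hp1 hg hm (a := α)
    (e := fun j => α j + 3) (τ := fun _ => p - 2) (fun j => by linarith [hα j])
    (fun j => by linarith [hs j]) (fun j => by linarith [hA2 j])
  obtain ⟨K3, hK3, H3⟩ := exists_lintegral_rpow_le_prodWeight hp0 hp1 hg
    (fun j => by linarith [hs j]) (fun j => (hA2 j).le)
  -- the constant in the pointwise bound for the kernel of `D` of the conjugate Hankel operator
  obtain ⟨Q, hQ0, hQ⟩ : ∃ Q : ℝ, 0 < Q ∧ Q = (∏ j, 2 ^ |α j|) * ∏ j, (α j + 4) :=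
    ⟨_, mul_pos (Finset.prod_pos fun j _ => by positivity)
      (Finset.prod_pos fun j _ => by linarith [hα j]), rfl⟩
  obtain ⟨L, hL⟩ : ∃ L : ℝ≥0∞, L = ENNReal.ofReal K2 * ENNReal.ofReal Q ^ p *
      (ENNReal.ofReal K1 * ENNReal.ofReal (C0 ^ n) ^ p * ENNReal.ofReal ((2 ^ (2 - p)) ^ n)) :=
    ⟨_, rfl⟩
  have hLtop : L ≠ ∞ := by
    rw [hL]
    have h1 : ∀ x : ℝ, ENNReal.ofReal x ^ p ≠ ∞ := fun x =>
      ENNReal.rpow_ne_top_of_nonneg hp0.le ENNReal.ofReal_ne_top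
    exact ENNReal.mul_ne_top (ENNReal.mul_ne_top ENNReal.ofReal_ne_top (h1 _))
      (ENNReal.mul_ne_top (ENNReal.mul_ne_top ENNReal.ofReal_ne_top (h1 _)) ENNReal.ofReal_ne_top)
  refine ⟨(L ^ (1 / p)).toNNReal, fun f φ g hfφ hf hφ hgm => ?_⟩
  have hφs := hφ.1.sepHolomorphic
  have hgtop : linftyNorm g ≠ ∞ := hgm.2.ne
  -- the weighted norm of `φ` is controlled by that of `D φ`
  have step1 : ∫⁻ y, ‖φ y‖ₑ ^ p * prodWeight ω (fun _ => -2) y ∂polydiscMeasure n ≤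
      (ENNReal.ofReal K1 * ENNReal.ofReal (C0 ^ n) ^ p * ENNReal.ofReal ((2 ^ (2 - p)) ^ n)) *
        besovPow p ω φ := by
    have := H1 (besovD φ) (ENNReal.ofReal (C0 ^ n)) (fun z => ‖φ z‖ₑ) hφs.besovD (H0 φ hφs)
    refine this.trans ?_
    rw [mul_assoc _ (ENNReal.ofReal ((2 ^ (2 - p)) ^ n))]
    refine mul_le_mul' le_rfl ?_
    refine le_trans (le_of_eq ?_) (besovPow_le_lintegral hp0 hp1 hω φ).2
    refine lintegral_congr fun y => ?_
    congr 3
    funext j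
    ring
  have hfin : ∫⁻ y, ‖φ y‖ₑ * ∏ j, ENNReal.ofReal ((1 - ‖y j‖) ^ α j) ∂polydiscMeasure n < ∞ := by
    have h1 := H3 φ hφs
    have h2 : (∫⁻ y, ‖φ y‖ₑ * ∏ j, ENNReal.ofReal ((1 - ‖y j‖) ^ α j) ∂polydiscMeasure n) ^ p
        < ∞ := by
      refine h1.trans_lt (ENNReal.mul_lt_top ENNReal.ofReal_lt_top (step1.trans_lt ?_))
      refine ENNReal.mul_lt_top (ENNReal.mul_lt_top (ENNReal.mul_lt_top ENNReal.ofReal_lt_top ?_)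
        ENNReal.ofReal_lt_top) hφ.2
      exact ENNReal.rpow_lt_top_of_nonneg hp0.le ENNReal.ofReal_ne_top
    by_contra hcon
    rw [not_lt, top_le_iff] at hcon
    rw [hcon, ENNReal.top_rpow_of_pos hp0] at h2
    exact lt_irrefl _ h2
  have hint : Integrable (hankelDensity α g f) (polydiscMeasure n) := by
    refine ⟨?_, ?_⟩
    · have hgm' : AEStronglyMeasurable g (polydiscMeasure n) := by
        have := hgm.1
        rwa [restrict_polydisc] at this
      have hw : Measurable fun ζ : Fin n → ℂ => ∏ j, (((1 - ‖ζ j‖ ^ 2) ^ (α j) : ℝ) : ℂ) :=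
        Finset.measurable_prod _ fun j _ => by fun_prop
      exact Complex.continuous_conj.comp_aestronglyMeasurable
        ((hw.aestronglyMeasurable.mul hf).mul hgm')
    · refine (lintegral_mono_ae (enorm_hankelDensity_le α hfφ)).trans_lt ?_
      rw [lintegral_const_mul' _ _ (ENNReal.mul_ne_top ENNReal.ofReal_ne_top hgtop)]
      exact ENNReal.mul_lt_top (ENNReal.mul_lt_top ENNReal.ofReal_lt_top hgtop.lt_top) hfin
  have step2 : ∀ z ∈ polydisc n, ‖besovD (conjFun (hankel α g f)) z‖ₑ ≤
      (ENNReal.ofReal Q * linftyNorm g) * ∫⁻ y, ‖φ y‖ₑ *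
        ∏ j, ENNReal.ofReal (powKernel (α j) (α j + 3) (z j) (y j)) ∂polydiscMeasure n := by
    intro z hz
    rw [besovD_conjFun_hankel hα hint hz,
      ← lintegral_const_mul' _ _ (ENNReal.mul_ne_top ENNReal.ofReal_ne_top hgtop)]
    refine (enorm_integral_le_lintegral_enorm _).trans (lintegral_mono_ae ?_)
    filter_upwards [ae_mem_polydisc n, enorm_hankelDensity_le α hfφ] with ζ hζ h1
    rw [enorm_mul]
    have h2 : ‖∏ j, cpowKernelD (α j + 2) (z j) (ζ j)‖ₑ ≤ ENNReal.ofReal (∏ j, (α j + 4)) *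
        ∏ j, ENNReal.ofReal (‖1 - ζ j * (starRingEnd ℂ) (z j)‖ ^ (-(α j + 3))) := by
      rw [← ofReal_norm, norm_prod, ENNReal.ofReal_prod_of_nonneg fun j _ => norm_nonneg _,
        ENNReal.ofReal_prod_of_nonneg fun j _ => by linarith [hα j], ← Finset.prod_mul_distrib]
      refine Finset.prod_le_prod' fun j _ => ?_
      rw [← ENNReal.ofReal_mul (by linarith [hα j])]
      refine ENNReal.ofReal_le_ofReal ?_
      have := norm_cpowKernel_add_le (a := α j + 2) (by linarith [hα j])
        (mem_ball_of_mem_polydisc hz j) (mem_ball_of_mem_polydisc hζ j)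
      rwa [show α j + 2 + 2 = α j + 4 by ring, show α j + 2 + 1 = α j + 3 by ring] at this
    refine (mul_le_mul' h1 h2).trans (le_of_eq ?_)
    have h3 : ∀ j, ENNReal.ofReal (powKernel (α j) (α j + 3) (z j) (ζ j)) =
        ENNReal.ofReal ((1 - ‖ζ j‖) ^ α j) *
          ENNReal.ofReal (‖1 - ζ j * (starRingEnd ℂ) (z j)‖ ^ (-(α j + 3))) := fun j => by
      have h4 : ‖ζ j‖ < 1 := hζ j
      have h5 : 0 ≤ 1 - ‖ζ j‖ := by linarith
      rw [powKernel, ENNReal.ofReal_mul (by positivity)]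
    simp_rw [h3]
    rw [Finset.prod_mul_distrib, hQ, ENNReal.ofReal_mul (Finset.prod_nonneg fun j _ => by
      positivity)]
    ring
  have step3 : besovPow p ω (conjFun (hankel α g f)) ≤
      L * linftyNorm g ^ p * besovPow p ω φ := by
    refine (besovPow_le_lintegral hp0 hp1 hω _).1.trans ?_
    refine (H2 φ _ _ hφs step2).trans ?_
    rw [ENNReal.mul_rpow_of_nonneg _ _ hp0.le]
    calc _ ≤ ENNReal.ofReal K2 * (ENNReal.ofReal Q ^ p * linftyNorm g ^ p) *
          ((ENNReal.ofReal K1 * ENNReal.ofReal (C0 ^ n) ^ p * ENNReal.ofReal ((2 ^ (2 - p)) ^ n)) *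
            besovPow p ω φ) := by
          refine mul_le_mul' le_rfl (le_trans (le_of_eq ?_) step1)
          refine lintegral_congr fun y => ?_
          congr 3
          funext j
          ring
      _ = _ := by rw [hL]; ring
  refine ⟨(hankelDefined_iff hα g f).2 hint, ⟨differentiableOn_conjFun_hankel hα hint, ?_⟩, ?_⟩
  · refine step3.trans_lt (ENNReal.mul_lt_top (ENNReal.mul_lt_top hLtop.lt_top ?_) hφ.2)
    exact ENNReal.rpow_lt_top_of_nonneg hp0.le hgtop
  · have hp' : 0 ≤ 1 / p := by positivity
    rw [besovNorm, besovNorm, ENNReal.coe_toNNReal (ENNReal.rpow_ne_top_of_nonneg hp' hLtop)]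
    refine (ENNReal.rpow_le_rpow step3 hp').trans (le_of_eq ?_)
    rw [ENNReal.mul_rpow_of_nonneg _ _ hp', ENNReal.mul_rpow_of_nonneg _ _ hp', ← ENNReal.rpow_mul,
      mul_one_div_cancel hp0.ne', ENNReal.rpow_one]

/-! ### Powers and kernels in a nontangential region -/

theorem re_cpow_neg_ge {w : ℂ} {e κ : ℝ} (hre : 0 < w.re) (him : |w.im| ≤ κ * w.re) (he : 0 ≤ e)
    (hκ : 2 * e * κ ≤ 1) : ‖w‖ ^ (-e) / 2 ≤ (w ^ ((-e : ℝ) : ℂ)).re := by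
  have hw : 0 < ‖w‖ := norm_pos_iff.2 fun h => by simp [h] at hre
  have h1 := Real.mul_abs_le_abs_sin (Complex.abs_arg_le_pi_div_two_iff.2 hre.le)
  rw [Complex.sin_arg, abs_div, abs_of_pos hw] at h1
  have hκ0 : 0 ≤ κ := by
    by_contra h
    have := mul_neg_of_neg_of_pos (not_le.1 h) hre
    linarith [abs_nonneg w.im]
  have h2 : |w.im| / ‖w‖ ≤ κ := by
    rw [div_le_iff₀ hw]
    exact him.trans (mul_le_mul_of_nonneg_left (Complex.re_le_norm w) hκ0)
  have h3 : |w.arg| ≤ 2 * κ := by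
    have hpi := Real.pi_pos
    have hpi4 := Real.pi_le_four
    have h4 := h1.trans h2
    rw [div_mul_eq_mul_div, div_le_iff₀ hpi] at h4
    nlinarith [mul_le_mul_of_nonneg_left hpi4 hκ0]
  have h5 : |w.arg * -e| ≤ 1 := by
    rw [abs_mul, abs_neg, abs_of_nonneg he]
    nlinarith [mul_le_mul_of_nonneg_right h3 he]
  have h6 : 1 / 2 ≤ Real.cos (w.arg * -e) := by
    have h7 := Real.one_sub_sq_div_two_le_cos (x := w.arg * -e)
    have h8 : (w.arg * -e) ^ 2 ≤ 1 := by rw [← sq_abs]; nlinarith [abs_nonneg (w.arg * -e)]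
    linarith
  rw [Complex.cpow_ofReal_re]
  have : 0 < ‖w‖ ^ (-e) := by positivity
  nlinarith

/-- A nontangential approach region at the point `1`, with aperture `κ`. -/
def stolz (κ : ℝ) : Set ℂ := {ζ | |ζ.im| ≤ κ * (1 - ζ.re) ∧ 1 - ζ.re ≤ 1 / 32}

theorem measurableSet_stolz (κ : ℝ) : MeasurableSet (stolz κ) := by
  have h1 : IsClosed {ζ : ℂ | |ζ.im| ≤ κ * (1 - ζ.re)} := isClosed_le (by fun_prop) (by fun_prop)
  have h2 : IsClosed {ζ : ℂ | 1 - ζ.re ≤ 1 / 32} := isClosed_le (by fun_prop) continuous_const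
  exact (h1.inter h2).measurableSet

theorem re_lt_one_of_mem_ball {z : ℂ} (hz : z ∈ Metric.ball (0 : ℂ) 1) : z.re < 1 := by
  rw [mem_ball_zero_iff] at hz
  exact (Complex.re_le_norm z).trans_lt hz

theorem norm_one_sub_le_of_mem_stolz {κ : ℝ} (hκ1 : κ ≤ 1) {ζ : ℂ}
    (hζ : ζ ∈ stolz κ) (hζ1 : ζ.re < 1) : ‖1 - ζ‖ ≤ 1 / 16 := by
  obtain ⟨h1, h2⟩ := hζ
  have h3 := Complex.norm_le_abs_re_add_abs_im (1 - ζ)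
  simp only [Complex.sub_re, Complex.one_re, Complex.sub_im, Complex.one_im, zero_sub,
    abs_neg] at h3
  have h0 : 0 ≤ 1 - ζ.re := by linarith
  rw [abs_of_nonneg h0] at h3
  nlinarith

theorem one_sub_conj_mul_sector {κ : ℝ} (hκ0 : 0 ≤ κ) (hκ1 : κ ≤ 1) {z ζ : ℂ}
    (hz : z ∈ stolz κ) (hz1 : z.re < 1) (hζ : ζ ∈ stolz κ) (hζ1 : ζ.re < 1) :
    0 < (1 - (starRingEnd ℂ) ζ * z).re ∧
      |(1 - (starRingEnd ℂ) ζ * z).im| ≤ 2 * κ * (1 - (starRingEnd ℂ) ζ * z).re := by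
  obtain ⟨h1, h2⟩ := hz
  obtain ⟨h3, h4⟩ := hζ
  have hre : (1 - (starRingEnd ℂ) ζ * z).re = 1 - (ζ.re * z.re + ζ.im * z.im) := by
    simp
  have him : (1 - (starRingEnd ℂ) ζ * z).im = ζ.im * z.re - ζ.re * z.im := by
    simp; ring
  obtain ⟨u, hu⟩ : ∃ u, u = 1 - ζ.re := ⟨_, rfl⟩
  obtain ⟨v, hv⟩ : ∃ v, v = 1 - z.re := ⟨_, rfl⟩
  have hu0 : 0 < u := by linarith
  have hv0 : 0 < v := by linarith
  have hζr : ζ.re = 1 - u := by linarith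
  have hzr : z.re = 1 - v := by linarith
  rw [← hu] at h3 h4
  rw [← hv] at h1 h2
  have hprod : ζ.im * z.im ≤ u * v := by
    calc ζ.im * z.im ≤ |ζ.im| * |z.im| := by rw [← abs_mul]; exact le_abs_self _
      _ ≤ (1 * u) * (1 * v) := by
        refine mul_le_mul (h3.trans ?_) (h1.trans ?_) (abs_nonneg _) (by positivity) <;> gcongr
      _ = _ := by ring
  have hrelow : (u + v) / 2 ≤ (1 - (starRingEnd ℂ) ζ * z).re := by
    rw [hre, hζr, hzr]
    nlinarith
  refine ⟨by linarith, ?_⟩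
  have hη : |(1 - (starRingEnd ℂ) ζ * z).im| ≤ κ * (u + v) := by
    rw [him]
    refine (abs_sub _ _).trans ?_
    rw [abs_mul, abs_mul, hζr, hzr, abs_of_nonneg (show 0 ≤ 1 - v by linarith),
      abs_of_nonneg (show 0 ≤ 1 - u by linarith)]
    nlinarith [abs_nonneg ζ.im, abs_nonneg z.im]
  nlinarith

theorem norm_one_sub_conj_mul_le {z ζ : ℂ} (hζ : ‖ζ‖ ≤ 1) :
    ‖1 - (starRingEnd ℂ) ζ * z‖ ≤ ‖1 - ζ‖ + ‖1 - z‖ := by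
  have h : 1 - (starRingEnd ℂ) ζ * z =
      (starRingEnd ℂ) (1 - ζ) + (starRingEnd ℂ) ζ * (1 - z) := by
    rw [map_sub, map_one]; ring
  rw [h]
  refine (norm_add_le _ _).trans ?_
  rw [Complex.norm_conj, norm_mul, Complex.norm_conj]
  nlinarith [norm_nonneg (1 - z)]

/-- In a narrow nontangential region the real part of the kernel of `D h` is comparable to its
modulus. -/
theorem re_cpowKernelD_ge {a κ : ℝ} (ha : 1 ≤ a) (hκ0 : 0 ≤ κ) (hκ1 : κ ≤ 1)
    (hκa : 4 * (a + 1) * κ ≤ 1) {z ζ : ℂ} (hz : z ∈ Metric.ball (0 : ℂ) 1)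
    (hζ : ζ ∈ Metric.ball (0 : ℂ) 1) (hzs : z ∈ stolz κ) (hζs : ζ ∈ stolz κ) :
    ‖1 - (starRingEnd ℂ) ζ * z‖ ^ (-(a + 1)) / 4 ≤ (cpowKernelD a z ζ).re := by
  obtain ⟨hre, him⟩ := one_sub_conj_mul_sector hκ0 hκ1 hzs (re_lt_one_of_mem_ball hz) hζs
    (re_lt_one_of_mem_ball hζ)
  have hζ1 := (mem_ball_zero_iff.1 hζ).le
  have hnorm := (norm_one_sub_conj_mul_le (z := z) hζ1).trans
    (add_le_add (norm_one_sub_le_of_mem_stolz hκ1 hζs (re_lt_one_of_mem_ball hζ))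
      (norm_one_sub_le_of_mem_stolz hκ1 hzs (re_lt_one_of_mem_ball hz)))
  have hsec := re_cpow_neg_ge (e := a + 1) hre him (by linarith) (by linarith)
  have hsplit : cpowKernelD a z ζ =
      a * (1 - (starRingEnd ℂ) ζ * z) ^ ((-(a + 1) : ℝ) : ℂ) -
        (a - 1 : ℝ) * (1 - (starRingEnd ℂ) ζ * z) ^ ((-a : ℝ) : ℂ) := by
    have hw : 1 - (starRingEnd ℂ) ζ * z ≠ 0 := fun h => by simp [h] at hre
    have : (1 - (starRingEnd ℂ) ζ * z) ^ ((-a : ℝ) : ℂ) = (1 - (starRingEnd ℂ) ζ * z) *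
        (1 - (starRingEnd ℂ) ζ * z) ^ ((-(a + 1) : ℝ) : ℂ) := by
      rw [show ((-a : ℝ) : ℂ) = 1 + ((-(a + 1) : ℝ) : ℂ) by push_cast; ring,
        Complex.cpow_add _ _ hw, Complex.cpow_one]
    rw [cpowKernelD, cpowKernel, cpowKernel', this]
    push_cast
    ring
  obtain ⟨w, hw⟩ : ∃ w, w = 1 - (starRingEnd ℂ) ζ * z := ⟨_, rfl⟩
  rw [← hw] at hre hnorm hsec hsplit ⊢
  have hw0 : 0 < ‖w‖ := norm_pos_iff.2 fun h => by simp [h] at hre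
  have h1 : (w ^ ((-a : ℝ) : ℂ)).re ≤ ‖w‖ * ‖w‖ ^ (-(a + 1)) := by
    refine (Complex.re_le_norm _).trans (le_of_eq ?_)
    rw [Complex.norm_cpow_real]
    calc ‖w‖ ^ (-a) = ‖w‖ ^ (1 + -(a + 1)) := by congr 1; ring
      _ = _ := by rw [Real.rpow_add hw0, Real.rpow_one]
  have hp : 0 < ‖w‖ ^ (-(a + 1)) := by positivity
  rw [hsplit, Complex.sub_re, Complex.re_ofReal_mul, Complex.re_ofReal_mul]
  have h2 : ‖w‖ * ‖w‖ ^ (-(a + 1)) ≤ 1 / 8 * ‖w‖ ^ (-(a + 1)) := by gcongr; linarith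
  have h3 : (a - 1) * (w ^ ((-a : ℝ) : ℂ)).re ≤ (a - 1) * (1 / 8 * ‖w‖ ^ (-(a + 1))) :=
    mul_le_mul_of_nonneg_left (h1.trans h2) (by linarith)
  have h4 := mul_le_mul_of_nonneg_left hsec (by linarith : (0 : ℝ) ≤ a)
  nlinarith

/-! ### Dyadic discs in the nontangential region -/

/-- The dyadic distances `2^{-l-6}` to the boundary point `1`; the shift by `6` keeps all discs
`dyadBall κ l` inside the nontangential region `stolz κ`. -/
noncomputable def dyad (l : ℕ) : ℝ := (1 / 2) ^ (l + 6)

theorem dyad_pos (l : ℕ) : 0 < dyad l := by unfold dyad; positivity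

theorem dyad_anti {l k : ℕ} (h : l ≤ k) : dyad k ≤ dyad l := by
  unfold dyad
  exact pow_le_pow_of_le_one (by norm_num) (by norm_num) (by omega)

theorem dyad_le (l : ℕ) : dyad l ≤ 1 / 64 := by
  refine (dyad_anti (Nat.zero_le l)).trans (le_of_eq ?_)
  norm_num [dyad]

theorem dyad_succ_le {l k : ℕ} (h : l < k) : 2 * dyad k ≤ dyad l := by
  have h1 := dyad_anti (Nat.succ_le_of_lt h)
  have h2 : dyad (l + 1) = dyad l / 2 := by unfold dyad; ring
  rw [Nat.succ_eq_add_one, h2] at h1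
  linarith

theorem dyad_mem_Ioo (l : ℕ) : dyad l ∈ Set.Ioo (0 : ℝ) 1 :=
  ⟨dyad_pos l, by linarith [dyad_le l]⟩

/-- A disc of radius comparable to its distance `dyad l` from the point `1`. -/
noncomputable def dyadBall (κ : ℝ) (l : ℕ) : Set ℂ :=
  Metric.ball ((1 - dyad l : ℝ) : ℂ) (κ * dyad l / 4)

theorem dyadBall_bounds {κ : ℝ} (hκ1 : κ ≤ 1) {l : ℕ} {ζ : ℂ}
    (hζ : ζ ∈ dyadBall κ l) : 3 / 4 * dyad l ≤ 1 - ‖ζ‖ ∧ 1 - ‖ζ‖ ≤ 5 / 4 * dyad l ∧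
      3 / 4 * dyad l ≤ ‖1 - ζ‖ ∧ ‖1 - ζ‖ ≤ 5 / 4 * dyad l := by
  have hd := dyad_pos l
  have hd1 := dyad_le l
  rw [dyadBall, mem_ball_iff_norm] at hζ
  have h1 : ‖((1 - dyad l : ℝ) : ℂ)‖ = 1 - dyad l := by
    rw [Complex.norm_real, Real.norm_of_nonneg (by linarith)]
  have h2 := abs_norm_sub_norm_le ζ ((1 - dyad l : ℝ) : ℂ)
  rw [h1] at h2
  have h3 : κ * dyad l / 4 ≤ dyad l / 4 := by nlinarith
  have h4 := abs_le.1 (h2.trans (hζ.le.trans h3))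
  have h5 : ‖((dyad l : ℝ) : ℂ)‖ = dyad l := by
    rw [Complex.norm_real, Real.norm_of_nonneg hd.le]
  have h6 := abs_norm_sub_norm_le (1 - ζ) ((dyad l : ℝ) : ℂ)
  have h7 : 1 - ζ - ((dyad l : ℝ) : ℂ) = -(ζ - ((1 - dyad l : ℝ) : ℂ)) := by push_cast; ring
  rw [h5, h7, norm_neg] at h6
  have h8 := abs_le.1 (h6.trans (hζ.le.trans h3))
  exact ⟨by linarith, by linarith, by linarith, by linarith⟩

theorem dyadBall_subset_stolz {κ : ℝ} (hκ0 : 0 ≤ κ) (hκ1 : κ ≤ 1) (l : ℕ) :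
    dyadBall κ l ⊆ stolz κ := by
  intro ζ hζ
  have hd := dyad_pos l
  have hd1 := dyad_le l
  have h3 : κ * dyad l / 4 ≤ dyad l / 4 := by nlinarith
  rw [dyadBall, mem_ball_iff_norm] at hζ
  have h1 := (Complex.abs_im_le_norm _).trans hζ.le
  have h2 := abs_le.1 ((Complex.abs_re_le_norm _).trans (hζ.le.trans h3))
  simp only [Complex.sub_im, Complex.sub_re, Complex.ofReal_im, Complex.ofReal_re,
    sub_zero] at h1 h2
  refine ⟨?_, by linarith⟩
  have : κ * (3 / 4 * dyad l) ≤ κ * (1 - ζ.re) := mul_le_mul_of_nonneg_left (by linarith) hκ0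
  nlinarith [mul_nonneg hκ0 hd.le]

theorem dyadBall_subset_ball {κ : ℝ} (hκ1 : κ ≤ 1) (l : ℕ) :
    dyadBall κ l ⊆ Metric.ball (0 : ℂ) 1 := by
  intro ζ hζ
  rw [mem_ball_zero_iff]
  linarith [(dyadBall_bounds hκ1 hζ).1, dyad_pos l]

theorem pairwise_disjoint_dyadBall {κ : ℝ} (hκ1 : κ ≤ 1) :
    Pairwise fun l k => Disjoint (dyadBall κ l) (dyadBall κ k) := by
  have key : ∀ l k : ℕ, l < k → Disjoint (dyadBall κ l) (dyadBall κ k) := by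
    intro l k hlk
    rw [Set.disjoint_left]
    intro ζ h1 h2
    have h3 := (dyadBall_bounds hκ1 h1).2.2.1
    have h4 := (dyadBall_bounds hκ1 h2).2.2.2
    linarith [dyad_succ_le hlk, dyad_pos k]
  intro l k hlk
  rcases lt_or_gt_of_ne hlk with h | h
  · exact key l k h
  · exact (key k l h).symm

theorem discMeasure_dyadBall {κ : ℝ} (hκ0 : 0 ≤ κ) (hκ1 : κ ≤ 1) (l : ℕ) :
    discMeasure (dyadBall κ l) = ENNReal.ofReal (Real.pi * (κ / 4) ^ 2 * dyad l ^ (2 : ℝ)) := by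
  rw [discMeasure, Measure.restrict_apply' Metric.isOpen_ball.measurableSet,
    Set.inter_eq_left.2 (dyadBall_subset_ball hκ1 l), dyadBall, Complex.volume_ball]
  have hd := dyad_pos l
  rw [← ENNReal.ofReal_pow (by positivity), Real.rpow_two]
  have : (NNReal.pi : ℝ≥0∞) = ENNReal.ofReal Real.pi := by
    rw [ENNReal.ofReal, ← NNReal.coe_real_pi, Real.toNNReal_coe]
  rw [this, ← ENNReal.ofReal_mul (by positivity)]
  congr 1
  ring

theorem WeightGrowth.exists_le_of_mul_le {ω : ℝ → ℝ} {s A c C : ℝ} (h : WeightGrowth ω s A c C)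
    (hs : 0 ≤ s) {θ : ℝ} (hθ : 0 < θ) :
    ∃ K > 0, ∀ r ∈ Set.Ioo (0 : ℝ) 1, ∀ x ∈ Set.Ioo (0 : ℝ) 1, θ * r ≤ x → K * ω r ≤ ω x := by
  have hA0 : 0 ≤ A := hs.trans h.exponent_le
  have hc := h.c_pos
  have hC := h.C_pos
  refine ⟨min (c * θ ^ A) C⁻¹, by positivity, fun r hr x hx hrx => ?_⟩
  have hr0 := hr.1
  have hx0 := hx.1
  have hωr := h.pos r hr
  have hωx := h.pos x hx
  rcases le_total x r with hxr | hxr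
  · have h1 := h.lower r hr (x / r) ⟨by positivity, (div_le_one hr0).2 hxr⟩
    rw [div_mul_cancel₀ _ hr0.ne'] at h1
    refine le_trans ?_ h1
    calc _ ≤ c * θ ^ A * ω r := by gcongr; exact min_le_left _ _
      _ ≤ _ := by gcongr; rwa [le_div_iff₀ hr0]
  · have h1 := h.upper x hx (r / x) ⟨by positivity, (div_le_one hx0).2 hxr⟩
    rw [div_mul_cancel₀ _ hx0.ne'] at h1
    have h2 : (r / x) ^ s ≤ 1 := Real.rpow_le_one (by positivity) ((div_le_one hx0).2 hxr) hs
    calc _ ≤ C⁻¹ * ω r := by gcongr; exact min_le_right _ _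
      _ ≤ C⁻¹ * (C * 1 * ω x) := by
        gcongr
        exact h1.trans (by gcongr)
      _ = ω x := by field_simp

/-! ### Lower bounds without cancellation -/

/-- The one-variable factor of `D` applied to the conjugate Hankel operator, for the density
`(1 - |ζ|²)^α h(ζ)`. -/
noncomputable def discHankel (α : ℝ) (h : ℂ → ℝ) (z : ℂ) : ℂ :=
  ∫ ζ, (((1 - ‖ζ‖ ^ 2) ^ α * h ζ : ℝ) : ℂ) * cpowKernelD (α + 2) z ζ ∂discMeasure

theorem ae_mem_ball_discMeasure : ∀ᵐ ζ ∂discMeasure, ζ ∈ Metric.ball (0 : ℂ) 1 :=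
  ae_restrict_mem measurableSet_ball

theorem integrable_mul_cpowKernelD {α : ℝ} (hα : -1 < α) {q : ℂ → ℝ}
    (hq : Integrable q discMeasure) {z : ℂ} (hz : z ∈ Metric.ball (0 : ℂ) 1) :
    Integrable (fun ζ => (q ζ : ℂ) * cpowKernelD (α + 2) z ζ) discMeasure := by
  have hd := discKernel_cpowKernel (a := α + 2) (by linarith)
  rw [mem_ball_zero_iff] at hz
  obtain ⟨B, hB⟩ := hd.bound _ hz
  have hz' : z ∈ Metric.ball (0 : ℂ) 1 := by rwa [mem_ball_zero_iff]
  refine Integrable.mul_bdd (c := B + ‖z‖ * B) hq.ofReal ?_ ?_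
  · refine ContinuousOn.aestronglyMeasurable ?_ measurableSet_ball
    exact (hd.continuousOn z hz').add (continuousOn_const.mul (hd.continuousOn' z hz'))
  · filter_upwards [ae_mem_ball_discMeasure] with ζ hζ
    obtain ⟨h1, h2⟩ := hB z le_rfl ζ hζ
    refine (norm_add_le _ _).trans (add_le_add h1 ?_)
    rw [norm_mul]
    gcongr

/-- If the density is supported in a narrow nontangential region, then the real part of the
integrand is nonnegative there, and the contribution of a single dyadic disc bounds the integral
from below. -/
theorem exists_le_norm_discHankel {α κ : ℝ} (hα : -1 < α) (hκ0 : 0 < κ) (hκ1 : κ ≤ 1)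
    (hκα : 4 * (α + 3) * κ ≤ 1) : ∃ c > 0, ∀ h : ℂ → ℝ, (∀ ζ, 0 ≤ h ζ) →
      (∀ ζ, ζ ∉ stolz κ → h ζ = 0) →
      Integrable (fun ζ => (1 - ‖ζ‖ ^ 2) ^ α * h ζ) discMeasure → ∀ m, 0 ≤ m → ∀ l k, l ≤ k →
      (∀ ζ ∈ dyadBall κ k, m ≤ h ζ) → ∀ z ∈ dyadBall κ l,
        c * m * (dyad k ^ (α + 2) * dyad l ^ (-(α + 3))) ≤ ‖discHankel α h z‖ := by
  have hpi := Real.pi_pos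
  refine ⟨((2 ^ |α|)⁻¹ * (3 / 2) ^ α) * (4 ^ (-(α + 3)) / 4) * (Real.pi * (κ / 4) ^ 2),
    by positivity, fun h hh0 hhs hint m hm l k hlk hmk z hz => ?_⟩
  have hk := dyad_pos k
  have hl := dyad_pos l
  have hzb := dyadBall_subset_ball hκ1 l hz
  have hzs := dyadBall_subset_stolz hκ0.le hκ1 l hz
  have hI := integrable_mul_cpowKernelD hα hint hzb
  obtain ⟨e, he⟩ : ∃ e : ℝ, e = ((2 ^ |α|)⁻¹ * (3 / 2 * dyad k) ^ α * m) *
    ((4 * dyad l) ^ (-(α + 3)) / 4) := ⟨_, rfl⟩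
  have hre : (discHankel α h z).re = ∫ ζ, ((((1 - ‖ζ‖ ^ 2) ^ α * h ζ : ℝ) : ℂ) *
      cpowKernelD (α + 2) z ζ).re ∂discMeasure :=
    (Complex.reCLM.integral_comp_comm hI).symm
  have hle : ∫ ζ, (dyadBall κ k).indicator (fun _ => e) ζ ∂discMeasure ≤
      (discHankel α h z).re := by
    rw [hre]
    refine integral_mono_ae ((integrable_const e).indicator Metric.isOpen_ball.measurableSet)
      (Complex.reCLM.integrable_comp hI) ?_
    filter_upwards [ae_mem_ball_discMeasure] with ζ hζ
    rw [Complex.re_ofReal_mul]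
    have hq0 : 0 ≤ (1 - ‖ζ‖ ^ 2) ^ α := by
      rw [mem_ball_zero_iff] at hζ
      have : 0 ≤ 1 - ‖ζ‖ ^ 2 := by nlinarith [norm_nonneg ζ]
      positivity
    by_cases hζk : ζ ∈ dyadBall κ k
    · rw [Set.indicator_of_mem hζk, he]
      have hζs := dyadBall_subset_stolz hκ0.le hκ1 k hζk
      obtain ⟨b1, b2, -, b4⟩ := dyadBall_bounds hκ1 hζk
      obtain ⟨-, -, -, d4⟩ := dyadBall_bounds hκ1 hz
      have hkl := dyad_anti hlk
      have hker := re_cpowKernelD_ge (a := α + 2) (by linarith) hκ0.le hκ1 (by linarith)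
        hzb hζ hzs hζs
      rw [show α + 2 + 1 = α + 3 by ring] at hker
      have hw := (one_sub_conj_mul_sector hκ0.le hκ1 hzs (re_lt_one_of_mem_ball hzb) hζs
        (re_lt_one_of_mem_ball hζ)).1
      have hw0 : 0 < ‖1 - (starRingEnd ℂ) ζ * z‖ :=
        norm_pos_iff.2 fun h0 => by simp [h0] at hw
      have hwle := norm_one_sub_conj_mul_le (z := z) (mem_ball_zero_iff.1 hζ).le
      have h1 : (4 * dyad l) ^ (-(α + 3)) ≤ ‖1 - (starRingEnd ℂ) ζ * z‖ ^ (-(α + 3)) :=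
        Real.rpow_le_rpow_of_nonpos hw0 (by linarith) (by linarith)
      have h2 : (2 ^ |α|)⁻¹ * (3 / 2 * dyad k) ^ α ≤ (1 - ‖ζ‖ ^ 2) ^ α := by
        rw [inv_mul_le_iff₀ (by positivity)]
        have hn := norm_nonneg ζ
        rw [mem_ball_zero_iff] at hζ
        refine rpow_le_two_rpow_abs_mul (by positivity) ?_ ?_ <;> nlinarith
      refine mul_le_mul (mul_le_mul h2 (hmk ζ hζk) hm hq0) ?_ (by positivity)
        (mul_nonneg hq0 (hh0 ζ))
      linarith
    · rw [Set.indicator_of_notMem hζk]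
      by_cases hζs : ζ ∈ stolz κ
      · have hker := re_cpowKernelD_ge (a := α + 2) (by linarith) hκ0.le hκ1 (by linarith)
          hzb hζ hzs hζs
        refine mul_nonneg (mul_nonneg hq0 (hh0 ζ)) (le_trans ?_ hker)
        positivity
      · simp [hhs ζ hζs]
  refine le_trans (le_of_eq ?_) (hle.trans (Complex.re_le_norm _))
  have hms : MeasurableSet (dyadBall κ k) := Metric.isOpen_ball.measurableSet
  rw [integral_indicator_const _ hms, Measure.real,
    discMeasure_dyadBall hκ0.le hκ1, ENNReal.toReal_ofReal (by positivity), smul_eq_mul, he,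
    Real.mul_rpow (by norm_num) hk.le, Real.mul_rpow (by norm_num) hl.le, Real.rpow_add hk]
  ring

/-- Summation of the lower bound over the dyadic discs of larger size. -/
theorem exists_le_lintegral_discHankel {ω : ℝ → ℝ} {s A c C : ℝ} (hg : WeightGrowth ω s A c C)
    (hs : 0 ≤ s) {p : ℝ} (hp0 : 0 < p) {α κ : ℝ} (hα : -1 < α) (hκ0 : 0 < κ) (hκ1 : κ ≤ 1)
    (hκα : 4 * (α + 3) * κ ≤ 1) : ∃ c > 0, ∀ h : ℂ → ℝ, (∀ ζ, 0 ≤ h ζ) →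
      (∀ ζ, ζ ∉ stolz κ → h ζ = 0) →
      Integrable (fun ζ => (1 - ‖ζ‖ ^ 2) ^ α * h ζ) discMeasure → ∀ m, 0 ≤ m → ∀ k,
      (∀ ζ ∈ dyadBall κ k, m ≤ h ζ) →
      ENNReal.ofReal (c * m ^ p * dyad k ^ (p * (α + 2)) *
          ∑ l ∈ Finset.range (k + 1), ω (dyad l) * dyad l ^ (-(p * (α + 2)))) ≤
        ∫⁻ z, ‖discHankel α h z‖ₑ ^ p *
          ENNReal.ofReal (zeroExt ω (1 - ‖z‖) * (1 - ‖z‖) ^ (p - 2)) ∂discMeasure := by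
  obtain ⟨c1, hc1, H1⟩ := exists_le_norm_discHankel hα hκ0 hκ1 hκα
  obtain ⟨K, hK, HK⟩ := hg.exists_le_of_mul_le hs (θ := 3 / 4) (by norm_num)
  have hpi := Real.pi_pos
  refine ⟨c1 ^ p * K * (2 ^ |p - 2|)⁻¹ * (Real.pi * (κ / 4) ^ 2), by positivity,
    fun h hh0 hhs hint m hm k hmk => ?_⟩
  have hk := dyad_pos k
  have hterm : ∀ l ∈ Finset.range (k + 1),
      ENNReal.ofReal ((c1 * m * (dyad k ^ (α + 2) * dyad l ^ (-(α + 3)))) ^ p *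
        (K * ω (dyad l) * ((2 ^ |p - 2|)⁻¹ * dyad l ^ (p - 2))) *
          (Real.pi * (κ / 4) ^ 2 * dyad l ^ (2 : ℝ))) ≤
      ∫⁻ z in dyadBall κ l, ‖discHankel α h z‖ₑ ^ p *
          ENNReal.ofReal (zeroExt ω (1 - ‖z‖) * (1 - ‖z‖) ^ (p - 2)) ∂discMeasure := by
    intro l hl
    have hlk : l ≤ k := Nat.lt_succ_iff.1 (Finset.mem_range.1 hl)
    have hl0 := dyad_pos l
    have hωl := hg.pos _ (dyad_mem_Ioo l)
    rw [ENNReal.ofReal_mul (by positivity), ← discMeasure_dyadBall hκ0.le hκ1 l,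
      ← setLIntegral_const]
    refine setLIntegral_mono' Metric.isOpen_ball.measurableSet fun z hz => ?_
    obtain ⟨b1, b2, -, -⟩ := dyadBall_bounds hκ1 hz
    have hl1 := dyad_le l
    have hx : 1 - ‖z‖ ∈ Set.Ioo (0 : ℝ) 1 := ⟨by linarith, by linarith⟩
    rw [ENNReal.ofReal_mul (by positivity), ← ENNReal.ofReal_rpow_of_nonneg (by positivity) hp0.le,
      zeroExt_of_mem hx, ← ofReal_norm (discHankel α h z)]
    gcongr
    · exact H1 h hh0 hhs hint m hm l k hlk hmk z hz
    · exact (hg.pos _ hx).le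
    · exact HK _ (dyad_mem_Ioo l) _ hx (by linarith)
    · rw [inv_mul_le_iff₀ (by positivity)]
      exact rpow_le_two_rpow_abs_mul hl0 (by linarith) (by linarith)
  calc _ = ∑ l ∈ Finset.range (k + 1),
        ENNReal.ofReal ((c1 * m * (dyad k ^ (α + 2) * dyad l ^ (-(α + 3)))) ^ p *
        (K * ω (dyad l) * ((2 ^ |p - 2|)⁻¹ * dyad l ^ (p - 2))) *
          (Real.pi * (κ / 4) ^ 2 * dyad l ^ (2 : ℝ))) := by
        rw [← ENNReal.ofReal_sum_of_nonneg, Finset.mul_sum]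
        · congr 1
          refine Finset.sum_congr rfl fun l _ => ?_
          have hl0 := dyad_pos l
          rw [Real.mul_rpow (by positivity) (by positivity), Real.mul_rpow hc1.le hm,
            Real.mul_rpow (by positivity) (by positivity), ← Real.rpow_mul hk.le,
            ← Real.rpow_mul hl0.le, mul_comm (α + 2) p]
          rw [show -(p * (α + 2)) = -(α + 3) * p + (p - 2) + 2 by ring, Real.rpow_add hl0,
            Real.rpow_add hl0]
          ring
        · intro l _
          have hl0 := dyad_pos l
          have hωl := hg.pos _ (dyad_mem_Ioo l)
          positivity
    _ ≤ ∑ l ∈ Finset.range (k + 1), ∫⁻ z in dyadBall κ l, ‖discHankel α h z‖ₑ ^ p *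
          ENNReal.ofReal (zeroExt ω (1 - ‖z‖) * (1 - ‖z‖) ^ (p - 2)) ∂discMeasure :=
        Finset.sum_le_sum hterm
    _ = ∫⁻ z in ⋃ l ∈ Finset.range (k + 1), dyadBall κ l, ‖discHankel α h z‖ₑ ^ p *
          ENNReal.ofReal (zeroExt ω (1 - ‖z‖) * (1 - ‖z‖) ^ (p - 2)) ∂discMeasure :=
        (lintegral_biUnion_finset ((pairwise_disjoint_dyadBall hκ1).set_pairwise _)
          (fun l _ => Metric.isOpen_ball.measurableSet) _).symm
    _ ≤ _ := setLIntegral_le_lintegral _ _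

/-! ### Dyadic sums and the lower growth exponent -/

/-- If the partial sums of a positive sequence are dominated by the last term, then the sequence
grows geometrically. -/
theorem exists_geometric_growth {a : ℕ → ℝ} (ha : ∀ k, 0 < a k) {D : ℝ}
    (hD : ∀ k, ∑ l ∈ Finset.range (k + 1), a l ≤ D * a k) :
    ∃ E > 0, ∃ ε > 0, ∀ l k, l ≤ k → a l ≤ E * (1 / 2) ^ (ε * ((k : ℝ) - l)) * a k := by
  -- enlarging `D` makes the ratio `1 - 1/D` positive
  obtain ⟨D', hD'1, hD'⟩ : ∃ D' : ℝ, 1 < D' ∧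
      ∀ k, ∑ l ∈ Finset.range (k + 1), a l ≤ D' * a k := by
    refine ⟨max D 2, lt_of_lt_of_le (by norm_num) (le_max_right _ _), fun k => (hD k).trans ?_⟩
    exact mul_le_mul_of_nonneg_right (le_max_left _ _) (ha k).le
  have hD'0 : 0 < D' := by linarith
  set γ : ℝ := 1 - D'⁻¹ with hγ
  have hinv : D'⁻¹ < 1 := inv_lt_one_of_one_lt₀ hD'1
  have hinv0 : 0 < D'⁻¹ := by positivity
  have hγ0 : 0 < γ := by linarith
  have hγ1 : γ < 1 := by linarith
  set S : ℕ → ℝ := fun k => ∑ l ∈ Finset.range (k + 1), a l with hS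
  have hstep : ∀ k, S k ≤ γ * S (k + 1) := by
    intro k
    have h1 : S (k + 1) = S k + a (k + 1) := Finset.sum_range_succ _ _
    have h2 : D'⁻¹ * S (k + 1) ≤ a (k + 1) := by
      rw [inv_mul_le_iff₀ hD'0]; exact hD' (k + 1)
    rw [hγ, sub_mul, one_mul]
    linarith
  have hgeo : ∀ l i, S l ≤ γ ^ i * S (l + i) := by
    intro l i
    induction i with
    | zero => simp
    | succ i ih =>
      refine ih.trans ?_
      rw [pow_succ, mul_assoc]
      exact mul_le_mul_of_nonneg_left (hstep _) (by positivity)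
  refine ⟨D', hD'0, -Real.logb 2 γ, ?_, fun l k hlk => ?_⟩
  · have := Real.logb_neg (b := 2) (by norm_num) hγ0 hγ1
    simpa using this
  · obtain ⟨i, rfl⟩ := Nat.exists_eq_add_of_le hlk
    have h1 : ((1 : ℝ) / 2) ^ (-Real.logb 2 γ * (((l + i : ℕ) : ℝ) - l)) = γ ^ i := by
      rw [one_div, Real.inv_rpow (by norm_num), ← Real.rpow_neg (by norm_num)]
      push_cast
      rw [show -(-Real.logb 2 γ * ((l : ℝ) + i - l)) = Real.logb 2 γ * i by ring,
        Real.rpow_mul (by norm_num), Real.rpow_logb (by norm_num) (by norm_num) hγ0,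
        Real.rpow_natCast]
    rw [h1]
    calc a l ≤ S l := Finset.single_le_sum (f := a) (fun j _ => (ha j).le)
          (Finset.self_mem_range_succ l)
      _ ≤ γ ^ i * S (l + i) := hgeo l i
      _ ≤ γ ^ i * (D' * a (l + i)) := by gcongr; exact hD' _
      _ = _ := by ring

theorem exists_dyad_near {r : ℝ} (hr : r ∈ Set.Ioo (0 : ℝ) 1) :
    ∃ k, dyad k < r / 32 ∧ r / 64 ≤ dyad k := by
  obtain ⟨k, h1, h2⟩ := exists_nat_pow_near_of_lt_one hr.1 hr.2.le
    (by norm_num : (0 : ℝ) < 1 / 2) (by norm_num)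
  refine ⟨k, ?_, ?_⟩
  · rw [dyad, pow_add]
    rw [pow_add] at h1
    norm_num at h1 ⊢
    linarith
  · rw [dyad, pow_add]
    norm_num at h2 ⊢
    linarith

/-- If the dyadic sums of `ω(t) t^{-b}` are dominated by their last term, then the index `α_ω` is
strictly less than `b`. -/
theorem alphaIndex_lt_of_dyadic_sum_le {ω : ℝ → ℝ} {s A c C b D : ℝ}
    (hg : WeightGrowth ω s A c C) (hs : 0 ≤ s) (hb : 0 < b)
    (hD : ∀ k, ∑ l ∈ Finset.range (k + 1), ω (dyad l) * dyad l ^ (-b) ≤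
      D * (ω (dyad k) * dyad k ^ (-b))) : alphaIndex ω < b := by
  have hpos : ∀ k, 0 < ω (dyad k) * dyad k ^ (-b) := fun k =>
    mul_pos (hg.pos _ (dyad_mem_Ioo k)) (Real.rpow_pos_of_pos (dyad_pos k) _)
  obtain ⟨E, hE, ε, hε, H⟩ := exists_geometric_growth hpos hD
  obtain ⟨K, hK, HK⟩ := hg.exists_le_of_mul_le hs (θ := 1 / 64) (by norm_num)
  have hratio : ∀ l k : ℕ, ((1 : ℝ) / 2) ^ (ε * ((k : ℝ) - l)) = (dyad k / dyad l) ^ ε := by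
    intro l k
    have h1 : ∀ m : ℕ, dyad m = (1 / 2) ^ ((m : ℝ) + 6) := fun m => by
      rw [dyad, ← Real.rpow_natCast]; push_cast; rfl
    rw [h1, h1, ← Real.rpow_sub (by norm_num), ← Real.rpow_mul (by norm_num)]
    congr 1
    ring
  -- the estimate at dyadic points
  have hdy : ∀ l k, l ≤ k → E⁻¹ * (dyad k / dyad l) ^ (b - ε) * ω (dyad l) ≤ ω (dyad k) := by
    intro l k hlk
    have h1 := H l k hlk
    have hk := dyad_pos k
    have hl := dyad_pos l
    rw [hratio] at h1
    rw [mul_assoc, inv_mul_le_iff₀ hE]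
    have h2 : (dyad k / dyad l) ^ (b - ε) * ω (dyad l) =
        (dyad k ^ b * ((dyad k / dyad l) ^ ε)⁻¹) * (ω (dyad l) * dyad l ^ (-b)) := by
      rw [Real.rpow_sub (by positivity), Real.div_rpow hk.le hl.le, Real.rpow_neg hl.le]
      field_simp
    have h3 : E * ω (dyad k) = (dyad k ^ b * ((dyad k / dyad l) ^ ε)⁻¹) *
        (E * (dyad k / dyad l) ^ ε * (ω (dyad k) * dyad k ^ (-b))) := by
      rw [Real.rpow_neg hk.le]
      field_simp
    rw [h2, h3]
    exact mul_le_mul_of_nonneg_left h1 (by positivity)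
  refine alphaIndex_lt_of_lower hg.pos hb (B := b - ε) (by linarith)
    (c := K * (E⁻¹ * (2 ^ |b - ε|)⁻¹) * K) (by positivity) fun r hr x hx => ?_
  have hr0 := hr.1
  have hx0 := hx.1
  have hxr : x * r ∈ Set.Ioo (0 : ℝ) 1 := mul_mem_Ioo_of_mem hx hr
  obtain ⟨l, hl1, hl2⟩ := exists_dyad_near hr
  obtain ⟨k, hk1, hk2⟩ := exists_dyad_near hxr
  have hk := dyad_pos k
  have hl := dyad_pos l
  have hωr := hg.pos r hr
  have hωl := hg.pos _ (dyad_mem_Ioo l)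
  have hxr1 : x * r ≤ r := by nlinarith [hx.2]
  have e1 : K * ω r ≤ ω (dyad l) := HK r hr _ (dyad_mem_Ioo l) (by linarith)
  have e2 : K * ω (dyad k) ≤ ω (x * r) := HK _ (dyad_mem_Ioo k) _ hxr (by linarith)
  have e3 : x ^ (b - ε) ≤ 2 ^ |b - ε| * (dyad k / dyad l) ^ (b - ε) := by
    refine rpow_le_two_rpow_abs_mul hx0 ?_ ?_
    · rw [← mul_div_assoc, le_div_iff₀ hl]; nlinarith
    · rw [div_le_iff₀ hl]; nlinarith
  have hlk : l ≤ k := by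
    by_contra hcon
    linarith [dyad_succ_le (not_le.1 hcon)]
  calc K * (E⁻¹ * (2 ^ |b - ε|)⁻¹) * K * x ^ (b - ε) * ω r
      = K * (E⁻¹ * ((2 ^ |b - ε|)⁻¹ * x ^ (b - ε)) * (K * ω r)) := by ring
    _ ≤ K * (E⁻¹ * (dyad k / dyad l) ^ (b - ε) * ω (dyad l)) := by
        gcongr
        rw [inv_mul_le_iff₀ (by positivity)]
        exact e3
    _ ≤ K * ω (dyad k) := by gcongr; exact hdy l k hlk
    _ ≤ ω (x * r) := e2

/-! ### Lacunary test functions -/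

theorem ENNReal.tsum_rpow_le_tsum_rpow {ι : Type*} {p : ℝ} (hp0 : 0 < p) (hp1 : p ≤ 1)
    (a : ι → ℝ≥0∞) : (∑' i, a i) ^ p ≤ ∑' i, a i ^ p := by
  classical
  rw [← ENNReal.le_rpow_inv_iff hp0, ENNReal.tsum_eq_iSup_sum]
  refine iSup_le fun s => ?_
  rw [ENNReal.le_rpow_inv_iff hp0]
  refine le_trans ?_ (ENNReal.sum_le_tsum s)
  induction s using Finset.induction_on with
  | empty => simp [hp0]
  | insert i s hi ih =>
    rw [Finset.sum_insert hi, Finset.sum_insert hi]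
    exact (ENNReal.rpow_add_le_add_rpow _ _ hp0.le hp1).trans (add_le_add le_rfl ih)

/-- The function `∑ d_i (1 - ρ_i z)^{-N}`. -/
noncomputable def cauchySum (N : ℝ) (d ρ : ℕ → ℝ) (z : ℂ) : ℂ :=
  ∑' i, (d i : ℂ) * cpowKernel N z (ρ i)

section CauchySum

variable {N : ℝ} {d ρ : ℕ → ℝ}

theorem ofReal_mem_ball {x : ℝ} (hx : x ∈ Set.Ioo (0 : ℝ) 1) : (x : ℂ) ∈ Metric.ball (0 : ℂ) 1 := by
  rw [mem_ball_zero_iff, Complex.norm_real, Real.norm_of_nonneg hx.1.le]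
  exact hx.2

theorem exists_summable_bound_cauchySum (hN : 0 ≤ N) (hd : Summable d) (hd0 : ∀ i, 0 ≤ d i)
    (hρ : ∀ i, ρ i ∈ Set.Ioo (0 : ℝ) 1) {r : ℝ} (hr : r < 1) :
    ∃ u : ℕ → ℝ, Summable u ∧ ∀ i, ∀ w ∈ Metric.ball (0 : ℂ) r,
      ‖(d i : ℂ) * cpowKernel N w (ρ i)‖ ≤ u i := by
  obtain ⟨B, hB⟩ := (discKernel_cpowKernel hN).bound r hr
  refine ⟨fun i => d i * B, hd.mul_right B, fun i w hw => ?_⟩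
  rw [mem_ball_zero_iff] at hw
  rw [norm_mul, Complex.norm_real, Real.norm_of_nonneg (hd0 i)]
  exact mul_le_mul_of_nonneg_left (hB w hw.le _ (ofReal_mem_ball (hρ i))).1 (hd0 i)

theorem differentiableOn_cauchySum_term (hN : 0 ≤ N) (hρ : ∀ i, ρ i ∈ Set.Ioo (0 : ℝ) 1) (i : ℕ) :
    DifferentiableOn ℂ (fun w => (d i : ℂ) * cpowKernel N w (ρ i)) (Metric.ball 0 1) := fun w hw =>
  (((discKernel_cpowKernel hN).hasDerivAt _ (ofReal_mem_ball (hρ i)) w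
    hw).differentiableAt.const_mul _).differentiableWithinAt

theorem hasDerivAt_cauchySum (hN : 0 ≤ N) (hd : Summable d) (hd0 : ∀ i, 0 ≤ d i)
    (hρ : ∀ i, ρ i ∈ Set.Ioo (0 : ℝ) 1) {z : ℂ} (hz : z ∈ Metric.ball (0 : ℂ) 1) :
    Summable (fun i => (d i : ℂ) * cpowKernel N z (ρ i)) ∧
    HasDerivAt (cauchySum N d ρ) (deriv (cauchySum N d ρ) z) z ∧
    HasSum (fun i => (d i : ℂ) * cpowKernel' N z (ρ i)) (deriv (cauchySum N d ρ) z) := by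
  rw [mem_ball_zero_iff] at hz
  obtain ⟨r, hr1, hr2⟩ := exists_between hz
  obtain ⟨u, hu, hub⟩ := exists_summable_bound_cauchySum hN hd hd0 hρ hr2
  have hzr : z ∈ Metric.ball (0 : ℂ) r := by rwa [mem_ball_zero_iff]
  have hsub : Metric.ball (0 : ℂ) r ⊆ Metric.ball 0 1 := Metric.ball_subset_ball hr2.le
  have hdiff : ∀ i, DifferentiableOn ℂ (fun w => (d i : ℂ) * cpowKernel N w (ρ i))
      (Metric.ball 0 r) := fun i => (differentiableOn_cauchySum_term hN hρ i).mono hsub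
  refine ⟨Summable.of_norm_bounded hu fun i => hub i z hzr, ?_, ?_⟩
  · have := Complex.differentiableOn_tsum_of_summable_norm hu hdiff Metric.isOpen_ball hub
    exact (this.differentiableAt (Metric.isOpen_ball.mem_nhds hzr)).hasDerivAt
  · have := Complex.hasSum_deriv_of_summable_norm hu hdiff Metric.isOpen_ball hub hzr
    have hterm : (fun i => deriv (fun w => (d i : ℂ) * cpowKernel N w (ρ i)) z) =
        fun i => (d i : ℂ) * cpowKernel' N z (ρ i) := funext fun i =>
      (((discKernel_cpowKernel hN).hasDerivAt _ (ofReal_mem_ball (hρ i)) z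
        (hsub hzr)).const_mul _).deriv
    rw [hterm] at this
    exact this

theorem differentiableOn_cauchySum (hN : 0 ≤ N) (hd : Summable d) (hd0 : ∀ i, 0 ≤ d i)
    (hρ : ∀ i, ρ i ∈ Set.Ioo (0 : ℝ) 1) :
    DifferentiableOn ℂ (cauchySum N d ρ) (Metric.ball 0 1) := fun _ hz =>
  (hasDerivAt_cauchySum hN hd hd0 hρ hz).2.1.differentiableAt.differentiableWithinAt

theorem hasSum_deriv_mul_cauchySum (hN : 0 ≤ N) (hd : Summable d) (hd0 : ∀ i, 0 ≤ d i)
    (hρ : ∀ i, ρ i ∈ Set.Ioo (0 : ℝ) 1) {z : ℂ} (hz : z ∈ Metric.ball (0 : ℂ) 1) :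
    HasSum (fun i => (d i : ℂ) * cpowKernelD N z (ρ i))
      (deriv (fun w => w * cauchySum N d ρ w) z) := by
  obtain ⟨h1, h2, h3⟩ := hasDerivAt_cauchySum hN hd hd0 hρ hz
  have h4 := (hasDerivAt_id' z).fun_mul h2
  rw [h4.deriv, one_mul]
  have h5 : HasSum (fun i => (d i : ℂ) * cpowKernel N z (ρ i) +
      z * ((d i : ℂ) * cpowKernel' N z (ρ i)))
      (cauchySum N d ρ z + z * deriv (cauchySum N d ρ) z) := h1.hasSum.add (h3.mul_left z)
  have hterm : (fun i => (d i : ℂ) * cpowKernelD N z (ρ i)) = fun i =>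
      (d i : ℂ) * cpowKernel N z (ρ i) + z * ((d i : ℂ) * cpowKernel' N z (ρ i)) := by
    funext i
    rw [cpowKernelD]
    ring
  rw [hterm]
  exact h5

/-- On the nontangential region all terms have nonnegative real part, so that each term bounds the
sum from below. -/
theorem le_norm_cauchySum (hN : 0 ≤ N) (hd : Summable d) (hd0 : ∀ i, 0 ≤ d i)
    (hρ : ∀ i, ρ i ∈ Set.Ioo (0 : ℝ) 1) {κ : ℝ} (hκ0 : 0 ≤ κ) (hκ1 : κ ≤ 1) (hκN : 4 * N * κ ≤ 1)
    (hρ' : ∀ i, 1 - ρ i ≤ 1 / 32) {z : ℂ} (hz : z ∈ Metric.ball (0 : ℂ) 1) (hzs : z ∈ stolz κ)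
    (i : ℕ) : d i * (((1 - ρ i) + ‖1 - z‖) ^ (-N) / 2) ≤ ‖cauchySum N d ρ z‖ := by
  have hre : ∀ i, ((1 - ρ i) + ‖1 - z‖) ^ (-N) / 2 ≤ (cpowKernel N z (ρ i)).re := by
    intro i
    have hρi := hρ i
    have hρs : (ρ i : ℂ) ∈ stolz κ := by
      refine ⟨?_, ?_⟩
      · simp only [Complex.ofReal_im, Complex.ofReal_re, abs_zero]
        exact mul_nonneg hκ0 (by linarith [hρi.2])
      · simpa using hρ' i
    obtain ⟨h1, h2⟩ := one_sub_conj_mul_sector hκ0 hκ1 hzs (re_lt_one_of_mem_ball hz) hρs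
      (re_lt_one_of_mem_ball (ofReal_mem_ball hρi))
    have h3 := re_cpow_neg_ge h1 h2 hN (by linarith)
    refine le_trans ?_ h3
    have h4 : 0 < ‖1 - (starRingEnd ℂ) (ρ i : ℂ) * z‖ := 
      norm_pos_iff.2 fun h0 => by rw [h0] at h1; simp at h1
    have h5 := norm_one_sub_conj_mul_le (z := z) (mem_ball_zero_iff.1 (ofReal_mem_ball hρi)).le
    have h6 : ‖(1 : ℂ) - (ρ i : ℂ)‖ = 1 - ρ i := by
      rw [← Complex.ofReal_one, ← Complex.ofReal_sub, Complex.norm_real,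
        Real.norm_of_nonneg (by linarith [hρi.2])]
    rw [h6] at h5
    have := Real.rpow_le_rpow_of_nonpos (z := -N) h4 h5 (by linarith)
    linarith
  have hpos : ∀ i, 0 ≤ ((1 - ρ i) + ‖1 - z‖) ^ (-N) / 2 := fun i => by
    have := (hρ i).2
    have : 0 ≤ (1 - ρ i) + ‖1 - z‖ := by linarith [norm_nonneg (1 - z)]
    positivity
  obtain ⟨h1, -, -⟩ := hasDerivAt_cauchySum hN hd hd0 hρ hz
  have h2 : HasSum (fun i => d i * (cpowKernel N z (ρ i)).re) (cauchySum N d ρ z).re := by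
    have := Complex.reCLM.hasSum h1.hasSum
    simpa [cauchySum] using this
  have h3 := le_hasSum h2 i fun l _ => mul_nonneg (hd0 l) ((hpos l).trans (hre l))
  refine le_trans ?_ (h3.trans (Complex.re_le_norm _))
  exact mul_le_mul_of_nonneg_left (hre i) (hd0 i)

end CauchySum

/-- The weighted norm of a single kernel. -/
theorem exists_lintegral_cpowKernelD_le {ω : ℝ → ℝ} {s A c C : ℝ} (hg : WeightGrowth ω s A c C)
    (hs : 1 < s) {p : ℝ} (hp0 : 0 < p) {N : ℝ} (hN : 0 ≤ N) (hNA : A < p * N) :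
    ∃ K > 0, ∀ x ∈ Set.Ioo (0 : ℝ) 1, ∫⁻ z, ‖cpowKernelD N z ((1 - x : ℝ) : ℂ)‖ₑ ^ p *
      ENNReal.ofReal (zeroExt ω (1 - ‖z‖) * (1 - ‖z‖) ^ (p - 2)) ∂discMeasure ≤
        ENNReal.ofReal (K * (ω x * x ^ (-(p * N)))) := by
  obtain ⟨K, hK, HK⟩ := hg.exists_forelliRudin (τ := p - 2) (e := p * (N + 1)) (by linarith)
    (by linarith)
  refine ⟨(N + 2) ^ p * K, by positivity, fun x hx => ?_⟩
  have hx' : 1 - x ∈ Set.Ioo (0 : ℝ) 1 := ⟨by linarith [hx.2], by linarith [hx.1]⟩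
  have hb := ofReal_mem_ball hx'
  have hne : ((1 - x : ℝ) : ℂ) ≠ 0 := by exact_mod_cast hx'.1.ne'
  have hnorm : 1 - ‖((1 - x : ℝ) : ℂ)‖ = x := by
    rw [Complex.norm_real, Real.norm_of_nonneg hx'.1.le]; ring
  have h1 := HK _ hb hne
  rw [hnorm, zeroExt_of_mem hx, show p - 2 + 2 - p * (N + 1) = -(p * N) by ring] at h1
  calc _ ≤ ∫⁻ z, ENNReal.ofReal ((N + 2) ^ p) * ENNReal.ofReal (zeroExt ω (1 - ‖z‖) *
        (1 - ‖z‖) ^ (p - 2) * ‖1 - ((1 - x : ℝ) : ℂ) * (starRingEnd ℂ) z‖ ^ (-(p * (N + 1))))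
          ∂discMeasure := by
        refine lintegral_mono_ae ?_
        filter_upwards [ae_mem_ball_discMeasure] with z hz
        have h2 := norm_cpowKernel_add_le hN hz hb
        have hpos := norm_one_sub_mul_conj_pos hz hb
        have h3 : ‖cpowKernelD N z ((1 - x : ℝ) : ℂ)‖ ^ p ≤ (N + 2) ^ p *
            ‖1 - ((1 - x : ℝ) : ℂ) * (starRingEnd ℂ) z‖ ^ (-(p * (N + 1))) := by
          refine (Real.rpow_le_rpow (norm_nonneg _) h2 hp0.le).trans (le_of_eq ?_)
          rw [Real.mul_rpow (by positivity) (by positivity), ← Real.rpow_mul hpos.le]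
          congr 2
          ring
        rw [← ofReal_norm, ENNReal.ofReal_rpow_of_nonneg (norm_nonneg _) hp0.le,
          ← ENNReal.ofReal_mul (by positivity), ← ENNReal.ofReal_mul (by positivity)]
        refine ENNReal.ofReal_le_ofReal ?_
        have hz1 : ‖z‖ < 1 := mem_ball_zero_iff.1 hz
        have h4 : 0 ≤ zeroExt ω (1 - ‖z‖) * (1 - ‖z‖) ^ (p - 2) := by
          have h5 : 0 ≤ 1 - ‖z‖ := by linarith
          exact mul_nonneg (zeroExt_nonneg hg.pos _) (by positivity)
        calc _ ≤ _ := mul_le_mul_of_nonneg_right h3 h4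
          _ = _ := by ring
    _ = ENNReal.ofReal ((N + 2) ^ p) * _ := lintegral_const_mul' _ _ ENNReal.ofReal_ne_top
    _ ≤ ENNReal.ofReal ((N + 2) ^ p) * ENNReal.ofReal (K * (ω x * x ^ (-(p * N)))) :=
        mul_le_mul' le_rfl h1
    _ = _ := by
        rw [← ENNReal.ofReal_mul (by positivity), mul_assoc]

theorem lintegral_weight_lt_top {ω : ℝ → ℝ} {s A c C : ℝ} (hg : WeightGrowth ω s A c C)
    (hs : 1 < s) {p : ℝ} (hp0 : 0 < p) :
    ∫⁻ z, ENNReal.ofReal (zeroExt ω (1 - ‖z‖) * (1 - ‖z‖) ^ (p - 2)) ∂discMeasure < ∞ := by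
  have hA : 0 ≤ A := by linarith [hg.exponent_le]
  obtain ⟨K, hK, HK⟩ := hg.exists_forelliRudin (τ := p - 2) (e := A + p + 1) (by linarith)
    (by linarith)
  have hhalf := ofReal_mem_ball (x := 1 / 2) ⟨by norm_num, by norm_num⟩
  have h1 := HK _ hhalf (by norm_num)
  have h2 : ∫⁻ z, ENNReal.ofReal (zeroExt ω (1 - ‖z‖) * (1 - ‖z‖) ^ (p - 2)) ∂discMeasure ≤
      ENNReal.ofReal (2 ^ (A + p + 1)) * ∫⁻ z, ENNReal.ofReal (zeroExt ω (1 - ‖z‖) *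
        (1 - ‖z‖) ^ (p - 2) * ‖1 - ((1 / 2 : ℝ) : ℂ) * (starRingEnd ℂ) z‖ ^ (-(A + p + 1)))
          ∂discMeasure := by
    rw [← lintegral_const_mul' _ _ ENNReal.ofReal_ne_top]
    refine lintegral_mono_ae ?_
    filter_upwards [ae_mem_ball_discMeasure] with z hz
    rw [← ENNReal.ofReal_mul (by positivity)]
    refine ENNReal.ofReal_le_ofReal ?_
    have hpos := norm_one_sub_mul_conj_pos hz hhalf
    have hz1 : ‖z‖ < 1 := mem_ball_zero_iff.1 hz
    have hle : ‖1 - ((1 / 2 : ℝ) : ℂ) * (starRingEnd ℂ) z‖ ≤ 2 := by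
      refine (norm_sub_le _ _).trans ?_
      rw [norm_one, norm_mul, Complex.norm_conj]
      have := mem_ball_zero_iff.1 hhalf
      nlinarith [norm_nonneg z]
    have h3 := Real.rpow_le_rpow_of_nonpos (z := -(A + p + 1)) hpos hle (by linarith)
    have h4 : 0 ≤ zeroExt ω (1 - ‖z‖) * (1 - ‖z‖) ^ (p - 2) := by
      have h5 : 0 ≤ 1 - ‖z‖ := by linarith
      exact mul_nonneg (zeroExt_nonneg hg.pos _) (by positivity)
    have h6 : (2 : ℝ) ^ (A + p + 1) * 2 ^ (-(A + p + 1)) = 1 := by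
      rw [← Real.rpow_add two_pos]; simp
    calc _ = (2 : ℝ) ^ (A + p + 1) * ((zeroExt ω (1 - ‖z‖) * (1 - ‖z‖) ^ (p - 2)) *
          2 ^ (-(A + p + 1))) := by rw [mul_left_comm, h6, mul_one]
      _ ≤ _ := by gcongr
  exact h2.trans_lt (ENNReal.mul_lt_top ENNReal.ofReal_lt_top
    (lt_of_le_of_lt h1 ENNReal.ofReal_lt_top))

/-- The coefficients of the lacunary test function with dyadic parameters `k_i`, normalized so that
the `p`-th power of the Besov norm of the `i`-th term is at most a constant times `2^{-i}`. -/
noncomputable def lacunaryCoeff (ω : ℝ → ℝ) (p N : ℝ) (k : ℕ → ℕ) (i : ℕ) : ℝ :=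
  ((1 / 2) ^ i * (ω (dyad (k i)))⁻¹) ^ (1 / p) * dyad (k i) ^ N

section Lacunary

variable {ω : ℝ → ℝ} {s A c C : ℝ} {p N : ℝ}

theorem lacunaryCoeff_nonneg (hg : WeightGrowth ω s A c C) (k : ℕ → ℕ) (i : ℕ) :
    0 ≤ lacunaryCoeff ω p N k i := by
  have h1 := hg.pos _ (dyad_mem_Ioo (k i))
  have h2 := dyad_pos (k i)
  unfold lacunaryCoeff
  positivity

theorem lacunaryCoeff_rpow (hg : WeightGrowth ω s A c C) (hp0 : 0 < p) (k : ℕ → ℕ) (i : ℕ) :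
    lacunaryCoeff ω p N k i ^ p =
      (1 / 2) ^ i * (ω (dyad (k i)) * dyad (k i) ^ (-(p * N)))⁻¹ := by
  have h1 := hg.pos _ (dyad_mem_Ioo (k i))
  have h2 := dyad_pos (k i)
  rw [lacunaryCoeff, Real.mul_rpow (by positivity) (by positivity), ← Real.rpow_mul (by positivity),
    ← Real.rpow_mul h2.le, one_div_mul_cancel hp0.ne', Real.rpow_one, Real.rpow_neg h2.le, mul_inv,
    inv_inv, mul_comm N p, mul_assoc]

theorem summable_lacunaryCoeff (hg : WeightGrowth ω s A c C) (hs : 0 ≤ s) (hp0 : 0 < p)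
    (hNA : A < p * N) (k : ℕ → ℕ) : Summable (lacunaryCoeff ω p N k) := by
  obtain ⟨K, hK, HK⟩ := hg.exists_rpow_le hs hNA.le
  have hq : ((1 : ℝ) / 2) ^ (1 / p) < 1 :=
    Real.rpow_lt_one (by norm_num) (by norm_num) (by positivity)
  refine Summable.of_nonneg_of_le (lacunaryCoeff_nonneg hg k) (fun i => ?_)
    ((summable_geometric_of_lt_one (by positivity) hq).mul_left (K ^ (1 / p)))
  have h1 := hg.pos _ (dyad_mem_Ioo (k i))
  have h2 := dyad_pos (k i)
  have h3 := HK _ (dyad_mem_Ioo (k i))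
  have h4 : dyad (k i) ^ N = (dyad (k i) ^ (p * N)) ^ (1 / p) := by
    rw [← Real.rpow_mul h2.le]; congr 1; field_simp
  have h5 : (((1 : ℝ) / 2) ^ (1 / p)) ^ i = ((1 / 2) ^ i) ^ (1 / p) := by
    rw [← Real.rpow_natCast, ← Real.rpow_natCast, ← Real.rpow_mul (by norm_num),
      ← Real.rpow_mul (by norm_num), mul_comm]
  rw [lacunaryCoeff, h4, h5, ← Real.mul_rpow (by positivity) (by positivity),
    ← Real.mul_rpow (by positivity) (by positivity)]
  refine Real.rpow_le_rpow (by positivity) ?_ (by positivity)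
  calc _ = (1 / 2) ^ i * ((ω (dyad (k i)))⁻¹ * dyad (k i) ^ (p * N)) := by ring
    _ ≤ (1 / 2) ^ i * ((ω (dyad (k i)))⁻¹ * (K * ω (dyad (k i)))) := by gcongr
    _ = _ := by field_simp

theorem one_sub_dyad_mem_Ioo (k : ℕ) : 1 - dyad k ∈ Set.Ioo (0 : ℝ) 1 :=
  ⟨by linarith [dyad_le k], by linarith [dyad_pos k]⟩

/-- The lacunary test function, a sum of powers of the Cauchy kernel concentrated near the dyadic
discs selected by `k`. The sequence `k` is arbitrary and need not be monotone. -/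
noncomputable def lacunaryFun (ω : ℝ → ℝ) (p N : ℝ) (k : ℕ → ℕ) : ℂ → ℂ :=
  cauchySum N (lacunaryCoeff ω p N k) fun i => 1 - dyad (k i)

theorem differentiableOn_lacunaryFun (hg : WeightGrowth ω s A c C) (hs : 0 ≤ s) (hp0 : 0 < p)
    (hN : 0 ≤ N) (hNA : A < p * N) (k : ℕ → ℕ) :
    DifferentiableOn ℂ (lacunaryFun ω p N k) (Metric.ball 0 1) :=
  differentiableOn_cauchySum hN (summable_lacunaryCoeff hg hs hp0 hNA k)
    (lacunaryCoeff_nonneg hg k) fun i => one_sub_dyad_mem_Ioo (k i)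

/-- The lacunary test function belongs to the one-variable Besov space. -/
theorem lintegral_deriv_lacunaryFun_lt_top (hg : WeightGrowth ω s A c C) (hs : 1 < s)
    (hp0 : 0 < p) (hp1 : p < 1) (hN : 0 ≤ N) (hNA : A < p * N) (hm : Measurable (zeroExt ω))
    (k : ℕ → ℕ) :
    ∫⁻ z, ‖deriv (fun w => w * lacunaryFun ω p N k w) z‖ₑ ^ p *
      ENNReal.ofReal (zeroExt ω (1 - ‖z‖) * (1 - ‖z‖) ^ (p - 2)) ∂discMeasure < ∞ := by
  obtain ⟨K, hK, HK⟩ := exists_lintegral_cpowKernelD_le hg hs hp0 hN hNA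
  have hs0 : 0 ≤ s := by linarith
  have hd := summable_lacunaryCoeff hg hs0 hp0 hNA k
  have hd0 := lacunaryCoeff_nonneg (p := p) (N := N) hg k
  have hρ : ∀ i, 1 - dyad (k i) ∈ Set.Ioo (0 : ℝ) 1 := fun i => one_sub_dyad_mem_Ioo (k i)
  have hmeas : ∀ x : ℂ, Measurable fun z => cpowKernelD N z x := fun x => by
    unfold cpowKernelD cpowKernel cpowKernel'
    fun_prop
  calc _ ≤ ∫⁻ z, ∑' i, (‖(lacunaryCoeff ω p N k i : ℂ)‖ₑ ^ p *
        (‖cpowKernelD N z ((1 - dyad (k i) : ℝ) : ℂ)‖ₑ ^ p *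
        ENNReal.ofReal (zeroExt ω (1 - ‖z‖) * (1 - ‖z‖) ^ (p - 2)))) ∂discMeasure := by
        refine lintegral_mono_ae ?_
        filter_upwards [ae_mem_ball_discMeasure] with z hz
        rw [lacunaryFun, ← (hasSum_deriv_mul_cauchySum hN hd hd0 hρ hz).tsum_eq]
        simp_rw [← mul_assoc]
        rw [ENNReal.tsum_mul_right]
        gcongr
        refine (ENNReal.rpow_le_rpow (enorm_tsum_le_tsum_enorm) hp0.le).trans ?_
        refine (ENNReal.tsum_rpow_le_tsum_rpow hp0 hp1.le _).trans (le_of_eq ?_)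
        refine tsum_congr fun i => ?_
        rw [enorm_mul, ENNReal.mul_rpow_of_nonneg _ _ hp0.le]
    _ = ∑' i, ‖(lacunaryCoeff ω p N k i : ℂ)‖ₑ ^ p *
        ∫⁻ z, ‖cpowKernelD N z ((1 - dyad (k i) : ℝ) : ℂ)‖ₑ ^ p *
        ENNReal.ofReal (zeroExt ω (1 - ‖z‖) * (1 - ‖z‖) ^ (p - 2)) ∂discMeasure := by
        rw [lintegral_tsum]
        · refine tsum_congr fun i => lintegral_const_mul' _ _ ?_
          exact ENNReal.rpow_ne_top_of_nonneg hp0.le enorm_ne_top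
        · intro i
          exact ((((hmeas _).enorm.pow_const p).mul
            (measurable_weight_factor hm (p - 2))).const_mul _).aemeasurable
    _ ≤ ∑' i : ℕ, ENNReal.ofReal (K * (1 / 2) ^ i) := by
        refine ENNReal.tsum_le_tsum fun i => ?_
        have h1 := hg.pos _ (dyad_mem_Ioo (k i))
        have h2 := dyad_pos (k i)
        refine (mul_le_mul' le_rfl (HK _ (dyad_mem_Ioo (k i)))).trans (le_of_eq ?_)
        rw [← ofReal_norm, Complex.norm_real, Real.norm_of_nonneg (hd0 i),
          ENNReal.ofReal_rpow_of_nonneg (hd0 i) hp0.le, lacunaryCoeff_rpow hg hp0,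
          ← ENNReal.ofReal_mul (by positivity)]
        congr 1
        field_simp
    _ < ∞ := by
        rw [← ENNReal.ofReal_tsum_of_nonneg (fun i => by positivity)
          ((summable_geometric_of_lt_one (by norm_num) (by norm_num)).mul_left K)]
        exact ENNReal.ofReal_lt_top

/-- The size of the lacunary test function on the dyadic discs selected by `k`. -/
theorem le_norm_lacunaryFun (hg : WeightGrowth ω s A c C) (hs : 0 ≤ s) (hp0 : 0 < p)
    (hN : 0 ≤ N) (hNA : A < p * N) {κ : ℝ} (hκ0 : 0 ≤ κ) (hκ1 : κ ≤ 1) (hκN : 4 * N * κ ≤ 1)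
    (k : ℕ → ℕ) (i : ℕ) {z : ℂ} (hz : z ∈ dyadBall κ (k i)) :
    4 ^ (-N) / 2 * ((1 / 2) ^ i * (ω (dyad (k i)))⁻¹) ^ (1 / p) ≤ ‖lacunaryFun ω p N k z‖ := by
  have h2 := dyad_pos (k i)
  have h1 := hg.pos _ (dyad_mem_Ioo (k i))
  have h3 := (dyadBall_bounds hκ1 hz).2.2.2
  refine le_trans ?_ (le_norm_cauchySum hN (summable_lacunaryCoeff hg hs hp0 hNA k)
    (lacunaryCoeff_nonneg hg k) (fun i => one_sub_dyad_mem_Ioo (k i)) hκ0 hκ1 hκN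
    (fun i => by linarith [dyad_le (k i)]) (dyadBall_subset_ball hκ1 _ hz)
    (dyadBall_subset_stolz hκ0 hκ1 _ hz) i)
  have h4 : (4 * dyad (k i)) ^ (-N) ≤ (1 - (1 - dyad (k i)) + ‖1 - z‖) ^ (-N) :=
    Real.rpow_le_rpow_of_nonpos (by linarith [norm_nonneg (1 - z)]) (by linarith) (by linarith)
  calc _ = lacunaryCoeff ω p N k i * ((4 * dyad (k i)) ^ (-N) / 2) := by
        have h5 : dyad (k i) ^ N * dyad (k i) ^ (-N) = 1 := by
          rw [← Real.rpow_add h2]; simp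
        rw [lacunaryCoeff, Real.mul_rpow (by norm_num) h2.le]
        linear_combination (-(4 ^ (-N) / 2 * ((1 / 2) ^ i * (ω (dyad (k i)))⁻¹) ^ (1 / p)) : ℝ) * h5
    _ ≤ _ := mul_le_mul_of_nonneg_left (by linarith) (lacunaryCoeff_nonneg hg k i)

end Lacunary

/-! ### Functions of one coordinate and product densities -/

theorem foldr_coordD_comp_coord {n : ℕ} (f : ℂ → ℂ) (j : Fin n) {l : List (Fin n)} (hl : l.Nodup)
    (z : Fin n → ℂ) : l.foldr coordD (fun z => f (z j)) z =
      if j ∈ l then deriv (fun w => w * f w) (z j) else f (z j) := by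
  induction l generalizing z with
  | nil => simp
  | cons i l ih =>
    obtain ⟨hi, hl'⟩ := List.nodup_cons.1 hl
    rw [List.foldr_cons, coordD_apply]
    simp_rw [ih hl']
    by_cases hij : j = i
    · subst hij
      simp [hi]
    · simp only [Function.update_of_ne hij, List.mem_cons, hij, false_or]
      split_ifs <;> simp

theorem besovD_comp_coord {n : ℕ} (f : ℂ → ℂ) (j : Fin n) (z : Fin n → ℂ) :
    besovD (fun z => f (z j)) z = deriv (fun w => w * f w) (z j) := by
  rw [besovD_eq_foldr_coordD, foldr_coordD_comp_coord f j (List.nodup_finRange n)]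
  simp

theorem memBesov_comp_coord {n : ℕ} {p : ℝ} (hp0 : 0 < p) (hp1 : p < 1) {ω : Fin n → ℝ → ℝ}
    (hω : ∀ j, RegularWeight (ω j)) (j : Fin n) {f : ℂ → ℂ}
    (hf : DifferentiableOn ℂ f (Metric.ball 0 1))
    (hwt : ∀ i, ∫⁻ z, ENNReal.ofReal (zeroExt (ω i) (1 - ‖z‖) * (1 - ‖z‖) ^ (p - 2))
      ∂discMeasure < ∞)
    (hD : ∫⁻ z, ‖deriv (fun w => w * f w) z‖ₑ ^ p *
      ENNReal.ofReal (zeroExt (ω j) (1 - ‖z‖) * (1 - ‖z‖) ^ (p - 2)) ∂discMeasure < ∞) :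
    MemBesov p ω fun z => f (z j) := by
  refine ⟨hf.comp (differentiable_apply j).differentiableOn fun z hz =>
    mem_ball_of_mem_polydisc hz j, ?_⟩
  refine (besovPow_le_lintegral hp0 hp1 hω _).1.trans_lt ?_
  simp_rw [besovD_comp_coord]
  have hsplit : ∀ z : Fin n → ℂ, ‖deriv (fun w => w * f w) (z j)‖ₑ ^ p *
      prodWeight ω (fun _ => p - 2) z = ∏ i, (if i = j then ‖deriv (fun w => w * f w) (z i)‖ₑ ^ p
        else 1) * ENNReal.ofReal (zeroExt (ω i) (1 - ‖z i‖) * (1 - ‖z i‖) ^ (p - 2)) := by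
    intro z
    rw [Finset.prod_mul_distrib, prodWeight, Finset.prod_ite_eq' Finset.univ j]
    simp
  simp_rw [hsplit]
  rw [lintegral_pi_prod_eq_prod (fun _ => discMeasure) (f := fun i w =>
    (if i = j then ‖deriv (fun w => w * f w) w‖ₑ ^ p else 1) *
      ENNReal.ofReal (zeroExt (ω i) (1 - ‖w‖) * (1 - ‖w‖) ^ (p - 2)))]
  · refine ENNReal.prod_lt_top fun i _ => ?_
    by_cases hij : i = j
    · subst hij
      simpa using hD
    · simpa [hij] using hwt i
  · intro i
    refine Measurable.mul ?_ (measurable_weight_factor (hω i).measurable_zeroExt (p - 2))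
    split_ifs
    · exact (measurable_deriv _).enorm.pow_const p
    · exact measurable_const

theorem ENNReal.lt_top_of_prod_lt_top {ι : Type*} [Fintype ι] {x : ι → ℝ≥0∞}
    (h0 : ∀ i, x i ≠ 0) (h : ∏ i, x i < ∞) (i : ι) : x i < ∞ := by
  classical
  rw [← Finset.mul_prod_erase _ _ (Finset.mem_univ i)] at h
  by_contra hcon
  rw [not_lt, top_le_iff] at hcon
  rw [hcon, ENNReal.top_mul (Finset.prod_ne_zero_iff.2 fun j _ => h0 j)] at h
  exact lt_irrefl _ h

theorem measurable_cpowKernelD (a : ℝ) :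
    Measurable fun q : ℂ × ℂ => cpowKernelD a q.1 q.2 := by
  unfold cpowKernelD cpowKernel cpowKernel'
  fun_prop

theorem measurable_discHankel {α : ℝ} {h : ℂ → ℝ} (hh : Measurable h) :
    Measurable (discHankel α h) := by
  have : StronglyMeasurable (Function.uncurry fun z ζ : ℂ =>
      (((1 - ‖ζ‖ ^ 2) ^ α * h ζ : ℝ) : ℂ) * cpowKernelD (α + 2) z ζ) := by
    refine Measurable.stronglyMeasurable ?_
    have h1 := measurable_cpowKernelD (α + 2)
    have h2 : Measurable fun q : ℂ × ℂ => (((1 - ‖q.2‖ ^ 2) ^ α * h q.2 : ℝ) : ℂ) := by fun_prop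
    exact h2.mul h1
  exact (this.integral_prod_right (ν := discMeasure)).measurable

/-- If the density of the Hankel operator is a product of one-variable densities, all of them
supported in a narrow nontangential region and bounded below on some dyadic disc, then each of the
one-variable factors of `D` of the conjugate Hankel operator has finite weighted norm. -/
theorem lintegral_discHankel_lt_top {n : ℕ} {p : ℝ} (hp0 : 0 < p) (hp1 : p < 1)
    {ω : Fin n → ℝ → ℝ} (hω : ∀ j, RegularWeight (ω j)) {s A c C α : Fin n → ℝ}
    (hg : ∀ j, WeightGrowth (ω j) (s j) (A j) (c j) (C j)) (hs : ∀ j, 0 ≤ s j)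
    (hα : ∀ j, -1 < α j) {κ : ℝ} (hκ0 : 0 < κ) (hκ1 : κ ≤ 1) (hκα : ∀ j, 4 * (α j + 3) * κ ≤ 1)
    {h : Fin n → ℂ → ℝ} (hh0 : ∀ j ζ, 0 ≤ h j ζ) (hhm : ∀ j, Measurable (h j))
    (hhs : ∀ j ζ, ζ ∉ stolz κ → h j ζ = 0)
    (hhk : ∀ j, ∃ k m, 0 < m ∧ ∀ ζ ∈ dyadBall κ k, m ≤ h j ζ) {g f : (Fin n → ℂ) → ℂ}
    (hdens : ∀ ζ ∈ polydisc n, hankelDensity α g f ζ =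
      ∏ j, (((1 - ‖ζ j‖ ^ 2) ^ α j * h j (ζ j) : ℝ) : ℂ))
    (hdef : HankelDefined α g f) (hmem : MemConjBesov p ω (hankel α g f)) (j : Fin n) :
    Integrable (fun ζ => (1 - ‖ζ‖ ^ 2) ^ α j * h j ζ) discMeasure ∧
      ∫⁻ z, ‖discHankel (α j) (h j) z‖ₑ ^ p *
        ENNReal.ofReal (zeroExt (ω j) (1 - ‖z‖) * (1 - ‖z‖) ^ (p - 2)) ∂discMeasure < ∞ := by
  have hQ := (hankelDefined_iff hα g f).1 hdef
  have hqm : ∀ j, Measurable fun ζ : ℂ => (1 - ‖ζ‖ ^ 2) ^ α j * h j ζ := fun j => by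
    have := hhm j
    fun_prop
  have hqint : ∀ j, Integrable (fun ζ => (1 - ‖ζ‖ ^ 2) ^ α j * h j ζ) discMeasure := by
    have hfin : ∏ j, ∫⁻ ζ, ‖(1 - ‖ζ‖ ^ 2) ^ α j * h j ζ‖ₑ ∂discMeasure < ∞ := by
      rw [← lintegral_pi_prod_eq_prod (fun _ => discMeasure) (f := fun j ζ =>
        ‖(1 - ‖ζ‖ ^ 2) ^ α j * h j ζ‖ₑ) fun j => (hqm j).enorm]
      refine lt_of_le_of_lt (le_of_eq ?_) hQ.2
      refine lintegral_polydisc_congr fun ζ hζ => ?_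
      rw [hdens ζ hζ, ← ofReal_norm, norm_prod, ENNReal.ofReal_prod_of_nonneg fun _ _ =>
        norm_nonneg _]
      refine Finset.prod_congr rfl fun i _ => ?_
      rw [Complex.norm_real, ofReal_norm]
    refine fun j => ⟨(hqm j).aestronglyMeasurable,
      ENNReal.lt_top_of_prod_lt_top (fun i hi => ?_) hfin j⟩
    obtain ⟨k, m, hm, hmk⟩ := hhk i
    rw [lintegral_eq_zero_iff (hqm i).enorm] at hi
    have h1 : discMeasure (dyadBall κ k) = 0 := by
      refine measure_mono_null (fun ζ hζ => ?_) (ae_iff.1 hi)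
      have h2 := dyadBall_subset_ball hκ1 k hζ
      rw [mem_ball_zero_iff] at h2
      have h3 : 0 < 1 - ‖ζ‖ ^ 2 := by nlinarith [norm_nonneg ζ]
      have h4 : 0 < (1 - ‖ζ‖ ^ 2) ^ α i * h i ζ :=
        mul_pos (by positivity) (hm.trans_le (hmk ζ hζ))
      simp only [Set.mem_ofPred_eq, Pi.zero_apply, enorm_eq_zero]
      exact h4.ne'
    have h5 := dyad_pos k
    rw [discMeasure_dyadBall hκ0.le hκ1, ENNReal.ofReal_eq_zero] at h1
    have : 0 < Real.pi * (κ / 4) ^ 2 * dyad k ^ (2 : ℝ) := by have := Real.pi_pos; positivity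
    linarith
  refine ⟨hqint j, ?_⟩
  have hprod : ∀ z ∈ polydisc n, besovD (conjFun (hankel α g f)) z =
      ∏ j, discHankel (α j) (h j) (z j) := by
    intro z hz
    rw [besovD_conjFun_hankel hα hQ hz]
    simp only [discHankel]
    rw [← integral_fintype_prod_eq_prod (μ := fun _ : Fin n => discMeasure) (f := fun j ζ =>
      (((1 - ‖ζ‖ ^ 2) ^ α j * h j ζ : ℝ) : ℂ) * cpowKernelD (α j + 2) (z j) ζ)]
    refine integral_congr_ae ?_
    filter_upwards [ae_mem_polydisc n] with ζ hζ
    rw [hdens ζ hζ, ← Finset.prod_mul_distrib]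
  have hfin : ∏ j, ∫⁻ z, ‖discHankel (α j) (h j) z‖ₑ ^ p *
      ENNReal.ofReal (zeroExt (ω j) (1 - ‖z‖) * (1 - ‖z‖) ^ (p - 2)) ∂discMeasure < ∞ := by
    rw [← lintegral_pi_prod_eq_prod (fun _ => discMeasure) (f := fun j z =>
      ‖discHankel (α j) (h j) z‖ₑ ^ p *
        ENNReal.ofReal (zeroExt (ω j) (1 - ‖z‖) * (1 - ‖z‖) ^ (p - 2)))]
    · have h1 := (besovPow_le_lintegral hp0 hp1 hω (conjFun (hankel α g f))).2.trans_lt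
        (ENNReal.mul_lt_top ENNReal.ofReal_lt_top hmem.2)
      refine lt_of_le_of_lt (le_of_eq ?_) h1
      refine lintegral_polydisc_congr fun z hz => ?_
      rw [hprod z hz, Finset.prod_mul_distrib, prodWeight, ← ofReal_norm, norm_prod,
        ENNReal.ofReal_prod_of_nonneg fun _ _ => norm_nonneg _, ENNReal.prod_rpow_of_nonneg hp0.le]
      simp_rw [ofReal_norm]
    · intro i
      exact ((measurable_discHankel (hhm i)).enorm.pow_const p).mul
        (measurable_weight_factor (hω i).measurable_zeroExt (p - 2))
  refine ENNReal.lt_top_of_prod_lt_top (fun i hi => ?_) hfin j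
  obtain ⟨k, m, hm, hmk⟩ := hhk i
  obtain ⟨c1, hc1, H1⟩ := exists_le_lintegral_discHankel (hg i) (hs i) hp0 (hα i) hκ0 hκ1 (hκα i)
  have h1 := H1 (h i) (hh0 i) (hhs i) (hqint i) m hm.le k hmk
  rw [hi, nonpos_iff_eq_zero, ENNReal.ofReal_eq_zero] at h1
  have h2 : 0 < ∑ l ∈ Finset.range (k + 1), ω i (dyad l) * dyad l ^ (-(p * (α i + 2))) :=
    Finset.sum_pos (fun l _ => mul_pos ((hg i).pos _ (dyad_mem_Ioo l))
      (Real.rpow_pos_of_pos (dyad_pos l) _)) (by simp)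
  have h3 := dyad_pos k
  have h4 : 0 < c1 * m ^ p * dyad k ^ (p * (α i + 2)) := by positivity
  have := mul_pos h4 h2
  linarith

/-! ### Necessity of the condition on the weights -/

/-- Necessity. If the condition fails in the variable `z_j`, then a suitable lacunary function of
`z_j` and a symbol cancelling its argument in a nontangential region violate the mapping property.
The argument of the operator is a function `F f` with `|F f| = |f|`; this covers both `f` and its
complex conjugate. -/
theorem alphaIndex_lt_of_forall_memConjBesov {n : ℕ} {p : ℝ} (hp0 : 0 < p) (hp1 : p < 1)
    {ω : Fin n → ℝ → ℝ} (hω : ∀ j, RegularWeight (ω j)) (hβ : ∀ j, betaIndex (ω j) < -1)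
    {α : Fin n → ℝ} (hα : ∀ j, -1 < α j)
    {F : ((Fin n → ℂ) → ℂ) → (Fin n → ℂ) → ℂ} (hF : ∀ f z, ‖F f z‖ = ‖f z‖)
    (hFm : ∀ f, ContinuousOn f (polydisc n) → ContinuousOn (F f) (polydisc n))
    (H : ∀ f g : (Fin n → ℂ) → ℂ, MemBesov p ω f → MemLinfty g →
      HankelDefined α g (F f) ∧ MemConjBesov p ω (hankel α g (F f))) (j : Fin n) :
    alphaIndex (ω j) < p * (α j + 2) := by
  choose s c C hs hg using fun j => (hω j).exists_growth (hβ j) (lt_add_one (alphaIndex (ω j)))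
  obtain ⟨A, hA⟩ : ∃ A : Fin n → ℝ, A = fun j => alphaIndex (ω j) + 1 := ⟨_, rfl⟩
  have hg' : ∀ j, WeightGrowth (ω j) (s j) (A j) (c j) (C j) := hA ▸ hg
  have hs0 : ∀ j, 0 ≤ s j := fun j => by linarith [hs j]
  have hA0 : 0 ≤ A j := (hs0 j).trans (hg' j).exponent_le
  obtain ⟨N, hN⟩ : ∃ N : ℝ, N = A j / p + 1 := ⟨_, rfl⟩
  have hN0 : 0 ≤ N := by rw [hN]; positivity
  have hNA : A j < p * N := by
    rw [hN, mul_add, mul_div_cancel₀ _ hp0.ne']; linarith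
  have hm : Measurable (zeroExt (ω j)) := (hω j).measurable_zeroExt
  have hα3 : ∀ i, 0 < α i + 3 := fun i => by linarith [hα i]
  -- the aperture of the nontangential region
  obtain ⟨κ, hκ0, hκ1, hκN, hκα⟩ : ∃ κ : ℝ, 0 < κ ∧ κ ≤ 1 ∧ 4 * N * κ ≤ 1 ∧
      ∀ i, 4 * (α i + 3) * κ ≤ 1 := by
    have hsum : 0 ≤ ∑ i, (α i + 3) := Finset.sum_nonneg fun i _ => (hα3 i).le
    have hden : 0 < 4 * (N + ∑ i, (α i + 3) + 1) := by positivity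
    refine ⟨1 / (4 * (N + ∑ i, (α i + 3) + 1)), by positivity, ?_, ?_, fun i => ?_⟩
    · rw [div_le_one hden]; linarith
    · rw [mul_one_div, div_le_one hden]; linarith
    · have := Finset.single_le_sum (f := fun i => α i + 3) (fun i _ => (hα3 i).le)
        (Finset.mem_univ i)
      rw [mul_one_div, div_le_one hden]
      linarith
  by_contra hcon
  -- the dyadic sums are not dominated by their last terms
  have hb : 0 < p * (α j + 2) := mul_pos hp0 (by linarith [hα j])
  have hbig : ∀ i : ℕ, ∃ k, 4 ^ i * (ω j (dyad k) * dyad k ^ (-(p * (α j + 2)))) <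
      ∑ l ∈ Finset.range (k + 1), ω j (dyad l) * dyad l ^ (-(p * (α j + 2))) := by
    intro i
    by_contra! h
    exact hcon (alphaIndex_lt_of_dyadic_sum_le (hg' j) (hs0 j) hb h)
  choose k hk using hbig
  obtain ⟨φ, hφ⟩ : ∃ φ, φ = lacunaryFun (ω j) p N k := ⟨_, rfl⟩
  have hφd : DifferentiableOn ℂ φ (Metric.ball 0 1) :=
    hφ ▸ differentiableOn_lacunaryFun (hg' j) (hs0 j) hp0 hN0 hNA k
  have hφle : ∀ i, ∀ ζ ∈ dyadBall κ (k i),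
      4 ^ (-N) / 2 * ((1 / 2) ^ i * (ω j (dyad (k i)))⁻¹) ^ (1 / p) ≤ ‖φ ζ‖ := fun i ζ hζ =>
    hφ ▸ le_norm_lacunaryFun (hg' j) (hs0 j) hp0 hN0 hNA hκ0.le hκ1 hκN k i hζ
  have hmem : MemBesov p ω fun z => φ (z j) :=
    memBesov_comp_coord hp0 hp1 hω j hφd
      (fun i => lintegral_weight_lt_top (hg' i) (hs i) hp0)
      (hφ ▸ lintegral_deriv_lacunaryFun_lt_top (hg' j) (hs j) hp0 hp1 hN0 hNA hm k)
  obtain ⟨f, hf⟩ : ∃ f : (Fin n → ℂ) → ℂ, f = F fun z => φ (z j) := ⟨_, rfl⟩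
  have hfn : ∀ z, ‖f z‖ = ‖φ (z j)‖ := fun z => by rw [hf, hF]
  -- the symbol cancels the argument of `f` and localizes to the nontangential region
  obtain ⟨g, hgdef⟩ : ∃ g : (Fin n → ℂ) → ℂ, g = fun ζ =>
      (∏ i, (stolz κ).indicator (fun _ => (1 : ℂ)) (ζ i)) *
        ((starRingEnd ℂ) (f ζ) * (((‖f ζ‖⁻¹ : ℝ)) : ℂ)) := ⟨_, rfl⟩
  have hind : ∀ ζ : ℂ, ‖(stolz κ).indicator (fun _ => (1 : ℂ)) ζ‖ ≤ 1 := fun ζ => by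
    by_cases h : ζ ∈ stolz κ <;> simp [h]
  have hgL : MemLinfty g := by
    rw [MemLinfty, restrict_polydisc]
    have hfm : AEStronglyMeasurable f (polydiscMeasure n) := by
      rw [hf]
      exact (hFm _ hmem.1.continuousOn).aestronglyMeasurable_polydisc
    refine memLp_top_of_bound ?_ 1 (Filter.Eventually.of_forall fun ζ => ?_)
    · rw [hgdef]
      refine AEStronglyMeasurable.mul ?_ (AEStronglyMeasurable.mul ?_ ?_)
      · refine Measurable.aestronglyMeasurable (Finset.measurable_prod _ fun i _ => ?_)
        exact (measurable_const.indicator (measurableSet_stolz κ)).comp (measurable_pi_apply i)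
      · exact Complex.continuous_conj.comp_aestronglyMeasurable hfm
      · exact Complex.continuous_ofReal.comp_aestronglyMeasurable
          hfm.norm.aemeasurable.inv.aestronglyMeasurable
    · rw [hgdef]
      simp only
      rw [norm_mul, norm_mul, norm_prod, Complex.norm_conj, Complex.norm_real, norm_inv, norm_norm]
      refine mul_le_one₀ (Finset.prod_le_one (fun _ _ => norm_nonneg _) fun i _ => hind _)
        (by positivity) mul_inv_le_one
  obtain ⟨hdef, hcb⟩ := H _ g hmem hgL
  rw [← hf] at hdef hcb
  -- the resulting one-variable densities
  obtain ⟨h, hh⟩ : ∃ h : Fin n → ℂ → ℝ, h = fun i => (stolz κ).indicator fun ζ =>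
      if i = j then ‖(Metric.ball (0 : ℂ) 1).indicator φ ζ‖ else 1 := ⟨_, rfl⟩
  have hh0 : ∀ i ζ, 0 ≤ h i ζ := fun i ζ => by
    rw [hh]
    refine Set.indicator_nonneg (fun ζ _ => ?_) ζ
    split_ifs <;> positivity
  have hhm : ∀ i, Measurable (h i) := fun i => by
    rw [hh]
    refine Measurable.indicator ?_ (measurableSet_stolz κ)
    split_ifs
    · exact (hφd.continuousOn.measurable_indicator_of_measurableSet measurableSet_ball).norm
    · exact measurable_const
  have hhs : ∀ i ζ, ζ ∉ stolz κ → h i ζ = 0 := fun i ζ hζ => by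
    rw [hh]; exact Set.indicator_of_notMem hζ _
  have hhj : ∀ i, ∀ ζ ∈ dyadBall κ (k i),
      4 ^ (-N) / 2 * ((1 / 2) ^ i * (ω j (dyad (k i)))⁻¹) ^ (1 / p) ≤ h j ζ := by
    intro i ζ hζ
    rw [hh]
    dsimp only
    rw [Set.indicator_of_mem (dyadBall_subset_stolz hκ0.le hκ1 _ hζ), if_pos rfl,
      Set.indicator_of_mem (dyadBall_subset_ball hκ1 _ hζ)]
    exact hφle i ζ hζ
  have hmpos : ∀ i, 0 < (4 : ℝ) ^ (-N) / 2 * ((1 / 2) ^ i * (ω j (dyad (k i)))⁻¹) ^ (1 / p) :=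
    fun i => by
      have := (hg' j).pos _ (dyad_mem_Ioo (k i))
      positivity
  have hhk : ∀ i, ∃ k m, 0 < m ∧ ∀ ζ ∈ dyadBall κ k, m ≤ h i ζ := by
    intro i
    by_cases hij : i = j
    · subst hij
      exact ⟨k 0, _, hmpos 0, hhj 0⟩
    · refine ⟨0, 1, one_pos, fun ζ hζ => ?_⟩
      rw [hh]
      simp only
      rw [Set.indicator_of_mem (dyadBall_subset_stolz hκ0.le hκ1 _ hζ), if_neg hij]
  have hdens : ∀ ζ ∈ polydisc n, hankelDensity α g f ζ =
      ∏ i, (((1 - ‖ζ i‖ ^ 2) ^ α i * h i (ζ i) : ℝ) : ℂ) := by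
    intro ζ hζ
    have h1 : f ζ * g ζ = ∏ i, ((h i (ζ i) : ℝ) : ℂ) := by
      have h2 : ∀ i, ((h i (ζ i) : ℝ) : ℂ) = (stolz κ).indicator (fun _ => (1 : ℂ)) (ζ i) *
          (if i = j then ((‖φ (ζ i)‖ : ℝ) : ℂ) else 1) := by
        intro i
        rw [hh]
        simp only
        by_cases h3 : ζ i ∈ stolz κ
        · rw [Set.indicator_of_mem h3, Set.indicator_of_mem h3, one_mul,
            Set.indicator_of_mem (mem_ball_of_mem_polydisc hζ i)]
          split_ifs <;> simp
        · simp [Set.indicator_of_notMem h3]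
      simp_rw [h2]
      rw [Finset.prod_mul_distrib, Finset.prod_ite_eq' Finset.univ j, if_pos (Finset.mem_univ j),
        ← hfn, hgdef]
      simp only
      rw [mul_left_comm, ← mul_assoc (f ζ), Complex.mul_conj, Complex.normSq_eq_norm_sq,
        ← Complex.ofReal_mul]
      congr 2
      rcases eq_or_ne ‖f ζ‖ 0 with h0 | h0
      · rw [h0]; simp
      · field_simp
    rw [hankelDensity, mul_assoc, h1, ← Finset.prod_mul_distrib, map_prod]
    refine Finset.prod_congr rfl fun i _ => ?_
    rw [← Complex.ofReal_mul, Complex.conj_ofReal]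
  obtain ⟨hint, hfin⟩ := lintegral_discHankel_lt_top hp0 hp1 hω hg' hs0 hα hκ0 hκ1 hκα hh0 hhm hhs
    hhk hdens hdef hcb j
  obtain ⟨c1, hc1, H1⟩ := exists_le_lintegral_discHankel (hg' j) (hs0 j) hp0 (hα j) hκ0 hκ1 (hκα j)
  obtain ⟨T, hT⟩ := ENNReal.lt_iff_exists_nnreal_btwn.1 hfin
  -- the lower bounds on the dyadic discs are unbounded
  have hlow : ∀ i : ℕ, c1 * (4 ^ (-N) / 2) ^ p * 2 ^ i ≤ (T : ℝ) := by
    intro i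
    have h1 := (H1 (h j) (hh0 j) (hhs j) hint _ (hmpos i).le (k i) (hhj i)).trans hT.1.le
    rw [← ENNReal.ofReal_coe_nnreal] at h1
    refine le_trans ?_ ((ENNReal.ofReal_le_ofReal_iff T.2).1 h1)
    have hω1 := (hg' j).pos _ (dyad_mem_Ioo (k i))
    have hd := dyad_pos (k i)
    rw [Real.mul_rpow (by positivity) (by positivity), ← Real.rpow_mul (by positivity),
      one_div_mul_cancel hp0.ne', Real.rpow_one]
    calc _ = c1 * ((4 ^ (-N) / 2) ^ p * ((1 / 2) ^ i * (ω j (dyad (k i)))⁻¹)) *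
          dyad (k i) ^ (p * (α j + 2)) *
            (4 ^ i * (ω j (dyad (k i)) * dyad (k i) ^ (-(p * (α j + 2))))) := by
          rw [Real.rpow_neg hd.le, show (4 : ℝ) ^ i = 2 ^ i * 2 ^ i by rw [← mul_pow]; norm_num,
            one_div, inv_pow]
          field_simp
      _ ≤ _ := by gcongr; exact (hk i).le
  have hc2 : 0 < c1 * (4 ^ (-N) / 2) ^ p := by positivity
  obtain ⟨i, hi⟩ := pow_unbounded_of_one_lt ((T : ℝ) / (c1 * (4 ^ (-N) / 2) ^ p)) one_lt_two
  rw [div_lt_iff₀ hc2] at hi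
  linarith [hlow i]

theorem mainTheorem1 (n : ℕ) (hn : 0 < n) (p : ℝ) (hp0 : 0 < p) (hp1 : p < 1)
    (ω : Fin n → ℝ → ℝ) (hω : ∀ j, RegularWeight (ω j)) (hβ : ∀ j, betaIndex (ω j) < -1)
    (α : Fin n → ℝ) (hα : ∀ j, -1 < α j) :
    ((∀ f g : (Fin n → ℂ) → ℂ, MemBesov p ω f → MemLinfty g →
        HankelDefined α g f ∧ MemConjBesov p ω (hankel α g f)) ↔
      ∀ j, alphaIndex (ω j) / p - 2 < α j) ∧
    ((∀ f g : (Fin n → ℂ) → ℂ, MemConjBesov p ω f → MemLinfty g →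
        HankelDefined α g f ∧ MemConjBesov p ω (hankel α g f)) ↔
      ∀ j, alphaIndex (ω j) / p - 2 < α j) ∧
    ((∀ j, alphaIndex (ω j) / p - 2 < α j) →
      ∃ C : ℝ≥0, ∀ g : (Fin n → ℂ) → ℂ, MemLinfty g →
        (∀ f : (Fin n → ℂ) → ℂ, MemBesov p ω f →
          besovNorm p ω (conjFun (hankel α g f)) ≤ C * linftyNorm g * besovNorm p ω f) ∧
        (∀ f : (Fin n → ℂ) → ℂ, MemConjBesov p ω f →
          besovNorm p ω (conjFun (hankel α g f)) ≤
            C * linftyNorm g * besovNorm p ω (conjFun f))) := by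
  have hcond : ∀ j, alphaIndex (ω j) < p * (α j + 2) ↔ alphaIndex (ω j) / p - 2 < α j := fun j => by
    rw [sub_lt_iff_lt_add, div_lt_iff₀ hp0, mul_comm]
  have hconj : ∀ f : (Fin n → ℂ) → ℂ, conjFun (conjFun f) = f := fun f => by
    ext z; simp [conjFun]
  have hmeas : ∀ f : (Fin n → ℂ) → ℂ, MemBesov p ω f →
      AEStronglyMeasurable f (polydiscMeasure n) := fun f hf =>
    hf.1.continuousOn.aestronglyMeasurable_polydisc
  have hmeas' : ∀ f : (Fin n → ℂ) → ℂ, MemConjBesov p ω f →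
      AEStronglyMeasurable f (polydiscMeasure n) := fun f hf => by
    have := Complex.continuous_conj.comp_aestronglyMeasurable (hmeas _ hf)
    exact (hconj f) ▸ this
  have hnorm : ∀ (f : (Fin n → ℂ) → ℂ) (z : Fin n → ℂ), ‖conjFun f z‖ = ‖f z‖ := fun f z =>
    Complex.norm_conj _
  refine ⟨⟨fun H j => ?_, fun h => ?_⟩, ⟨fun H j => ?_, fun h => ?_⟩, fun h => ?_⟩
  · exact (hcond j).1 (alphaIndex_lt_of_forall_memConjBesov hp0 hp1 hω hβ hα (F := id)
      (fun _ _ => rfl) (fun _ hf => hf) H j)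
  · obtain ⟨C, hC⟩ := exists_hankel_bound hp0 hp1 hω hβ hα h
    intro f g hf hg
    obtain ⟨h1, h2, -⟩ := hC f f g (fun _ _ => rfl) (hmeas f hf) hf hg
    exact ⟨h1, h2⟩
  · refine (hcond j).1 (alphaIndex_lt_of_forall_memConjBesov hp0 hp1 hω hβ hα (F := conjFun)
      hnorm (fun f hf => Complex.continuous_conj.comp_continuousOn hf) (fun f g hf hg => ?_) j)
    refine H (conjFun f) g ?_ hg
    rw [MemConjBesov, hconj]
    exact hf
  · obtain ⟨C, hC⟩ := exists_hankel_bound hp0 hp1 hω hβ hα h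
    intro f g hf hg
    obtain ⟨h1, h2, -⟩ := hC f (conjFun f) g (fun z _ => (hnorm f z).symm) (hmeas' f hf) hf hg
    exact ⟨h1, h2⟩
  · obtain ⟨C, hC⟩ := exists_hankel_bound hp0 hp1 hω hβ hα h
    refine ⟨C, fun g hg => ⟨fun f hf => ?_, fun f hf => ?_⟩⟩
    · exact (hC f f g (fun _ _ => rfl) (hmeas f hf) hf hg).2.2
    · exact (hC f (conjFun f) g (fun z _ => (hnorm f z).symm) (hmeas' f hf) hf hg).2.2
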